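/- Consider an edge-to-edge tiling of the unit sphere by $f$ congruent (possibly reflected) simple geodesic quadrilaterals $ABCD$ in which every vertex has degree at least $3$. Suppose that the edges of the tile satisfy $AB=DA=a$, $BC=b$, $CD=c$ with $a,b,c$ pairwise distinct, and let $\alpha,\beta,\gamma,\delta$ be its interior angles at $A,B,C,D$. We say that $\alpha^k\beta^l\gamma^m\delta^n$ is a vertex if some vertex of the tiling is surrounded by exactly $k$ angles $\alpha$, $l$ angles $\beta$, $m$ angles $\gamma$ and $n$ angles $\delta$ (each angle being identified by its position in the tile, not by its value; zero exponents are omitted), and we let $\mathrm{AVC}$ be the set of all $\alpha^k\beta^l\gamma^m\delta^n$ that are vertices of the tiling. Suppose that $\alpha\beta^2$ is a vertex, that it is the only vertex of degree $3$ in $\mathrm{AVC}$, and that $\gamma^2\delta^2$ is not a vertex. Then $$\alpha=\pi-\frac{8\pi}{f},\qquad \beta=\frac{\pi}{2}+\frac{4\pi}{f},\qquad \gamma=\frac{\pi}{2},\qquad \delta=\frac{8\pi}{f},$$ and one of the following holds: 1. $f=16$ and $\mathrm{AVC}=\{\alpha\beta^2,\ \alpha^2\delta^2,\ \gamma^4,\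 \delta^4\}$; 2. $f>16$, $f$ is divisible by $8$, and $$\{\alpha\beta^2,\alpha^2\delta^2,\gamma^4\}\subseteq\mathrm{AVC}\subseteq\{\alpha\beta^2,\ \alpha^2\delta^2,\ \gamma^4,\ \alpha\delta^{(f+8)/8},\ \beta^2\delta^{(f-8)/8},\ \delta^{f/4}\}.$$ -/

import Mathlib

open Real Set

/-- Euclidean three-space. -/
abbrev E3 : Type := EuclideanSpace ℝ (Fin 3)

/-- The unit sphere. -/
abbrev S2 : Type := Metric.sphere (0 : E3) 1

/-- The point at (angular) distance `t` from `p` on the great circle that leaves `p` in the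
unit tangent direction `u`. -/
noncomputable def geodesic (p u : E3) (t : ℝ) : E3 := cos t • p + sin t • u

/-- The velocity of that great circle after distance `t`. -/
noncomputable def geodesicVelocity (p u : E3) (t : ℝ) : E3 := (-sin t) • p + cos t • u

/-- `u` is a unit tangent vector of the sphere at `p`. -/
def IsUnitTangent (p : S2) (u : E3) : Prop := ‖u‖ = 1 ∧ inner ℝ (p : E3) u = 0

/-- The geodesic arc of length `l` that leaves `p` in direction `u`. -/
def geodesicArc (p : S2) (u : E3) (l : ℝ) : Set S2 :=
  {x | ∃ t ∈ Icc (0 : ℝ) l, (x : E3) = geodesic p u t}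

/-- The set `R` has interior angle `θ` at `p` between the unit tangent directions `u` and `v`:
in polar coordinates around `p`, with polar angle measured from `u` in the sense of rotation
towards a unit tangent vector `w` orthogonal to `u`, the set `R` coincides near `p` with the
closed sector of polar angles between `0` (the direction `u`) and `θ` (the direction `v`). -/
def IsInteriorAngle (R : Set S2) (p : S2) (u v : E3) (θ : ℝ) : Prop :=
  0 < θ ∧ θ < 2 * π ∧
    ∃ w : E3, IsUnitTangent p w ∧ inner ℝ u w = 0 ∧ v = cos θ • u + sin θ • w ∧
      ∃ r > 0, ∀ s ∈ Ioo (0 : ℝ) r, ∀ φ ∈ Ico (0 : ℝ) (2 * π), ∀ x : S2,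
        (x : E3) = geodesic p (cos φ • u + sin φ • w) s → (x ∈ R ↔ φ ≤ θ)

/-- A simple closed curve on the sphere made of four geodesic arcs. The corners `0, 1, 2, 3` are
`A, B, C, D`, and side `k` leads from corner `k` to corner `k + 1` (so the sides are
`AB, BC, CD, DA`). -/
structure SimpleQuadrilateral where
  corner : Fin 4 → S2
  /-- the direction in which side `k` leaves corner `k` -/
  dir : Fin 4 → E3
  /-- the length of side `k` -/
  len : Fin 4 → ℝ
  isUnitTangent_dir : ∀ k, IsUnitTangent (corner k) (dir k)
  len_pos : ∀ k, 0 < len k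
  len_lt : ∀ k, len k < 2 * π
  corner_succ : ∀ k, (corner (k + 1) : E3) = geodesic (corner k) (dir k) (len k)
  adjacent_sides : ∀ k,
    geodesicArc (corner k) (dir k) (len k) ∩
      geodesicArc (corner (k + 1)) (dir (k + 1)) (len (k + 1)) = {corner (k + 1)}
  opposite_sides : ∀ k,
    Disjoint (geodesicArc (corner k) (dir k) (len k))
      (geodesicArc (corner (k + 2)) (dir (k + 2)) (len (k + 2)))

/-- Side `k` of the quadrilateral, as a set of points. -/
def SimpleQuadrilateral.side (Q : SimpleQuadrilateral) (k : Fin 4) : Set S2 :=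
  geodesicArc (Q.corner k) (Q.dir k) (Q.len k)

/-- A quadrilateral tile: a closed region of the sphere (either side of the curve) bounded by a
simple quadrilateral, together with its interior angles. The angles `0, 1, 2, 3` are
`α, β, γ, δ`, at the corners `A, B, C, D`. At corner `k + 1` the two sides leave in the direction
`dir (k + 1)` and in the direction opposite to the final velocity of side `k`. -/
structure QuadTile extends SimpleQuadrilateral where
  region : Set S2
  isClosed_region : IsClosed region
  nonempty_interior : (interior region).Nonempty
  frontier_region : frontier region = ⋃ k, toSimpleQuadrilateral.side k
  angle : Fin 4 → ℝ
  isInteriorAngle : ∀ k, IsInteriorAngle region (corner (k + 1)) (dir (k + 1))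
    (-geodesicVelocity (corner k) (dir k) (len k)) (angle (k + 1))

/-- The edge combination `a²bc` with `a, b, c` distinct: `AB = DA = a`, `BC = b`, `CD = c`.
So `α` lies between the two `a`-edges, `β` between `a` and `b`, `γ` between `b` and `c`,
`δ` between `c` and `a`. -/
def QuadTile.IsA2BC (Q : QuadTile) : Prop :=
  Q.len 3 = Q.len 0 ∧ Q.len 0 ≠ Q.len 1 ∧ Q.len 0 ≠ Q.len 2 ∧ Q.len 1 ≠ Q.len 2

/-- The action of an orthogonal transformation (rotation or rotation-reflection) on the sphere. -/
noncomputable def move (g : E3 ≃ₗᵢ[ℝ] E3) (x : S2) : S2 := ⟨g x, by simp⟩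

/-- The number of copies of `α, β, γ, δ` at the point `x`, when copies of the tile `Q` are placed
by the orthogonal transformations `g i`. -/
noncomputable def vertexType (Q : QuadTile) {f : ℕ} (g : Fin f → E3 ≃ₗᵢ[ℝ] E3) (x : S2) :
    Fin 4 → ℕ :=
  fun k => {i : Fin f | move (g i) (Q.corner k) = x}.ncard

/-- The degree of a vertex of type `t`, i.e. the number of angles at it. -/
def degree (t : Fin 4 → ℕ) : ℕ := t 0 + t 1 + t 2 + t 3

/-- The `f` congruent copies `g i (Q)` of the tile `Q` form an edge-to-edge tiling of the sphere
in which every vertex has degree at least three. -/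
structure IsEdgeToEdgeTiling (Q : QuadTile) {f : ℕ} (g : Fin f → E3 ≃ₗᵢ[ℝ] E3) : Prop where
  covers : ⋃ i, move (g i) '' Q.region = univ
  disjoint_interiors : ∀ i j, i ≠ j →
    Disjoint (interior (move (g i) '' Q.region)) (interior (move (g j) '' Q.region))
  /-- two tiles meet only in common corners and common sides -/
  edge_to_edge : ∀ i j, i ≠ j → ∀ x ∈ move (g i) '' Q.region ∩ move (g j) '' Q.region,
    (∃ k l, x = move (g i) (Q.corner k) ∧ x = move (g j) (Q.corner l)) ∨
      ∃ k l, move (g i) '' Q.side k = move (g j) '' Q.side l ∧ x ∈ move (g i) '' Q.side k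
  three_le_degree : ∀ i k, 3 ≤ degree (vertexType Q g (move (g i) (Q.corner k)))

/-- The vertex type `α^a β^b γ^c δ^d`. -/
def vtx (a b c d : ℕ) : Fin 4 → ℕ := ![a, b, c, d]

/-- The anglewise vertex combination: the set of the types of all vertices of the tiling. -/
def avc (Q : QuadTile) {f : ℕ} (g : Fin f → E3 ≃ₗᵢ[ℝ] E3) : Set (Fin 4 → ℕ) :=
  {t | ∃ i k, t = vertexType Q g (move (g i) (Q.corner k))}

/-! The only geometric input is threefold: the angles at a vertex add up to 2π, the angles of the
tile add up to 2π + 4π/f, and the corners at a vertex form a single cycle, glued along sides of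
equal length. No spherical trigonometry enters.

The first fact comes from a polar chart at the vertex, in which almost every direction lies in
exactly one corner. Integrating the indicator functions of the corners gives 2π
(`IsVertexChart.sum_angle`). For the cycle, the final rays of a set of corners closed under
adjacency are its starting rays. Hence its angle sum is a positive multiple of 2π, so it is
everything (`cornersAt_subset_of_closed`).

The tile sum is equivalent to Euler's formula V = f + 2, which is obtained by a discrete
Gauss–Bonnet argument instead of an area computation. For a generic point x, the `charge` of a tile
counts the corners that see x or its antipode inside their sector, minus twice the number of these
two points in the tile. Whenever x crosses the great circle of a side, the jumps cancel. So the
charge is constant, and it is an even integer 2m. Summed over the tiling it equals 2V − 4, so fm = V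
− 2. The bounds V ≥ 4 and 3V ≤ 4f force m = 1 (`card_verts`).

For the combinatorics, put ε = 4π/f. Then α + 2β = 2π and γ + δ = β + ε. Pairing tiles across b- and
c-sides shows that β + γ and γ + δ occur an even number of times at each vertex. Hence a vertex with
α is αβ² or α^k δ^n (`classify_alpha`). The tile across DA of the α at αβ² produces a vertex with α
and δ, from which α + δ ≤ π follows. As every angle occurs f times, some vertex has more γ than δ,
and it can only be γ^m with m ≥ 4 even (`exists_gamma_pow`). If m ≥ 6, all angles are determined and
m = 6. At γ⁶ a 2-colouring of the six tiles, preserved across c-sides and reversed across b-sides,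
would split them into 3 and 3 with 3 even (`HasHexVertices.not_mem`). So γ = π/2.

Next, at most two α meet at a vertex (`alpha_count_le`), and a weight count yields the vertex α²δ²,
which fixes all four angles. Finally βγδ^n and γ²δ^n are excluded because every tile has some α at
its corner B or D (`alpha_pos_or`). The angle equation then leaves the list of the theorem. -/

open Filter Topology

/-! ### Orthonormal frames and polar angles -/

/-- `p, u, w` is an orthonormal frame of Euclidean three-space. -/
structure IsFrame (p u w : E3) : Prop where
  norm_p : ‖p‖ = 1
  norm_u : ‖u‖ = 1
  norm_w : ‖w‖ = 1
  pu : inner ℝ p u = 0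
  pw : inner ℝ p w = 0
  uw : inner ℝ u w = 0

namespace IsFrame
variable {p u w : E3}

theorem orthonormal (h : IsFrame p u w) : Orthonormal ℝ ![p, u, w] := by
  rw [orthonormal_iff_ite]
  intro i j
  fin_cases i <;> fin_cases j <;>
    simp [h.norm_p, h.norm_u, h.norm_w, h.pu, h.pw, h.uw, real_inner_comm p u, real_inner_comm p w,
      real_inner_comm u w]

theorem expand (h : IsFrame p u w) (x : E3) :
    x = inner ℝ p x • p + inner ℝ u x • u + inner ℝ w x • w := by
  have hc : Fintype.card (Fin 3) = Module.finrank ℝ E3 := by simp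
  let b := basisOfOrthonormalOfCardEqFinrank h.orthonormal hc
  have hb : ⇑b = ![p, u, w] := coe_basisOfOrthonormalOfCardEqFinrank _ _
  let ob := b.toOrthonormalBasis (by rw [hb]; exact h.orthonormal)
  have hob : ⇑ob = ![p, u, w] := by simp [ob, hb]
  have := ob.sum_repr' x
  rw [hob, Fin.sum_univ_three] at this
  simpa using this.symm

theorem inner_expand (h : IsFrame p u w) (x y : E3) :
    inner ℝ x y = inner ℝ p x * inner ℝ p y + inner ℝ u x * inner ℝ u y
      + inner ℝ w x * inner ℝ w y := by
  conv_lhs => rw [h.expand x]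
  simp only [inner_add_left, real_inner_smul_left]

theorem sq_sum (h : IsFrame p u w) {x : E3} (hx : ‖x‖ = 1) :
    inner ℝ p x ^ 2 + inner ℝ u x ^ 2 + inner ℝ w x ^ 2 = 1 := by
  have := h.inner_expand x x
  rw [real_inner_self_eq_norm_sq, hx] at this
  linarith

theorem rot (h : IsFrame p u w) : IsFrame u w p :=
  ⟨h.norm_u, h.norm_w, h.norm_p, h.uw, by rw [real_inner_comm]; exact h.pu,
    by rw [real_inner_comm]; exact h.pw⟩

theorem neg_w (h : IsFrame p u w) : IsFrame p u (-w) :=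
  ⟨h.norm_p, h.norm_u, by simpa using h.norm_w, h.pu, by simpa using h.pw, by simpa using h.uw⟩

theorem swap (h : IsFrame p u w) : IsFrame p w u :=
  ⟨h.norm_p, h.norm_w, h.norm_u, h.pw, h.pu, by rw [real_inner_comm]; exact h.uw⟩

theorem inner_self_p (h : IsFrame p u w) : inner ℝ p p = (1 : ℝ) := by
  rw [real_inner_self_eq_norm_sq, h.norm_p]; norm_num

theorem inner_self_u (h : IsFrame p u w) : inner ℝ u u = (1 : ℝ) := h.rot.inner_self_p
theorem inner_self_w (h : IsFrame p u w) : inner ℝ w w = (1 : ℝ) := h.rot.rot.inner_self_p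
theorem up (h : IsFrame p u w) : inner ℝ u p = (0 : ℝ) := by rw [real_inner_comm]; exact h.pu
theorem wp (h : IsFrame p u w) : inner ℝ w p = (0 : ℝ) := by rw [real_inner_comm]; exact h.pw
theorem wu (h : IsFrame p u w) : inner ℝ w u = (0 : ℝ) := by rw [real_inner_comm]; exact h.uw

/-- A unit vector orthogonal to `p` and `u` is one of the two unit normals. -/
theorem eq_or_eq_neg (h : IsFrame p u w) {n : E3} (hn : ‖n‖ = 1) (hp : inner ℝ p n = (0 : ℝ))
    (hu : inner ℝ u n = (0 : ℝ)) : n = w ∨ n = -w := by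
  have h1 := h.expand n
  have h2 := h.sq_sum hn
  rw [hp, hu] at h1 h2
  have h3 : inner ℝ w n = (1 : ℝ) ∨ inner ℝ w n = (-1 : ℝ) := by
    have := (sq_eq_sq_iff_eq_or_eq_neg (a := (inner ℝ w n : ℝ)) (b := 1)).1 (by linarith)
    simpa using this
  rcases h3 with h3 | h3 <;> rw [h3] at h1
  · left; simpa using h1
  · right; simpa using h1

theorem map (h : IsFrame p u w) (g : E3 ≃ₗᵢ[ℝ] E3) : IsFrame (g p) (g u) (g w) :=
  ⟨by simpa using h.norm_p, by simpa using h.norm_u, by simpa using h.norm_w,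
    by simpa using h.pu, by simpa using h.pw, by simpa using h.uw⟩

/-- Rotation of the frame about its first vector. -/
theorem rotate (h : IsFrame p u w) (t : ℝ) :
    IsFrame p (cos t • u + sin t • w) (-sin t • u + cos t • w) := by
  have hn : ∀ a b : ℝ, a ^ 2 + b ^ 2 = 1 → ‖a • u + b • w‖ = 1 := by
    intro a b hab
    have : ‖a • u + b • w‖ ^ 2 = 1 := by
      rw [← real_inner_self_eq_norm_sq]
      simp only [inner_add_left, inner_add_right, real_inner_smul_left, real_inner_smul_right,
        h.uw, h.wu, h.inner_self_u, h.inner_self_w]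
      linarith
    nlinarith [norm_nonneg (a • u + b • w)]
  refine ⟨h.norm_p, hn _ _ (cos_sq_add_sin_sq t), hn _ _ (by nlinarith [cos_sq_add_sin_sq t]), ?_, ?_, ?_⟩
  · simp [inner_add_right, real_inner_smul_right, h.pu, h.pw]
  · simp [inner_add_right, real_inner_smul_right, h.pu, h.pw]
  · simp only [inner_add_left, inner_add_right, real_inner_smul_left, real_inner_smul_right,
        h.uw, h.wu, h.inner_self_u, h.inner_self_w]
    ring

end IsFrame

theorem exists_isFrame (p : E3) (hp : ‖p‖ = 1) : ∃ u w, IsFrame p u w := by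
  have h1 : ∃ ob : OrthonormalBasis (Fin 3) ℝ E3, ob 0 = p := by
    have hc : Module.finrank ℝ E3 = Fintype.card (Fin 3) := by simp
    obtain ⟨b, hb⟩ := Orthonormal.exists_orthonormalBasis_extension_of_card_eq (𝕜 := ℝ) hc
      (v := fun _ => p) (s := {0}) (by
        rw [orthonormal_iff_ite]
        rintro ⟨i, hi⟩ ⟨j, hj⟩
        simp only [mem_singleton_iff] at hi hj
        subst hi; subst hj
        simp [hp])
    exact ⟨b, hb 0 (by simp)⟩
  obtain ⟨b, rfl⟩ := h1
  exact ⟨b 1, b 2, by simp, by simp, by simp, by simp, by simp, by simp⟩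

theorem exists_isFrame' (p u : E3) (hp : ‖p‖ = 1) (hu : ‖u‖ = 1) (h : inner ℝ p u = (0 : ℝ)) :
    ∃ w, IsFrame p u w := by
  obtain ⟨a, b, hf⟩ := exists_isFrame p hp
  have h1 := hf.expand u
  have h2 := hf.sq_sum hu
  rw [h] at h1 h2
  simp only [zero_smul, zero_add] at h1
  have h0 : (inner ℝ a u : ℝ) ^ 2 + inner ℝ b u ^ 2 = 1 := by linarith
  set x : ℝ := inner ℝ a u
  set y : ℝ := inner ℝ b u
  have hn : ‖-y • a + x • b‖ = 1 := by
    have : ‖-y • a + x • b‖ ^ 2 = 1 := by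
      rw [← real_inner_self_eq_norm_sq]
      simp only [inner_add_left, inner_add_right, real_inner_smul_left, real_inner_smul_right,
        hf.uw, hf.wu, hf.inner_self_u, hf.inner_self_w]
      linarith
    nlinarith [norm_nonneg (-y • a + x • b)]
  refine ⟨-y • a + x • b, hp, hu, hn, h, ?_, ?_⟩
  · simp [inner_add_right, real_inner_smul_right, hf.pu, hf.pw]
  · rw [h1]
    simp only [inner_add_left, inner_add_right, real_inner_smul_left, real_inner_smul_right,
        hf.uw, hf.wu, hf.inner_self_u, hf.inner_self_w]
    ring

theorem exists_eq_add_two_pi {a b : ℝ} (hc : cos a = cos b) (hs : sin a = sin b) :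
    ∃ n : ℤ, a = b + 2 * π * n := by
  have := Real.Angle.cos_sin_inj hc hs
  rw [Real.Angle.angle_eq_iff_two_pi_dvd_sub] at this
  obtain ⟨k, hk⟩ := this
  exact ⟨k, by linarith⟩

theorem eq_of_mem_Ico {a b : ℝ} (ha : a ∈ Ico 0 (2 * π)) (hb : b ∈ Ico 0 (2 * π))
    (hc : cos a = cos b) (hs : sin a = sin b) : a = b := by
  obtain ⟨n, hn⟩ := exists_eq_add_two_pi hc hs
  have hpi := pi_pos
  have h1 : (n : ℝ) < 1 := by
    by_contra hh; push Not at hh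
    nlinarith [ha.1, ha.2, hb.1, hb.2]
  have h2 : (-1 : ℝ) < n := by
    by_contra hh; push Not at hh
    nlinarith [ha.1, ha.2, hb.1, hb.2]
  have : n = 0 := by
    have h1' : n < 1 := by exact_mod_cast h1
    have h2' : -1 < n := by exact_mod_cast h2
    omega
  simp [hn, this]

theorem exists_mem_Ico (a : ℝ) : ∃ b ∈ Ico 0 (2 * π), cos b = cos a ∧ sin b = sin a := by
  refine ⟨toIcoMod two_pi_pos 0 a, ?_, ?_, ?_⟩
  · simpa using toIcoMod_mem_Ico two_pi_pos 0 a
  · rw [← self_sub_toIcoDiv_zsmul, zsmul_eq_mul, cos_sub_int_mul_two_pi]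
  · rw [← self_sub_toIcoDiv_zsmul, zsmul_eq_mul, sin_sub_int_mul_two_pi]

theorem exists_polar (A B : ℝ) : ∃ ρ ≥ 0, ∃ φ ∈ Ico 0 (2 * π), A = ρ * cos φ ∧ B = ρ * sin φ := by
  obtain ⟨b, hb, hc, hs⟩ := exists_mem_Ico (Complex.arg ⟨A, B⟩)
  refine ⟨‖(⟨A, B⟩ : ℂ)‖, norm_nonneg _, b, hb, ?_, ?_⟩
  · rw [hc, Complex.norm_mul_cos_arg]
  · rw [hs, Complex.norm_mul_sin_arg]

theorem exists_polar_pos {A B : ℝ} (h : A ≠ 0 ∨ B ≠ 0) :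
    ∃ ρ > 0, ∃ φ ∈ Ico 0 (2 * π), A = ρ * cos φ ∧ B = ρ * sin φ := by
  obtain ⟨ρ, hρ, φ, hφ, rfl, rfl⟩ := exists_polar A B
  refine ⟨ρ, lt_of_le_of_ne hρ ?_, φ, hφ, rfl, rfl⟩
  rintro rfl
  simp at h

/-! ### Sectors in the tangent plane -/

/-- The plane vector `(A, B)` has a polar angle between `0` and `θ`. -/
def InSector (θ A B : ℝ) : Prop := ∃ ρ > 0, ∃ φ ∈ Icc 0 θ, A = ρ * cos φ ∧ B = ρ * sin φ

theorem inSector_polar {θ ρ φ : ℝ} (hθ : θ < 2 * π) (hρ : 0 < ρ) (hφ : φ ∈ Ico 0 (2 * π)) :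
    InSector θ (ρ * cos φ) (ρ * sin φ) ↔ φ ≤ θ := by
  constructor
  · rintro ⟨ρ', hρ', φ', hφ', hc, hs⟩
    have h1 : ρ ^ 2 = ρ' ^ 2 := by
      have e1 : ρ ^ 2 = (ρ * cos φ) ^ 2 + (ρ * sin φ) ^ 2 := by nlinarith [cos_sq_add_sin_sq φ]
      have e2 : ρ' ^ 2 = (ρ' * cos φ') ^ 2 + (ρ' * sin φ') ^ 2 := by
        nlinarith [cos_sq_add_sin_sq φ']
      rw [e1, e2, hc, hs]
    have h2 : ρ = ρ' := by nlinarith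
    subst h2
    have := eq_of_mem_Ico hφ ⟨hφ'.1, hφ'.2.trans_lt hθ⟩ (mul_left_cancel₀ hρ.ne' hc)
      (mul_left_cancel₀ hρ.ne' hs)
    rw [this]; exact hφ'.2
  · intro h
    exact ⟨ρ, hρ, φ, ⟨hφ.1, h⟩, rfl, rfl⟩

theorem inSector_mul {θ A B c : ℝ} (hc : 0 < c) : InSector θ (c * A) (c * B) ↔ InSector θ A B := by
  constructor
  · rintro ⟨ρ, hρ, φ, hφ, h1, h2⟩
    refine ⟨ρ / c, by positivity, φ, hφ, ?_, ?_⟩ <;> field_simp <;> linarith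
  · rintro ⟨ρ, hρ, φ, hφ, rfl, rfl⟩
    exact ⟨c * ρ, by positivity, φ, hφ, by ring, by ring⟩

open Classical in
/-- The number (`0` or `1`) of directions `(A, B)` in the sector. -/
noncomputable def sectorCount (θ A B : ℝ) : ℝ := if InSector θ A B then 1 else 0

theorem sign_sin_pos {x : ℝ} (h0 : 0 < x) (h1 : x < π) : Real.sign (sin x) = 1 :=
  Real.sign_of_pos (sin_pos_of_pos_of_lt_pi h0 h1)

theorem sign_sin_neg {x : ℝ} (h0 : π < x) (h1 : x < 2 * π) : Real.sign (sin x) = -1 := by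
  apply Real.sign_of_neg
  have := sin_pos_of_pos_of_lt_pi (x := x - π) (by linarith) (by linarith)
  rw [sin_sub_pi] at this; linarith

theorem sectorCount_polar {θ ρ φ : ℝ} (hθ : θ < 2 * π) (hρ : 0 < ρ) (hφ : φ ∈ Ico 0 (2 * π)) :
    sectorCount θ (ρ * cos φ) (ρ * sin φ) = if φ ≤ θ then 1 else 0 := by
  unfold sectorCount
  simp only [inSector_polar hθ hρ hφ]

theorem sectorCount_add_neg_aux {θ ρ φ : ℝ} (h0 : 0 < θ) (hθ : θ < 2 * π) (hρ : 0 < ρ) (hφ : 0 < φ)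
    (hφ' : φ < π) (hH : sin (θ - φ) ≠ 0) :
    sectorCount θ (ρ * cos φ) (ρ * sin φ) + sectorCount θ (-(ρ * cos φ)) (-(ρ * sin φ)) =
      1 - Real.sign (sin θ) * (1 - Real.sign (sin (θ - φ))) / 2 := by
  have e1 : -(ρ * cos φ) = ρ * cos (φ + π) := by rw [cos_add_pi]; ring
  have e2 : -(ρ * sin φ) = ρ * sin (φ + π) := by rw [sin_add_pi]; ring
  have hpi := pi_pos
  rw [e1, e2, sectorCount_polar hθ hρ ⟨hφ.le, by linarith⟩,
    sectorCount_polar hθ hρ ⟨by linarith, by linarith⟩]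
  rcases lt_trichotomy θ φ with h | h | h
  · have : Real.sign (sin (θ - φ)) = -1 := by
      rw [← neg_sub, sin_neg, Real.sign_neg, sign_sin_pos] <;> linarith
    rw [this, if_neg (by linarith), if_neg (by linarith), sign_sin_pos h0 (by linarith)]
    norm_num
  · simp [h] at hH
  · rcases lt_trichotomy θ (φ + π) with h' | h' | h'
    · rw [if_pos h.le, if_neg (by linarith), sign_sin_pos (x := θ - φ) (by linarith) (by linarith)]
      norm_num
    · simp [h'] at hH
    · rw [if_pos h.le, if_pos h'.le, sign_sin_neg (x := θ - φ) (by linarith) (by linarith),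
        sign_sin_neg (by linarith) hθ]
      norm_num

/-- The number of the two directions `±(A, B)` in the sector, through the signs of the two
linear forms that vanish on its sides. -/
theorem sectorCount_add_neg {θ A B : ℝ} (h0 : 0 < θ) (hθ : θ < 2 * π) (hB : B ≠ 0)
    (hH : sin θ * A - cos θ * B ≠ 0) :
    sectorCount θ A B + sectorCount θ (-A) (-B) =
      1 - Real.sign (sin θ) * (1 - Real.sign (sin θ * A - cos θ * B) * Real.sign B) / 2 := by
  obtain ⟨ρ, hρ, φ, hφ, rfl, rfl⟩ := exists_polar_pos (A := A) (B := B) (Or.inr hB)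
  have e : ∀ ψ, sin θ * (ρ * cos ψ) - cos θ * (ρ * sin ψ) = ρ * sin (θ - ψ) := by
    intro ψ; rw [sin_sub]; ring
  have hs : ∀ x : ℝ, Real.sign (ρ * x) = Real.sign x := by
    intro x
    rcases lt_trichotomy x 0 with h | h | h
    · rw [Real.sign_of_neg h, Real.sign_of_neg (by nlinarith)]
    · simp [h]
    · rw [Real.sign_of_pos h, Real.sign_of_pos (by positivity)]
  rw [e] at hH ⊢
  rw [hs, hs]
  have hH' : sin (θ - φ) ≠ 0 := fun h => hH (by rw [h, mul_zero])
  have hne0 : φ ≠ 0 := by rintro rfl; simp at hB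
  have hnepi : φ ≠ π := by rintro rfl; simp at hB
  have hpos : 0 < φ := lt_of_le_of_ne hφ.1 hne0.symm
  -- Replacing (A, B) by its negative changes neither side of the identity, so the range 0 < φ < π
  -- is enough.
  rcases lt_or_gt_of_ne hnepi with h | h
  · rw [sectorCount_add_neg_aux h0 hθ hρ hpos h hH', sign_sin_pos hpos h, mul_one]
  · have := sectorCount_add_neg_aux (φ := φ - π) h0 hθ hρ (by linarith) (by linarith [hφ.2])
      (by rw [show θ - (φ - π) = θ - φ + π by ring, sin_add_pi]; simpa using hH')
    rw [cos_sub_pi, sin_sub_pi, show θ - (φ - π) = θ - φ + π by ring, sin_add_pi, Real.sign_neg] at this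
    rw [sign_sin_neg h hφ.2, add_comm]
    simp only [mul_neg, neg_neg] at this
    rw [this]; ring

/-! ### Geodesics, and arcs as point sets -/

theorem IsUnitTangent.exists_frame {p : S2} {u : E3} (h : IsUnitTangent p u) :
    ∃ w, IsFrame (p : E3) u w :=
  exists_isFrame' _ _ (by simp) h.1 h.2

theorem IsFrame.isUnitTangent {p : S2} {u w : E3} (h : IsFrame (p : E3) u w) : IsUnitTangent p u :=
  ⟨h.norm_u, h.pu⟩

theorem IsFrame.geodesicFrame {p u w : E3} (h : IsFrame p u w) (t : ℝ) :
    IsFrame (geodesic p u t) (geodesicVelocity p u t) w :=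
  (h.rot.rot.rotate t).rot

theorem norm_geodesic {p : S2} {u : E3} (h : IsUnitTangent p u) (t : ℝ) :
    ‖geodesic p u t‖ = 1 := by
  obtain ⟨w, hw⟩ := h.exists_frame
  exact (hw.geodesicFrame t).norm_p

/-- `geodesic` as a point of the sphere. -/
noncomputable def geoPt (p : S2) (u : E3) (h : IsUnitTangent p u) (t : ℝ) : S2 :=
  ⟨geodesic p u t, by simpa using norm_geodesic h t⟩

theorem geoPt_mem {p : S2} {u : E3} (h : IsUnitTangent p u) {t l : ℝ} (ht : t ∈ Icc 0 l) :
    geoPt p u h t ∈ geodesicArc p u l := ⟨t, ht, rfl⟩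

theorem geodesic_add (p u : E3) (s t : ℝ) :
    geodesic (geodesic p u s) (geodesicVelocity p u s) t = geodesic p u (s + t) := by
  simp only [geodesic, geodesicVelocity, cos_add, sin_add]
  module

theorem geodesic_sub (p u : E3) (s t : ℝ) :
    geodesic (geodesic p u s) (-geodesicVelocity p u s) t = geodesic p u (s - t) := by
  simp only [geodesic, geodesicVelocity, cos_sub, sin_sub]
  module

theorem geodesic_zero (p u : E3) : geodesic p u 0 = p := by simp [geodesic]

theorem geodesicVelocity_zero (p u : E3) : geodesicVelocity p u 0 = u := by simp [geodesicVelocity]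

theorem geodesic_inj {p : S2} {u : E3} (h : IsUnitTangent p u) {s t : ℝ}
    (he : geodesic p u s = geodesic p u t) : ∃ n : ℤ, s = t + 2 * π * n := by
  obtain ⟨w, hw⟩ := h.exists_frame
  apply exists_eq_add_two_pi
  · have := congrArg (fun x => (inner ℝ (p : E3) x : ℝ)) he
    simpa [geodesic, inner_add_right, real_inner_smul_right, hw.pu, hw.inner_self_p] using this
  · have := congrArg (fun x => (inner ℝ u x : ℝ)) he
    simpa only [geodesic, inner_add_right, real_inner_smul_right, hw.up, hw.inner_self_u, mul_zero,
      zero_add, mul_one] using this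

theorem inner_normal_geodesic {p u w : E3} (h : IsFrame p u w) (t : ℝ) :
    inner ℝ w (geodesic p u t) = (0 : ℝ) := by
  simp [geodesic, inner_add_right, real_inner_smul_right, h.wp, h.wu]

theorem int_bound {n : ℤ} {a b : ℝ} (h : a = b + 2 * π * n) (h1 : -(2 * π) < a - b)
    (h2 : a - b < 4 * π) : n = 0 ∨ n = 1 := by
  have hpi := pi_pos
  have h1 : (n : ℝ) < 2 := by
    by_contra hh; push Not at hh
    nlinarith
  have h2 : (-1 : ℝ) < n := by
    by_contra hh; push Not at hh
    nlinarith
  have h1' : n < 2 := by exact_mod_cast h1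
  have h2' : -1 < n := by exact_mod_cast h2
  omega

theorem int_bound_zero {n : ℤ} {a b : ℝ} (h : a = b + 2 * π * n) (h1 : -(2 * π) < a - b)
    (h2 : a - b < 2 * π) : n = 0 := by
  have hpi := pi_pos
  rcases int_bound h h1 (by linarith) with h | h
  · exact h
  · subst h; push_cast at *; linarith

/-- Two geodesic arcs that agree as sets have the same length, and agree as paths up to reversal. -/
theorem geodesicArc_eq {p q : S2} {u v : E3} {l m : ℝ} (hu : IsUnitTangent p u)
    (hv : IsUnitTangent q v) (hl : 0 < l) (hl' : l < 2 * π) (hm : 0 < m) (hm' : m < 2 * π)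
    (h : geodesicArc p u l = geodesicArc q v m) :
    l = m ∧ ((q = p ∧ v = u) ∨
      ((q : E3) = geodesic p u l ∧ v = -geodesicVelocity p u l)) := by
  obtain ⟨w, hw⟩ := hu.exists_frame
  have hpi := pi_pos
  have hq : q ∈ geodesicArc p u l := by
    rw [h]; exact ⟨0, ⟨le_rfl, hm.le⟩, by rw [geodesic_zero]⟩
  obtain ⟨t₀, ht₀, hqt⟩ := hq
  have h1 : ∀ t ∈ Icc 0 l, ∃ s ∈ Icc 0 m, geodesic p u t = geodesic q v s := by
    intro t ht
    have := geoPt_mem hu ht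
    rw [h] at this
    obtain ⟨s, hs, e⟩ := this
    exact ⟨s, hs, e⟩
  have h2 : ∀ s ∈ Icc 0 m, ∃ t ∈ Icc 0 l, geodesic q v s = geodesic p u t := by
    intro t ht
    have := geoPt_mem hv ht
    rw [← h] at this
    obtain ⟨s, hs, e⟩ := this
    exact ⟨s, hs, e⟩
  have hwq : inner ℝ w (q : E3) = (0 : ℝ) := by rw [hqt]; exact inner_normal_geodesic hw _
  -- A second point of the other arc, at a distance with nonzero sine, puts its direction into the
  -- plane of the first great circle.
  have hwv : inner ℝ w v = (0 : ℝ) := by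
    have hs0 : 0 < min m 1 := lt_min hm one_pos
    obtain ⟨t, _, e⟩ := h2 (min m 1) ⟨hs0.le, min_le_left _ _⟩
    have e2 := inner_normal_geodesic hw t
    rw [← e] at e2
    simp only [geodesic, inner_add_right, real_inner_smul_right, hwq, mul_zero, zero_add] at e2
    have : 0 < sin (min m 1) := sin_pos_of_pos_of_le_one hs0 (min_le_right _ _)
    rcases mul_eq_zero.1 e2 with h | h
    · linarith
    · exact h
  have hfr := (hw.geodesicFrame t₀).swap
  rw [← hqt] at hfr
  rcases hfr.eq_or_eq_neg hv.1 hv.2 hwv with hv' | hv'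
  · have e : ∀ s, geodesic q v s = geodesic p u (t₀ + s) := by
      intro s; rw [hqt, hv', geodesic_add]
    -- If the second arc started inside the first, points slightly before its start would be reached
    -- only at parameters close to 2π. A step of at most (2π − m)/2 keeps them beyond its end m.
    have ht0 : t₀ = 0 := by
      by_contra hne
      have hpos : 0 < t₀ := lt_of_le_of_ne ht₀.1 (Ne.symm hne)
      have hd : 0 < min t₀ ((2 * π - m) / 2) := lt_min hpos (by linarith)
      obtain ⟨s, hs, e'⟩ := h1 (t₀ - min t₀ ((2 * π - m) / 2))
        ⟨by linarith [min_le_left t₀ ((2 * π - m) / 2)], by linarith [ht₀.2]⟩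
      rw [e] at e'
      obtain ⟨n, hn⟩ := geodesic_inj hu e'.symm
      have hb := min_le_right t₀ ((2 * π - m) / 2)
      rcases int_bound hn (by linarith [hs.1]) (by linarith [hs.2]) with rfl | rfl
      · push_cast at hn; linarith [hs.1]
      · push_cast at hn; linarith [hs.2]
    subst ht0
    rw [geodesic_zero] at hqt
    rw [geodesicVelocity_zero] at hv'
    refine ⟨?_, Or.inl ⟨Subtype.ext hqt, hv'⟩⟩
    apply le_antisymm
    · obtain ⟨s, hs, e'⟩ := h1 l ⟨hl.le, le_rfl⟩
      rw [e, zero_add] at e'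
      obtain ⟨n, hn⟩ := geodesic_inj hu e'
      have := int_bound_zero hn (by linarith [hs.2]) (by linarith [hs.1])
      subst this; push_cast at hn; linarith [hs.2]
    · obtain ⟨s, hs, e'⟩ := h2 m ⟨hm.le, le_rfl⟩
      rw [e, zero_add] at e'
      obtain ⟨n, hn⟩ := geodesic_inj hu e'
      have := int_bound_zero hn (by linarith [hs.2]) (by linarith [hs.1])
      subst this; push_cast at hn; linarith [hs.2]
  · have e : ∀ s, geodesic q v s = geodesic p u (t₀ - s) := by
      intro s; rw [hqt, hv', geodesic_sub]
    have ht0 : t₀ = l := by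
      by_contra hne
      have hpos : t₀ < l := lt_of_le_of_ne ht₀.2 hne
      have hd : 0 < min (l - t₀) ((2 * π - m) / 2) := lt_min (by linarith) (by linarith)
      obtain ⟨s, hs, e'⟩ := h1 (t₀ + min (l - t₀) ((2 * π - m) / 2))
        ⟨by linarith [ht₀.1], by linarith [min_le_left (l - t₀) ((2 * π - m) / 2)]⟩
      rw [e] at e'
      obtain ⟨n, hn⟩ := geodesic_inj hu e'
      have hb := min_le_right (l - t₀) ((2 * π - m) / 2)
      rcases int_bound hn (by linarith [hs.1]) (by linarith [hs.2]) with rfl | rfl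
      · push_cast at hn; linarith [hs.1]
      · push_cast at hn; linarith [hs.2]
    subst ht0
    refine ⟨?_, Or.inr ⟨hqt, hv'⟩⟩
    apply le_antisymm
    · obtain ⟨s, hs, e'⟩ := h1 0 ⟨le_rfl, hl.le⟩
      rw [e] at e'
      obtain ⟨n, hn⟩ := geodesic_inj hu e'.symm
      have := int_bound_zero hn (by linarith [hs.2]) (by linarith [hs.1])
      subst this; push_cast at hn; linarith [hs.2]
    · obtain ⟨s, hs, e'⟩ := h2 m ⟨hm.le, le_rfl⟩
      rw [e] at e'
      obtain ⟨n, hn⟩ := geodesic_inj hu e'.symm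
      rcases int_bound hn (by linarith [hs.1]) (by linarith [hs.2]) with rfl | rfl
      · push_cast at hn; linarith [hs.1]
      · push_cast at hn; linarith [hs.2]

/-! ### Local topology: punctured sphere, sectors near their sides, strips along arcs -/

/-- The sphere without finitely many points is connected. -/
theorem isPreconnected_compl_finite {B : Set S2} (hB : B.Finite) {v : S2} (hv : v ∈ B) :
    IsPreconnected Bᶜ := by
  have hnv : ‖(v : E3)‖ = 1 := by simp
  have : Fact (Module.finrank ℝ E3 = 2 + 1) := ⟨by simp⟩
  have hrank : 1 < Module.rank ℝ (ℝ ∙ (v : E3))ᗮ := by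
    have : Module.finrank ℝ (ℝ ∙ (v : E3))ᗮ = 2 :=
      Submodule.finrank_orthogonal_span_singleton (by intro h; rw [h] at hnv; simp at hnv)
    rw [← Module.finrank_eq_rank, this]
    norm_num
  -- Projection from the removed point v turns the set into a plane without countably many points,
  -- which is connected.
  let e := stereographic hnv
  have hc : (e '' (B \ {v})).Countable := ((hB.subset sdiff_subset).countable).image _
  have h1 := (hc.isConnected_compl_of_one_lt_rank hrank).isPreconnected
  have hcont : Continuous e.symm := by
    have := e.continuousOn_symm
    rwa [stereographic_target, ← continuousOn_univ.symm.eq] at this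
  have h2 := h1.image e.symm hcont.continuousOn
  convert h2 using 1
  ext x
  constructor
  · intro hx
    have hxv : x ∈ e.source := by
      rw [stereographic_source]
      rintro h
      apply hx
      have : x = v := by simpa [Subtype.ext_iff] using h
      rwa [this]
    refine ⟨e x, ?_, e.left_inv hxv⟩
    rintro ⟨y, hy, hyx⟩
    have hyv : y ∈ e.source := by
      rw [stereographic_source]
      intro h
      apply hy.2
      simpa [Subtype.ext_iff] using h
    have := e.injOn hyv hxv hyx
    subst this
    exact hx hy.1
  · rintro ⟨z, hz, rfl⟩ hB'
    apply hz
    have hzt : z ∈ e.target := by rw [stereographic_target]; trivial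
    refine ⟨e.symm z, ⟨hB', ?_⟩, e.right_inv hzt⟩
    intro h
    have := e.map_target hzt
    rw [stereographic_source] at this
    apply this
    simpa [Subtype.ext_iff] using h

/-- For A > 0 the polar angle is arctan (B/A), plus 2π if B < 0. When B/A is small it is close to 0
or to 2π, and only the former lies in [0, θ]. -/
theorem inSector_near_start {θ : ℝ} (h0 : 0 < θ) (hθ : θ < 2 * π) :
    ∃ δ > 0, ∀ A B : ℝ, 0 < A → |B / A| < δ → (InSector θ A B ↔ 0 ≤ B) := by
  have hpi := pi_pos
  have hε : 0 < min θ (2 * π - θ) := lt_min h0 (by linarith)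
  obtain ⟨δ, hδ, h⟩ := Metric.continuousAt_iff.1 (continuous_arctan.continuousAt (x := (0 : ℝ))) _ hε
  refine ⟨δ, hδ, fun A B hA hB => ?_⟩
  have h1 : |arctan (B / A)| < min θ (2 * π - θ) := by
    have := h (x := B / A) (by rwa [Real.dist_eq, sub_zero])
    simpa [Real.dist_eq] using this
  have hs : 0 < √(1 + (B / A) ^ 2) := by positivity
  have e1 : A = A * √(1 + (B / A) ^ 2) * cos (arctan (B / A)) := by
    rw [cos_arctan]; field_simp
  have e2 : B = A * √(1 + (B / A) ^ 2) * sin (arctan (B / A)) := by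
    rw [sin_arctan]; field_simp
  rcases le_or_gt 0 B with hB0 | hB0
  · simp only [hB0, iff_true]
    have h2 : 0 ≤ arctan (B / A) := arctan_nonneg.2 (by positivity)
    exact ⟨_, by positivity, _, ⟨h2, ((le_abs_self _).trans_lt (h1.trans_le (min_le_left _ _))).le⟩,
      e1, e2⟩
  · have h2 : arctan (B / A) < 0 := arctan_lt_zero.2 (div_neg_of_neg_of_pos hB0 hA)
    have h4 := inSector_polar (ρ := A * √(1 + (B / A) ^ 2)) (φ := arctan (B / A) + 2 * π) hθ
      (by positivity) ⟨by linarith [neg_pi_div_two_lt_arctan (B / A)], by linarith⟩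
    rw [cos_add_two_pi, sin_add_two_pi, ← e1, ← e2] at h4
    rw [h4]
    have h3 := (abs_lt.1 (h1.trans_le (min_le_right _ _))).1
    constructor <;> intro h4 <;> linarith

/-- The reflection φ ↦ θ − φ exchanges the two sides of the sector. It transfers every statement
about the first side of a corner to the second. -/
theorem inSector_reflect {θ A B : ℝ} :
    InSector θ (cos θ * A + sin θ * B) (sin θ * A - cos θ * B) ↔ InSector θ A B := by
  have key : ∀ A B, InSector θ A B →
      InSector θ (cos θ * A + sin θ * B) (sin θ * A - cos θ * B) := by
    rintro _ _ ⟨ρ, hρ, φ, hφ, rfl, rfl⟩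
    exact ⟨ρ, hρ, θ - φ, ⟨by linarith [hφ.2], by linarith [hφ.1]⟩,
      by rw [cos_sub]; ring, by rw [sin_sub]; ring⟩
  refine ⟨fun h => ?_, key A B⟩
  have := key _ _ h
  have e := cos_sq_add_sin_sq θ
  convert this using 1
  · linear_combination (-A) * e
  · linear_combination (-B) * e

/-- Near a point of the first side of a corner, the region lies to one side. -/
theorem eventually_mem_iff_of_sector {R : Set S2} {p : S2} {u w : E3} {θ κ : ℝ}
    (hf : IsFrame (p : E3) u w) (h0 : 0 < θ) (hθ : θ < 2 * π) (hκ : κ < 1)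
    (hR : ∀ x : S2, κ < inner ℝ (p : E3) (x : E3) → x ≠ p →
      (x ∈ R ↔ InSector θ (inner ℝ u (x : E3)) (inner ℝ w (x : E3)))) :
    ∃ t₁ > 0, ∀ t ∈ Ioo 0 t₁, ∀ x₀ : S2, (x₀ : E3) = geodesic p u t →
      ∀ᶠ x : S2 in 𝓝 x₀, (x ∈ R ↔ 0 ≤ (inner ℝ w (x : E3) : ℝ)) := by
  have hc : ∀ᶠ t in 𝓝 (0 : ℝ), κ < cos t :=
    continuous_cos.continuousAt.eventually (lt_mem_nhds (by simpa using hκ))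
  obtain ⟨ε, hε, h1⟩ := Metric.eventually_nhds_iff.1 hc
  obtain ⟨δ, hδ, h2⟩ := inSector_near_start h0 hθ
  refine ⟨min ε 1, lt_min hε one_pos, fun t ht x₀ hx₀ => ?_⟩
  have e1 : inner ℝ (p : E3) (x₀ : E3) = cos t := by
    simp [hx₀, geodesic, inner_add_right, real_inner_smul_right, hf.pu]
  have e2 : inner ℝ u (x₀ : E3) = sin t := by
    simp only [hx₀, geodesic, inner_add_right, real_inner_smul_right, hf.up, hf.inner_self_u]; ring
  have e3 : inner ℝ w (x₀ : E3) = (0 : ℝ) := by rw [hx₀]; exact inner_normal_geodesic hf t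
  have hs : 0 < sin t := sin_pos_of_pos_of_le_one ht.1 (ht.2.le.trans (min_le_right _ _))
  have c1 : ContinuousAt (fun x : S2 => (inner ℝ (p : E3) (x : E3) : ℝ)) x₀ := by fun_prop
  have c2 : ContinuousAt (fun x : S2 => (inner ℝ u (x : E3) : ℝ)) x₀ := by fun_prop
  have c3 : ContinuousAt (fun x : S2 => |(inner ℝ w (x : E3) : ℝ) / inner ℝ u (x : E3)|) x₀ := by
    apply ContinuousAt.abs
    apply ContinuousAt.div (by fun_prop) c2
    rw [e2]; exact hs.ne'
  have v1 := c1.tendsto.eventually_const_lt (u := κ) (by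
    rw [e1]; apply h1; rw [Real.dist_eq, sub_zero, abs_of_pos ht.1]
    exact ht.2.trans_le (min_le_left _ _))
  have v2 := c2.tendsto.eventually_const_lt (u := 0) (by rw [e2]; exact hs)
  have v3 := c3.tendsto.eventually_lt_const (u := δ) (by rw [e3]; simpa using hδ)
  filter_upwards [v1, v2, v3] with x w1 w2 w3
  rw [hR x w1, h2 _ _ w2 w3]
  rintro rfl
  rw [hf.up] at w2
  exact lt_irrefl _ w2

/-- The point at signed distance `s` from the great circle of `p, u` with unit normal `n`, over the
point at distance `t` from `p`. -/
noncomputable def stripPoint {p : S2} {u n : E3} (h : IsFrame (p : E3) u n) (t s : ℝ) : S2 :=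
  ⟨cos s • geodesic p u t + sin s • n, by
    rw [mem_sphere_zero_iff_norm]
    exact ((h.geodesicFrame t).swap.geodesicFrame s).norm_p⟩

theorem inner_stripPoint {p : S2} {u n : E3} (h : IsFrame (p : E3) u n) (t s : ℝ) :
    inner ℝ n (stripPoint h t s : E3) = sin s := by
  simp [stripPoint, inner_add_right, real_inner_smul_right, inner_normal_geodesic h, h.norm_w]

theorem continuous_stripPoint {p : S2} {u n : E3} (h : IsFrame (p : E3) u n) :
    Continuous (fun z : ℝ × ℝ => stripPoint h z.1 z.2) := by
  unfold stripPoint geodesic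
  apply Continuous.subtype_mk
  fun_prop

theorem stripPoint_zero {p : S2} {u n : E3} (h : IsFrame (p : E3) u n) (t : ℝ) :
    stripPoint h t 0 = geoPt p u h.isUnitTangent t := by
  apply Subtype.ext
  simp [stripPoint, geoPt]

/-- The strip coordinates of x are an arctan and an arcsin of inner products with the frame at the
base point. Both are continuous there, with value 0. -/
theorem eventually_stripPoint {p : S2} {u n : E3} (h : IsFrame (p : E3) u n) {t₀ t t₂ η : ℝ}
    (h0 : t₀ < t) (h2 : t < t₂) (hη : 0 < η) :
    ∀ᶠ x in 𝓝 (geoPt p u h.isUnitTangent t), ∃ t' ∈ Ioo t₀ t₂, ∃ s, |s| < η ∧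
      x = stripPoint h t' s := by
  set x₀ := geoPt p u h.isUnitTangent t
  have hx₀ : (x₀ : E3) = geodesic p u t := rfl
  have hf := h.geodesicFrame t
  rw [← hx₀] at hf
  set v := geodesicVelocity p u t with hv
  have e1 : inner ℝ (x₀ : E3) (x₀ : E3) = (1 : ℝ) := hf.inner_self_p
  have c1 : ContinuousAt (fun x : S2 => (inner ℝ (x₀ : E3) (x : E3) : ℝ)) x₀ := by fun_prop
  have c2 : ContinuousAt (fun x : S2 => arctan ((inner ℝ v (x : E3) : ℝ) /
      inner ℝ (x₀ : E3) (x : E3))) x₀ := by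
    apply continuous_arctan.continuousAt.comp
    apply ContinuousAt.div (by fun_prop) c1
    rw [e1]; exact one_ne_zero
  have c3 : ContinuousAt (fun x : S2 => |arcsin (inner ℝ n (x : E3) : ℝ)|) x₀ := by
    apply ContinuousAt.abs
    exact continuous_arcsin.continuousAt.comp (by fun_prop)
  have v1 := c1.tendsto.eventually_const_lt (u := 0) (by rw [e1]; exact one_pos)
  have v2 := c2.tendsto.eventually_const_lt (u := t₀ - t) (by rw [hf.up, zero_div, arctan_zero]; linarith)
  have v2' := c2.tendsto.eventually_lt_const (u := t₂ - t) (by rw [hf.up, zero_div, arctan_zero]; linarith)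
  have v3 := c3.tendsto.eventually_lt_const (u := η) (by rw [hf.wp, arcsin_zero, abs_zero]; exact hη)
  filter_upwards [v1, v2, v2', v3] with x w1 w2 w2' w3
  refine ⟨t + arctan ((inner ℝ v (x : E3) : ℝ) / inner ℝ (x₀ : E3) (x : E3)),
    ⟨by linarith, by linarith⟩, _, w3, ?_⟩
  apply Subtype.ext
  simp only [stripPoint]
  rw [← geodesic_add, ← hx₀, ← hv]
  have hsq := hf.sq_sum (x := (x : E3)) (by simp)
  set A : ℝ := inner ℝ (x₀ : E3) (x : E3)
  set B : ℝ := inner ℝ v (x : E3)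
  have e : (x : E3) = A • (x₀ : E3) + B • v + (inner ℝ n (x : E3) : ℝ) • n := hf.expand x
  set C : ℝ := inner ℝ n (x : E3)
  have hC : C ^ 2 ≤ 1 := by nlinarith [sq_nonneg A, sq_nonneg B]
  have hC' := abs_le_one_iff_mul_self_le_one.2 (by nlinarith : C * C ≤ 1)
  rw [e, geodesic, cos_arctan, sin_arctan, cos_arcsin, sin_arcsin (abs_le.1 hC').1 (abs_le.1 hC').2]
  have e4 : √(1 - C ^ 2) = A * √(1 + (B / A) ^ 2) := by
    rw [show 1 - C ^ 2 = A ^ 2 * (1 + (B / A) ^ 2) by field_simp; linarith,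
      sqrt_mul (by positivity), sqrt_sq w1.le]
  have hs : 0 < √(1 + (B / A) ^ 2) := by positivity
  rw [e4, smul_add, smul_smul, smul_smul]
  congr 2
  · congr 1; field_simp
  · congr 1; field_simp

theorem IsPreconnected.exists_mem_frontier {X : Type*} [TopologicalSpace X] {s R : Set X}
    (hs : IsPreconnected s) {x y : X} (hx : x ∈ s) (hy : y ∈ s) (hxR : x ∈ R) (hyR : y ∉ R) :
    ∃ z ∈ s, z ∈ frontier R := by
  by_contra! h
  have h1 : ∀ z ∈ s, z ∈ R → z ∈ interior R := fun z hz hzR => by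
    by_contra hh
    exact h z hz ⟨subset_closure hzR, hh⟩
  have h2 : ∀ z ∈ s, z ∉ R → z ∈ (closure R)ᶜ := fun z hz hzR hh =>
    h z hz ⟨hh, fun hi => hzR (interior_subset hi)⟩
  obtain ⟨z, -, hz1, hz2⟩ := hs _ _ isOpen_interior isClosed_closure.isOpen_compl
    (fun z hz => (em (z ∈ R)).imp (h1 z hz) (h2 z hz)) ⟨x, hx, h1 x hx hxR⟩ ⟨y, hy, h2 y hy hyR⟩
  exact hz2 (subset_closure (interior_subset hz1))

/-! ### Sides and corners of a simple quadrilateral -/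

namespace SimpleQuadrilateral
variable (Q : SimpleQuadrilateral)

/-- The point of side `k` at distance `t` from its first end (or of the great circle of side
`k`, for other `t`). -/
noncomputable def pt (k : Fin 4) (t : ℝ) : S2 := geoPt _ _ (Q.isUnitTangent_dir k) t

theorem coe_pt (k : Fin 4) (t : ℝ) :
    (Q.pt k t : E3) = geodesic (Q.corner k) (Q.dir k) t := rfl

theorem pt_zero (k : Fin 4) : Q.pt k 0 = Q.corner k := Subtype.ext (geodesic_zero _ _)

theorem pt_len (k : Fin 4) : Q.pt k (Q.len k) = Q.corner (k + 1) :=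
  Subtype.ext (Q.corner_succ k).symm

theorem continuous_pt (k : Fin 4) : Continuous (Q.pt k) := by
  unfold pt geoPt geodesic
  apply Continuous.subtype_mk
  fun_prop

theorem side_eq_image (k : Fin 4) : Q.side k = Q.pt k '' Icc 0 (Q.len k) := by
  ext x
  constructor
  · rintro ⟨t, ht, h⟩
    exact ⟨t, ht, Subtype.ext h.symm⟩
  · rintro ⟨t, ht, rfl⟩
    exact ⟨t, ht, rfl⟩

theorem pt_mem_side {k : Fin 4} {t : ℝ} (ht : t ∈ Icc 0 (Q.len k)) : Q.pt k t ∈ Q.side k :=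
  ⟨t, ht, rfl⟩

theorem corner_mem_side (k : Fin 4) : Q.corner k ∈ Q.side k := by
  rw [← Q.pt_zero]; exact Q.pt_mem_side ⟨le_rfl, (Q.len_pos k).le⟩

theorem corner_succ_mem_side (k : Fin 4) : Q.corner (k + 1) ∈ Q.side k := by
  rw [← Q.pt_len]; exact Q.pt_mem_side ⟨(Q.len_pos k).le, le_rfl⟩

theorem isCompact_side (k : Fin 4) : IsCompact (Q.side k) := by
  rw [side_eq_image]; exact isCompact_Icc.image (Q.continuous_pt k)

theorem pt_injOn {k : Fin 4} {s t : ℝ} (hs : s ∈ Icc 0 (Q.len k)) (ht : t ∈ Icc 0 (Q.len k))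
    (h : Q.pt k s = Q.pt k t) : s = t := by
  obtain ⟨n, hn⟩ := geodesic_inj (Q.isUnitTangent_dir k) (congrArg Subtype.val h)
  have := Q.len_lt k
  have := int_bound_zero hn (by linarith [hs.1, ht.2]) (by linarith [hs.2, ht.1])
  subst this
  simpa using hn

/-- A point inside a side lies on no other side. -/
theorem side_unique {k j : Fin 4} {t : ℝ} (ht : t ∈ Ioo 0 (Q.len k)) (h : Q.pt k t ∈ Q.side j) :
    j = k := by
  have hk := Q.pt_mem_side (Ioo_subset_Icc_self ht)
  have hl := Q.len_pos k
  by_contra hne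
  have hd : ∀ j k : Fin 4, j ≠ k → j = k + 1 ∨ j = k + 2 ∨ k = j + 1 := by decide
  have hc := hd j k hne
  rcases hc with rfl | rfl | rfl
  · have : Q.pt k t ∈ ({Q.corner (k + 1)} : Set S2) := Q.adjacent_sides k ▸ ⟨hk, h⟩
    rw [mem_singleton_iff, ← Q.pt_len] at this
    have := Q.pt_injOn (Ioo_subset_Icc_self ht) ⟨hl.le, le_rfl⟩ this
    linarith [ht.2]
  · exact disjoint_left.1 (Q.opposite_sides k) hk h
  · have : Q.pt (j + 1) t ∈ ({Q.corner (j + 1)} : Set S2) := Q.adjacent_sides j ▸ ⟨h, hk⟩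
    rw [mem_singleton_iff, ← Q.pt_zero] at this
    have := Q.pt_injOn (Ioo_subset_Icc_self ht) ⟨le_rfl, hl.le⟩ this
    linarith [ht.1]

theorem corner_mem_side_iff {k j : Fin 4} : Q.corner k ∈ Q.side j ↔ k = j ∨ k = j + 1 := by
  constructor
  · intro h
    by_contra hne
    have hd : ∀ j k : Fin 4, ¬(k = j ∨ k = j + 1) → j = k + 1 ∨ j = k + 2 := by decide
    have hc := hd j k hne
    rcases hc with rfl | rfl
    · have : Q.corner k ∈ ({Q.corner (k + 1)} : Set S2) :=
        Q.adjacent_sides k ▸ ⟨Q.corner_mem_side k, h⟩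
      rw [mem_singleton_iff, ← Q.pt_zero, ← Q.pt_len] at this
      have := Q.pt_injOn ⟨le_rfl, (Q.len_pos k).le⟩ ⟨(Q.len_pos k).le, le_rfl⟩ this
      linarith [Q.len_pos k]
    · exact disjoint_left.1 (Q.opposite_sides k) (Q.corner_mem_side k) h
  · rintro (rfl | rfl)
    · exact Q.corner_mem_side _
    · exact Q.corner_succ_mem_side _

theorem corner_injective : Function.Injective Q.corner := by
  intro k j h
  have h1 : Q.corner j ∈ Q.side k := h ▸ Q.corner_mem_side k
  have h2 : Q.corner j ∈ Q.side (k - 1) := by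
    have := Q.corner_succ_mem_side (k - 1)
    rwa [sub_add_cancel, h] at this
  rw [corner_mem_side_iff] at h1 h2
  have hd : ∀ j k : Fin 4, (j = k ∨ j = k + 1) → (j = k - 1 ∨ j = k - 1 + 1) → k = j := by decide
  exact hd j k h1 h2

end SimpleQuadrilateral

/-! ### The region of a tile near its corners and along its sides -/

namespace QuadTile
variable (Q : QuadTile)

theorem isInteriorAngle' (k : Fin 4) : IsInteriorAngle Q.region (Q.corner k) (Q.dir k)
    (-geodesicVelocity (Q.corner (k - 1)) (Q.dir (k - 1)) (Q.len (k - 1))) (Q.angle k) := by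
  have := Q.isInteriorAngle (k - 1)
  rwa [sub_add_cancel] at this

theorem angle_pos (k : Fin 4) : 0 < Q.angle k := (Q.isInteriorAngle' k).1
theorem angle_lt (k : Fin 4) : Q.angle k < 2 * π := (Q.isInteriorAngle' k).2.1

/-- The unit normal of side `k` that points into the region at corner `k`. -/
noncomputable def nrm (k : Fin 4) : E3 := (Q.isInteriorAngle' k).2.2.choose

theorem frame (k : Fin 4) : IsFrame (Q.corner k : E3) (Q.dir k) (Q.nrm k) := by
  have h := (Q.isInteriorAngle' k).2.2.choose_spec
  exact ⟨by simp, (Q.isUnitTangent_dir k).1, h.1.1, (Q.isUnitTangent_dir k).2, h.1.2, h.2.1⟩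

/-- The direction in which the side `k - 1` leaves corner `k`. -/
noncomputable def back (k : Fin 4) : E3 := cos (Q.angle k) • Q.dir k + sin (Q.angle k) • Q.nrm k

theorem back_eq (k : Fin 4) : Q.back k =
    -geodesicVelocity (Q.corner (k - 1)) (Q.dir (k - 1)) (Q.len (k - 1)) :=
  (Q.isInteriorAngle' k).2.2.choose_spec.2.2.1.symm

theorem back_succ (k : Fin 4) : Q.back (k + 1) =
    -geodesicVelocity (Q.corner k) (Q.dir k) (Q.len k) := by
  rw [back_eq, add_sub_cancel_right]

theorem back_frame (k : Fin 4) : IsFrame (Q.corner k : E3) (Q.back k)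
    (sin (Q.angle k) • Q.dir k - cos (Q.angle k) • Q.nrm k) := by
  have := ((Q.frame k).rotate (Q.angle k)).neg_w
  rwa [show sin (Q.angle k) • Q.dir k - cos (Q.angle k) • Q.nrm k =
    -(-sin (Q.angle k) • Q.dir k + cos (Q.angle k) • Q.nrm k) by module]

/-- Near a corner, the region is the sector between the two sides. -/
theorem mem_region_iff_inSector (k : Fin 4) : ∃ κ < (1 : ℝ), ∀ x : S2,
    κ < inner ℝ (Q.corner k : E3) (x : E3) → x ≠ Q.corner k →
      (x ∈ Q.region ↔
        InSector (Q.angle k) (inner ℝ (Q.dir k) (x : E3)) (inner ℝ (Q.nrm k) (x : E3))) := by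
  obtain ⟨-, -, -, r, hr, h⟩ := (Q.isInteriorAngle' k).2.2.choose_spec
  have hf := Q.frame k
  change ∀ s ∈ Ioo (0 : ℝ) r, ∀ φ ∈ Ico (0 : ℝ) (2 * π), ∀ x : S2,
    (x : E3) = geodesic (Q.corner k) (cos φ • Q.dir k + sin φ • Q.nrm k) s →
      (x ∈ Q.region ↔ φ ≤ Q.angle k) at h
  have hpi := pi_pos
  have hr' : 0 < min r π := lt_min hr hpi
  refine ⟨cos (min r π), ?_, fun x hx hne => ?_⟩
  · rw [← cos_zero]
    exact cos_lt_cos_of_nonneg_of_le_pi le_rfl (min_le_right _ _) hr'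
  have hsq := hf.sq_sum (x := (x : E3)) (by simp)
  have he := hf.expand x
  set P : ℝ := inner ℝ (Q.corner k : E3) (x : E3)
  obtain ⟨ρ, hρ, φ, hφ, hA, hB⟩ := exists_polar (inner ℝ (Q.dir k) (x : E3))
    (inner ℝ (Q.nrm k) (x : E3))
  rw [hA, hB] at he hsq ⊢
  have hρ2 : ρ ^ 2 = 1 - P ^ 2 := by nlinarith [cos_sq_add_sin_sq φ]
  have hP1 : P < 1 := by
    by_contra hh; push Not at hh
    have hP : P = 1 := by nlinarith [sq_nonneg ρ]
    have hρ0 : ρ = 0 := by rw [hP] at hρ2; nlinarith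
    apply hne
    apply Subtype.ext
    rw [he, hP, hρ0]; simp
  have hPm : -1 ≤ P := (neg_one_le_cos _).trans hx.le
  have hcos : cos (arccos P) = P := cos_arccos hPm hP1.le
  have hpos : 0 < arccos P := arccos_pos.2 hP1
  have hlt : arccos P < min r π := by
    by_contra hh; push Not at hh
    have := cos_le_cos_of_nonneg_of_le_pi hr'.le (arccos_le_pi P) hh
    linarith
  have hsin : sin (arccos P) = ρ := by
    rw [sin_arccos, ← hρ2, sqrt_sq hρ]
  have hρ0 : 0 < ρ := by
    rw [← hsin]
    exact sin_pos_of_pos_of_lt_pi hpos (hlt.trans_le (min_le_right _ _))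
  rw [inSector_polar (Q.angle_lt k) hρ0 hφ]
  apply h (arccos P) ⟨hpos, hlt.trans_le (min_le_left _ _)⟩ φ hφ
  rw [geodesic, hcos, hsin]
  rw [he]; module

theorem side_subset_region (k : Fin 4) : Q.side k ⊆ Q.region := by
  refine subset_trans ?_ Q.isClosed_region.frontier_subset
  rw [Q.frontier_region]
  exact subset_iUnion _ k

theorem mem_interior_of_notMem_side {x : S2} (hx : x ∈ Q.region) (h : ∀ k, x ∉ Q.side k) :
    x ∈ interior Q.region := by
  by_contra hh
  have : x ∈ frontier Q.region := ⟨subset_closure hx, hh⟩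
  rw [Q.frontier_region, mem_iUnion] at this
  exact this.elim h

theorem inner_nrm_of_mem_side {k : Fin 4} {x : S2} (hx : x ∈ Q.side k) :
    inner ℝ (Q.nrm k) (x : E3) = (0 : ℝ) := by
  obtain ⟨t, -, h⟩ := hx
  rw [h]; exact inner_normal_geodesic (Q.frame k) t

/-- Along the inner part of a side, the points at a small distance from the side are all in
the region or all outside. -/
theorem strip_mem_iff (k : Fin 4) {t₀ t₂ : ℝ} (h0 : 0 < t₀) (h2 : t₂ < Q.len k) :
    ∃ η > 0, ∀ s, |s| < η → s ≠ 0 → ∀ t ∈ Icc t₀ t₂, ∀ t' ∈ Icc t₀ t₂,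
      stripPoint (Q.frame k) t s ∈ Q.region → stripPoint (Q.frame k) t' s ∈ Q.region := by
  have hcl : IsClosed (⋃ j ∈ {j : Fin 4 | j ≠ k}, Q.side j) :=
    (Set.toFinite _).isClosed_biUnion fun j _ => (Q.isCompact_side j).isClosed
  have hop := hcl.isOpen_compl.preimage (continuous_stripPoint (Q.frame k))
  -- The compact inner part of the side avoids the other sides, so a strip of uniform width around
  -- it avoids them as well.
  obtain ⟨U, V, hU, hV, hUs, hVs, hUV⟩ := generalized_tube_lemma (isCompact_Icc (a := t₀) (b := t₂))
    (isCompact_singleton (x := (0 : ℝ))) hop (by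
      rintro ⟨t, s⟩ ⟨ht, hs⟩
      simp only [mem_singleton_iff] at hs
      subst hs
      simp only [mem_preimage, mem_compl_iff, mem_iUnion, not_exists, mem_ofPred_eq]
      intro j hj hmem
      rw [stripPoint_zero] at hmem
      exact hj (Q.side_unique (t := t) ⟨h0.trans_le ht.1, ht.2.trans_lt h2⟩ hmem))
  obtain ⟨η, hη, hb⟩ := Metric.isOpen_iff.1 hV 0 (hVs rfl)
  refine ⟨min η 1, lt_min hη one_pos, fun s hs hs0 t ht t' ht' hmem => ?_⟩
  by_contra hnot
  have hsin : sin s ≠ 0 := by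
    have h1 := (abs_lt.1 (hs.trans_le (min_le_right _ _)))
    have hp := pi_gt_three
    intro h
    rw [sin_eq_zero_iff_of_lt_of_lt (by linarith) (by linarith)] at h
    exact hs0 h
  have hsV : s ∈ V := hb (by simpa [Real.dist_eq] using hs.trans_le (min_le_left _ _))
  have hpre : IsPreconnected ((fun t => stripPoint (Q.frame k) t s) '' Icc t₀ t₂) :=
    isPreconnected_Icc.image _
      ((continuous_stripPoint (Q.frame k)).comp (by fun_prop : Continuous fun t : ℝ => (t, s))).continuousOn
  -- The curve at constant distance s from the side would cross the frontier. It meets neither this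
  -- side, since sin s ≠ 0, nor the other sides.
  obtain ⟨x, ⟨τ, hτ, rfl⟩, hx⟩ := hpre.exists_mem_frontier
    (mem_image_of_mem _ ht) (mem_image_of_mem _ ht') hmem hnot
  rw [Q.frontier_region, mem_iUnion] at hx
  obtain ⟨j, hj⟩ := hx
  by_cases hjk : j = k
  · subst hjk
    have := Q.inner_nrm_of_mem_side hj
    rw [inner_stripPoint] at this
    exact hsin this
  · have := hUV (mk_mem_prod (hUs hτ) hsV)
    apply this
    simp only [mem_iUnion]
    exact ⟨j, hjk, hj⟩

end QuadTile

theorem tendsto_stripPoint {p : S2} {u n : E3} (h : IsFrame (p : E3) u n) (t : ℝ) :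
    Tendsto (fun s => stripPoint h t s) (𝓝 0) (𝓝 (geoPt p u h.isUnitTangent t)) := by
  have := ((continuous_stripPoint h).comp (by fun_prop : Continuous fun s : ℝ => (t, s))).tendsto 0
  simpa [Function.comp_def, stripPoint_zero] using this

theorem sin_pos_iff_of_abs_lt_one {s : ℝ} (hs : |s| < 1) : 0 < sin s ↔ 0 < s := by
  have h := abs_lt.1 hs
  have hp := pi_gt_three
  constructor
  · intro h0
    by_contra hh; push Not at hh
    linarith [sin_nonpos_of_nonpos_of_neg_pi_le hh (by linarith)]
  · intro h0
    exact sin_pos_of_pos_of_lt_pi h0 (by linarith)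

theorem eventually_sign_eq {X : Type*} [TopologicalSpace X] {f : X → ℝ} {x₀ : X}
    (hf : ContinuousAt f x₀) (h0 : f x₀ ≠ 0) :
    ∀ᶠ x in 𝓝 x₀, Real.sign (f x) = Real.sign (f x₀) := by
  rcases lt_or_gt_of_ne h0 with h | h
  · filter_upwards [hf.tendsto.eventually_lt_const h] with x hx
    rw [Real.sign_of_neg h, Real.sign_of_neg hx]
  · filter_upwards [hf.tendsto.eventually_const_lt h] with x hx
    rw [Real.sign_of_pos h, Real.sign_of_pos hx]

theorem sign_eq_or {x : ℝ} (hx : x ≠ 0) : Real.sign x = 1 ∨ Real.sign x = -1 := by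
  rcases lt_or_gt_of_ne hx with h | h
  · exact Or.inr (Real.sign_of_neg h)
  · exact Or.inl (Real.sign_of_pos h)

theorem real_sign_mul (x y : ℝ) : Real.sign (x * y) = Real.sign x * Real.sign y := by
  rcases lt_trichotomy x 0 with hx | rfl | hx <;> rcases lt_trichotomy y 0 with hy | rfl | hy <;>
    simp [Real.sign_of_pos, Real.sign_of_neg, mul_pos_of_neg_of_neg,
      mul_neg_of_neg_of_pos, mul_neg_of_pos_of_neg, *]

namespace QuadTile
variable (Q : QuadTile)

/-- Next to a side, the region lies on the side of the normal `nrm k`. -/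
theorem eventually_mem_region (k : Fin 4) {t : ℝ} (ht : t ∈ Ioo 0 (Q.len k)) :
    ∀ᶠ x : S2 in 𝓝 (Q.pt k t), (0 < (inner ℝ (Q.nrm k) (x : E3) : ℝ) → x ∈ Q.region) ∧
      ((inner ℝ (Q.nrm k) (x : E3) : ℝ) < 0 → x ∉ Q.region) := by
  obtain ⟨κ, hκ, hR⟩ := Q.mem_region_iff_inSector k
  obtain ⟨t₁, ht₁, h1⟩ := eventually_mem_iff_of_sector (Q.frame k) (Q.angle_pos k) (Q.angle_lt k)
    hκ hR
  have hm : 0 < min t t₁ := lt_min ht.1 ht₁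
  have hm1 := min_le_left t t₁
  have hm2 := min_le_right t t₁
  have h2 := (tendsto_stripPoint (Q.frame k) (min t t₁ / 2)).eventually
    (h1 (min t t₁ / 2) ⟨by linarith, by linarith⟩ (Q.pt k (min t t₁ / 2)) rfl)
  obtain ⟨η₁, hη₁, h3⟩ := Metric.eventually_nhds_iff.1 h2
  -- Near corner k the sector tells on which side of the arc the region lies. The strip carries this
  -- information along to the point at distance t.
  obtain ⟨η₂, hη₂, h4⟩ := Q.strip_mem_iff k (t₀ := min t t₁ / 2) (t₂ := (t + Q.len k) / 2)
    (by linarith) (by linarith [ht.2])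
  have h5 := eventually_stripPoint (Q.frame k) (t₀ := min t t₁ / 2) (t := t)
    (t₂ := (t + Q.len k) / 2) (η := min (min η₁ η₂) 1) (by linarith [ht.1]) (by linarith [ht.2])
    (lt_min (lt_min hη₁ hη₂) one_pos)
  filter_upwards [h5] with x hx
  obtain ⟨t', ht', s, hs, rfl⟩ := hx
  have hs1 : |s| < 1 := hs.trans_le (min_le_right _ _)
  have hsη : |s| < min η₁ η₂ := hs.trans_le (min_le_left _ _)
  have h6 := h3 (y := s) (by rw [Real.dist_eq, sub_zero]; exact hsη.trans_le (min_le_left _ _))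
  have h7 := h4 s (hsη.trans_le (min_le_right _ _))
  have ha : min t t₁ / 2 ∈ Icc (min t t₁ / 2) ((t + Q.len k) / 2) :=
    ⟨le_rfl, by linarith [ht.1, ht.2]⟩
  have hb : t' ∈ Icc (min t t₁ / 2) ((t + Q.len k) / 2) := Ioo_subset_Icc_self ht'
  rw [inner_stripPoint] at h6
  rw [inner_stripPoint]
  constructor
  · intro h0
    have hs0 : s ≠ 0 := by rintro rfl; simp at h0
    exact h7 hs0 _ ha _ hb (h6.2 h0.le)
  · intro h0 hmem
    have hs0 : s ≠ 0 := by rintro rfl; simp at h0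
    exact absurd (h6.1 (h7 hs0 _ hb _ ha hmem)) (not_le.2 h0)

/-- The normals of consecutive sides, both chosen towards the region, are related by the
angle between the sides. -/
theorem nrm_eq (k : Fin 4) : Q.nrm k = sin (Q.angle (k + 1)) • Q.dir (k + 1) -
    cos (Q.angle (k + 1)) • Q.nrm (k + 1) := by
  have hf := Q.back_frame (k + 1)
  have hg := (Q.frame k).geodesicFrame (Q.len k)
  set m := sin (Q.angle (k + 1)) • Q.dir (k + 1) - cos (Q.angle (k + 1)) • Q.nrm (k + 1) with hm
  have e1 : inner ℝ (Q.corner (k + 1) : E3) (Q.nrm k) = (0 : ℝ) := by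
    rw [Q.corner_succ]; exact hg.pw
  have e2 : inner ℝ (Q.back (k + 1)) (Q.nrm k) = (0 : ℝ) := by
    rw [back_succ, inner_neg_left, hg.uw, neg_zero]
  rcases hf.eq_or_eq_neg hg.norm_w e1 e2 with h | h
  · exact h
  -- With the opposite sign, points just off the side near its end would be in the region as seen
  -- from corner k and outside it as seen from corner k + 1.
  exfalso
  obtain ⟨κ, hκ, hR⟩ := Q.mem_region_iff_inSector (k + 1)
  obtain ⟨t₁, ht₁, h1⟩ := eventually_mem_iff_of_sector hf (Q.angle_pos (k + 1)) (Q.angle_lt (k + 1))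
    hκ (R := Q.region) (by
      intro x hx hne
      rw [hR x hx hne, ← inSector_reflect]
      simp only [back, hm, inner_add_left, inner_sub_left, real_inner_smul_left])
  have hl := Q.len_pos k
  set t := min t₁ (Q.len k) / 2 with ht
  have ht0 : 0 < t := by have := lt_min ht₁ hl; positivity
  have hm1 := min_le_left t₁ (Q.len k)
  have hm2 := min_le_right t₁ (Q.len k)
  have h2 := h1 t ⟨ht0, by linarith⟩ (Q.pt k (Q.len k - t)) (by
    rw [back_succ, Q.corner_succ, geodesic_sub]; rfl)
  have h3 := Q.eventually_mem_region k (t := Q.len k - t) ⟨by linarith, by linarith⟩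
  have h4 := (tendsto_stripPoint (Q.frame k) (Q.len k - t)).eventually (h2.and h3)
  obtain ⟨η, hη, h5⟩ := Metric.eventually_nhds_iff.1 h4
  have hs : 0 < min η 1 / 2 := by positivity
  have h6 := h5 (y := min η 1 / 2) (by
    rw [Real.dist_eq, sub_zero, abs_of_pos hs]; linarith [min_le_left η 1])
  have hsin : 0 < sin (min η 1 / 2) :=
    (sin_pos_iff_of_abs_lt_one (by rw [abs_of_pos hs]; linarith [min_le_right η 1])).2 hs
  obtain ⟨h7, h8, -⟩ := h6
  rw [inner_stripPoint] at h8
  have h9 := h7.1 (h8 hsin)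
  rw [← neg_neg m, ← h, inner_neg_left, inner_stripPoint] at h9
  linarith

theorem inner_nrm_pred (k : Fin 4) (x : E3) : (inner ℝ (Q.nrm (k - 1)) x : ℝ) =
    sin (Q.angle k) * inner ℝ (Q.dir k) x - cos (Q.angle k) * inner ℝ (Q.nrm k) x := by
  have := Q.nrm_eq (k - 1)
  rw [sub_add_cancel] at this
  rw [this, inner_sub_left, real_inner_smul_left, real_inner_smul_left]

/-! ### The charge of a tile: a discrete Gauss–Bonnet theorem -/

/-- The point lies on no great circle of a side. -/
def Generic (x : E3) : Prop := ∀ k, (inner ℝ (Q.nrm k) x : ℝ) ≠ 0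

open Classical in
/-- The indicator function of the region. -/
noncomputable def ind (x : S2) : ℝ := if x ∈ Q.region then 1 else 0

/-- The number of the directions towards and away from `x` in the sector of corner `k`. -/
noncomputable def cornerCount (k : Fin 4) (x : E3) : ℝ :=
  sectorCount (Q.angle k) (inner ℝ (Q.dir k) x) (inner ℝ (Q.nrm k) x) +
    sectorCount (Q.angle k) (-inner ℝ (Q.dir k) x) (-inner ℝ (Q.nrm k) x)

/-- The number of corner directions towards and away from `x` inside the tile, corrected
by the positions of `x` and its antipode. -/
noncomputable def charge (x : S2) : ℝ :=
  ∑ k, Q.cornerCount k x - 2 * Q.ind x - 2 * Q.ind (-x)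

/-- By `inner_nrm_pred` the two linear forms bounding the sector of corner k are the normals of
sides k − 1 and k. So the count depends only on the position of x relative to these two great
circles. -/
theorem cornerCount_eq (k : Fin 4) {x : E3} (hx : Q.Generic x) :
    Q.cornerCount k x = 1 - Real.sign (sin (Q.angle k)) *
      (1 - Real.sign (inner ℝ (Q.nrm (k - 1)) x) * Real.sign (inner ℝ (Q.nrm k) x)) / 2 := by
  have h1 := hx (k - 1)
  rw [inner_nrm_pred] at h1 ⊢
  exact sectorCount_add_neg (Q.angle_pos k) (Q.angle_lt k) (hx k) h1

-- Crossing a side at an inner point changes the indicator by 1, written as half the jump of the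
-- sign of its normal. This form lets it be compared with the jumps of the corner counts.
open Classical in
theorem eventually_ind_eq {x₀ : S2} (hx₀ : ∀ k, x₀ ≠ Q.corner k) : ∃ c : ℝ, ∀ᶠ x : S2 in 𝓝 x₀,
    Q.Generic x → Q.ind x = c + 1 / 2 * ∑ k, Real.sign (inner ℝ (Q.nrm k) (x : E3)) *
      (if x₀ ∈ Q.side k then 1 else 0) := by
  by_cases h : ∃ k, x₀ ∈ Q.side k
  · obtain ⟨k, t, ht, hk⟩ := h
    replace hk : x₀ = Q.pt k t := Subtype.ext hk
    subst hk
    have ht' : t ∈ Ioo 0 (Q.len k) := by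
      refine ⟨lt_of_le_of_ne ht.1 ?_, lt_of_le_of_ne ht.2 ?_⟩
      · rintro rfl; exact hx₀ k (Q.pt_zero k)
      · rintro rfl; exact hx₀ (k + 1) (Q.pt_len k)
    refine ⟨1 / 2, ?_⟩
    filter_upwards [Q.eventually_mem_region k ht'] with x hx hgen
    rw [Finset.sum_eq_single k]
    · rw [if_pos (Q.pt_mem_side ht), ind]
      rcases lt_or_gt_of_ne (hgen k) with h | h
      · rw [Real.sign_of_neg h, if_neg (hx.2 h)]; norm_num
      · rw [Real.sign_of_pos h, if_pos (hx.1 h)]; norm_num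
    · intro j _ hj
      rw [if_neg (fun hmem => hj (Q.side_unique ht' hmem)), mul_zero]
    · simp
  · push Not at h
    have hfr : x₀ ∉ frontier Q.region := by
      rw [Q.frontier_region, mem_iUnion]; push Not; exact h
    refine ⟨Q.ind x₀, ?_⟩
    simp only [h, if_false, mul_zero, Finset.sum_const_zero, add_zero]
    by_cases hm : x₀ ∈ Q.region
    · have : x₀ ∈ interior Q.region := Q.mem_interior_of_notMem_side hm h
      filter_upwards [isOpen_interior.mem_nhds this] with x hx _
      rw [ind, ind, if_pos hm, if_pos (interior_subset hx)]
    · filter_upwards [Q.isClosed_region.isOpen_compl.mem_nhds hm] with x hx _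
      rw [ind, ind, if_neg hm, if_neg hx]

end QuadTile

theorem IsFrame.coord_ne_zero {p u w : E3} (h : IsFrame p u w) {x : E3} (hx : ‖x‖ = 1)
    (h1 : x ≠ p) (h2 : x ≠ -p) : (inner ℝ u x : ℝ) ≠ 0 ∨ (inner ℝ w x : ℝ) ≠ 0 := by
  by_contra! hh
  rcases h.rot.eq_or_eq_neg hx hh.1 hh.2 with h | h
  · exact h1 h
  · exact h2 h

open Classical in
/-- Behaviour of the product of two signs near a common zero of the linear forms. -/
theorem eventually_sign_mul_sign {X : Type*} [TopologicalSpace X] {A B : X → ℝ} {x₀ : X} {θ : ℝ}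
    (hA : ContinuousAt A x₀) (hB : ContinuousAt B x₀) (h0 : 0 < θ) (hθ : θ < 2 * π)
    (hne : A x₀ ≠ 0 ∨ B x₀ ≠ 0) :
    ∃ c : ℝ, ∀ᶠ x in 𝓝 x₀, Real.sign (sin θ) * Real.sign (sin θ * A x - cos θ * B x) *
      Real.sign (B x) = c + (if B x₀ = 0 then Real.sign (B x) * Real.sign (A x₀) else 0) +
      (if sin θ * A x₀ - cos θ * B x₀ = 0 then Real.sign (sin θ * A x - cos θ * B x) *
        Real.sign (cos θ * A x₀ + sin θ * B x₀) else 0) := by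
  have hH : ContinuousAt (fun x => sin θ * A x - cos θ * B x) x₀ := by fun_prop
  have hpi := pi_pos
  have htrig := cos_sq_add_sin_sq θ
  have hsq : ∀ y : ℝ, y ≠ 0 → Real.sign y * Real.sign y = 1 := by
    intro y hy; rcases sign_eq_or hy with h | h <;> rw [h] <;> norm_num
  by_cases h1 : B x₀ = 0 <;> by_cases h2 : sin θ * A x₀ - cos θ * B x₀ = 0
  -- Both forms vanish only for a straight angle θ = π. The left side is then 0 and the two
  -- contributions on the right cancel.
  · have hA0 : A x₀ ≠ 0 := by tauto
    rw [h1] at h2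
    have hs : sin θ = 0 := by
      simp only [mul_zero, sub_zero, mul_eq_zero] at h2; tauto
    have hpi' : θ = π := by
      have := (sin_eq_zero_iff_of_lt_of_lt (x := θ - π) (by linarith) (by linarith)).1
        (by rw [sin_sub_pi, hs, neg_zero])
      linarith
    refine ⟨0, Eventually.of_forall fun x => ?_⟩
    rw [if_pos h1, hpi', h1]
    simp [Real.sign_neg]
  · refine ⟨0, ?_⟩
    filter_upwards [eventually_sign_eq hH h2] with x hx
    rw [if_pos h1, if_neg h2, hx, h1]
    have hs : sin θ ≠ 0 := by rintro hs; simp [hs, h1] at h2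
    simp only [mul_zero, sub_zero, real_sign_mul]
    linear_combination Real.sign (A x₀) * Real.sign (B x) * hsq _ hs
  · refine ⟨0, ?_⟩
    filter_upwards [eventually_sign_eq hB h1] with x hx
    rw [if_neg h1, if_pos h2, hx]
    have hB0 : B x₀ = sin θ * (cos θ * A x₀ + sin θ * B x₀) := by
      linear_combination (-cos θ) * h2 - B x₀ * htrig
    have hs : sin θ ≠ 0 := by rintro hs; rw [hs] at hB0; simp at hB0; exact h1 hB0
    conv_lhs => rw [hB0, real_sign_mul]
    linear_combination Real.sign (sin θ * A x - cos θ * B x) *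
      Real.sign (cos θ * A x₀ + sin θ * B x₀) * hsq _ hs
  · refine ⟨Real.sign (sin θ) * Real.sign (sin θ * A x₀ - cos θ * B x₀) * Real.sign (B x₀), ?_⟩
    filter_upwards [eventually_sign_eq hH h2, eventually_sign_eq hB h1] with x hx hx'
    rw [if_neg h1, if_neg h2, hx, hx']; ring

namespace SimpleQuadrilateral
variable (Q : SimpleQuadrilateral)

theorem pt_mem_side_iff {k : Fin 4} {t : ℝ} (ht : t ∈ Ico 0 (2 * π)) :
    Q.pt k t ∈ Q.side k ↔ t ≤ Q.len k := by
  constructor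
  · rintro ⟨s, hs, h⟩
    obtain ⟨n, hn⟩ := geodesic_inj (Q.isUnitTangent_dir k) h
    have := Q.len_lt k
    have := int_bound_zero hn (by linarith [hs.2, ht.1]) (by linarith [hs.1, ht.2])
    subst this
    simp at hn
    rw [hn]; exact hs.2
  · intro h
    exact Q.pt_mem_side ⟨ht.1, h⟩

theorem neg_pt (k : Fin 4) (t : ℝ) : -Q.pt k t = Q.pt k (t + π) := by
  apply Subtype.ext
  rw [coe_neg_sphere, coe_pt, coe_pt, geodesic, geodesic, cos_add_pi, sin_add_pi]
  module

open Classical in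
theorem ind_side_sub_aux {k : Fin 4} {t : ℝ} (h0 : 0 < t) (h1 : t < π)
    (h2 : sin (Q.len k - t) ≠ 0) :
    (if Q.pt k t ∈ Q.side k then (1 : ℝ) else 0) - (if -Q.pt k t ∈ Q.side k then 1 else 0) =
      1 / 2 * (1 + Real.sign (sin (Q.len k - t))) := by
  have hpi := pi_pos
  have hl := Q.len_pos k
  have hl' := Q.len_lt k
  rw [neg_pt, Q.pt_mem_side_iff ⟨h0.le, by linarith⟩,
    Q.pt_mem_side_iff ⟨by linarith, by linarith⟩]
  rcases lt_trichotomy (Q.len k) t with h | h | h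
  · rw [if_neg (by linarith), if_neg (by linarith), ← neg_sub t, sin_neg, Real.sign_neg,
      sign_sin_pos (by linarith) (by linarith)]
    norm_num
  · simp [h] at h2
  · rcases lt_trichotomy (Q.len k) (t + π) with h' | h' | h'
    · rw [if_pos h.le, if_neg (by linarith), sign_sin_pos (by linarith) (by linarith)]
      norm_num
    · simp [h'] at h2
    · rw [if_pos h.le, if_pos h'.le, sign_sin_neg (by linarith) (by linarith)]
      norm_num

end SimpleQuadrilateral

namespace QuadTile
variable (Q : QuadTile)

theorem inner_dir_pt (k : Fin 4) (t : ℝ) : inner ℝ (Q.dir k) (Q.pt k t : E3) = sin t := by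
  simp only [SimpleQuadrilateral.coe_pt, geodesic, inner_add_right, real_inner_smul_right,
    (Q.frame k).up, (Q.frame k).inner_self_u]
  ring

theorem inner_back_pt (k : Fin 4) (t : ℝ) :
    inner ℝ (Q.back (k + 1)) (Q.pt k t : E3) = sin (Q.len k - t) := by
  have hf := Q.frame k
  simp only [SimpleQuadrilateral.coe_pt, back_succ, geodesic, geodesicVelocity, inner_add_right,
    inner_add_left, inner_neg_left, real_inner_smul_left, real_inner_smul_right,
    hf.up, hf.pu, hf.inner_self_u, hf.inner_self_p, sin_sub]
  ring

open Classical in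
/-- Whether `x₀` or its antipode lies on side `k`, for a point of the great circle of side `k`. -/
theorem ind_side_sub {k : Fin 4} {x₀ : S2} (h0 : (inner ℝ (Q.nrm k) (x₀ : E3) : ℝ) = 0)
    (h1 : ∀ j, x₀ ≠ Q.corner j) (h2 : ∀ j, x₀ ≠ -Q.corner j) :
    (if x₀ ∈ Q.side k then (1 : ℝ) else 0) - (if -x₀ ∈ Q.side k then 1 else 0) =
      1 / 2 * (Real.sign (inner ℝ (Q.dir k) (x₀ : E3)) +
        Real.sign (inner ℝ (Q.back (k + 1)) (x₀ : E3))) := by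
  have hf := Q.frame k
  have hpi := pi_pos
  -- A vanishing sine would place the point at an end of the side or at the antipode of an end.
  have key : ∀ t ∈ Ico 0 (2 * π), x₀ = Q.pt k t → sin t ≠ 0 ∧ sin (Q.len k - t) ≠ 0 := by
    rintro t ht rfl
    constructor
    · intro hs
      rcases hf.coord_ne_zero (x := (Q.pt k t : E3)) (by simp) (fun h => h1 k (Subtype.ext h))
        (fun h => h2 k (Subtype.ext h)) with h | h
      · exact h (by rw [inner_dir_pt, hs])
      · exact h h0
    · intro hs
      obtain ⟨n, hn⟩ := sin_eq_zero_iff.1 hs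
      have hsm : geodesic (Q.corner (k + 1)) (Q.back (k + 1)) (Q.len k - t) =
          (Q.pt k t : E3) := by
        rw [back_succ, Q.corner_succ, geodesic_sub, sub_sub_cancel]; rfl
      rw [geodesic, hs, zero_smul, add_zero] at hsm
      have hc : cos (Q.len k - t) = 1 ∨ cos (Q.len k - t) = -1 := by
        have := cos_sq_add_sin_sq (Q.len k - t)
        rw [hs] at this
        have := (sq_eq_sq_iff_eq_or_eq_neg (a := cos (Q.len k - t)) (b := 1)).1 (by linarith)
        simpa using this
      rcases hc with hc | hc <;> rw [hc] at hsm
      · exact h1 (k + 1) (Subtype.ext (by simpa using hsm.symm))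
      · exact h2 (k + 1) (Subtype.ext (by simpa using hsm.symm))
  have hex : ∃ t ∈ Ico 0 (2 * π), x₀ = Q.pt k t := by
    obtain ⟨ρ, hρ, φ, hφ, hA, hB⟩ := exists_polar (inner ℝ (Q.corner k : E3) (x₀ : E3))
      (inner ℝ (Q.dir k) (x₀ : E3))
    have hsq := hf.sq_sum (x := (x₀ : E3)) (by simp)
    have he := hf.expand x₀
    rw [h0, hA, hB] at hsq he
    have hρ2 : ρ ^ 2 = 1 := by linear_combination hsq - ρ ^ 2 * cos_sq_add_sin_sq φ
    have hρ1 : ρ = 1 := by nlinarith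
    refine ⟨φ, hφ, Subtype.ext ?_⟩
    rw [he, hρ1, SimpleQuadrilateral.coe_pt, geodesic]
    module
  obtain ⟨t, ht, rfl⟩ := hex
  obtain ⟨hs, hs'⟩ := key t ht rfl
  rw [inner_dir_pt, inner_back_pt]
  have ht0 : t ≠ 0 := by rintro rfl; simp at hs
  have htp : t ≠ π := by rintro rfl; simp at hs
  have hpos : 0 < t := lt_of_le_of_ne ht.1 ht0.symm
  -- Both sides of the identity are odd under x₀ ↦ −x₀, so the half circle 0 < t < π is enough.
  rcases lt_or_gt_of_ne htp with h | h
  · rw [sign_sin_pos hpos h, Q.ind_side_sub_aux hpos h hs']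
  · have e : Q.pt k t = -Q.pt k (t - π) := by rw [Q.neg_pt, sub_add_cancel]
    have := Q.ind_side_sub_aux (k := k) (t := t - π) (by linarith) (by linarith [ht.2])
      (by rw [show Q.len k - (t - π) = Q.len k - t + π by ring, sin_add_pi]; simpa using hs')
    rw [show Q.len k - (t - π) = Q.len k - t + π by ring, sin_add_pi, Real.sign_neg] at this
    rw [e, neg_neg, sign_sin_neg h ht.2]
    linarith

open Classical in
/-- The charge is locally constant away from the corners and their antipodes. -/
theorem eventually_charge_eq {x₀ : S2} (h1 : ∀ j, x₀ ≠ Q.corner j) (h2 : ∀ j, x₀ ≠ -Q.corner j) :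
    ∃ c : ℝ, ∀ᶠ x : S2 in 𝓝 x₀, Q.Generic x → Q.charge x = c := by
  have hcor : ∀ k, ∃ c : ℝ, ∀ᶠ x : S2 in 𝓝 x₀, Q.Generic x → Q.cornerCount k x = c + 1 / 2 *
      ((if (inner ℝ (Q.nrm k) (x₀ : E3) : ℝ) = 0 then Real.sign (inner ℝ (Q.nrm k) (x : E3)) *
        Real.sign (inner ℝ (Q.dir k) (x₀ : E3)) else 0) +
      (if (inner ℝ (Q.nrm (k - 1)) (x₀ : E3) : ℝ) = 0 then
        Real.sign (inner ℝ (Q.nrm (k - 1)) (x : E3)) *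
          Real.sign (inner ℝ (Q.back k) (x₀ : E3)) else 0)) := by
    intro k
    obtain ⟨c, hc⟩ := eventually_sign_mul_sign (A := fun x : S2 => (inner ℝ (Q.dir k) (x : E3) : ℝ))
      (B := fun x : S2 => (inner ℝ (Q.nrm k) (x : E3) : ℝ)) (x₀ := x₀) (by fun_prop) (by fun_prop)
      (Q.angle_pos k) (Q.angle_lt k) ((Q.frame k).coord_ne_zero (by simp)
        (fun h => h1 k (Subtype.ext h)) (fun h => h2 k (Subtype.ext h)))
    refine ⟨1 - Real.sign (sin (Q.angle k)) / 2 + c / 2, ?_⟩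
    filter_upwards [hc] with x hx hgen
    rw [Q.cornerCount_eq k hgen]
    simp only [inner_nrm_pred]
    simp only [back, inner_add_left, real_inner_smul_left]
    linear_combination hx / 2
  choose c hc using hcor
  obtain ⟨d, hd⟩ := Q.eventually_ind_eq h1
  obtain ⟨d', hd'⟩ := Q.eventually_ind_eq (x₀ := -x₀)
    (fun k h => h2 k (by rw [← h, neg_neg]))
  have hneg : Tendsto (fun x : S2 => -x) (𝓝 x₀) (𝓝 (-x₀)) := continuous_neg.tendsto x₀
  refine ⟨∑ k, c k - 2 * d - 2 * d', ?_⟩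
  filter_upwards [eventually_all.2 hc, hd, hneg.eventually hd'] with x e1 e2 e3 hgen
  have hgen' : Q.Generic (-x : S2) := by
    intro k; rw [coe_neg_sphere, inner_neg_right, neg_ne_zero]; exact hgen k
  rw [charge, e2 hgen, e3 hgen', Finset.sum_congr rfl fun k _ => e1 k hgen]
  simp only [coe_neg_sphere, inner_neg_right, Real.sign_neg]
  -- Side k bounds the sectors of corners k and k + 1. After the shift of index both of its
  -- contributions stand in the same summand.
  have hshift : ∑ k, (if (inner ℝ (Q.nrm (k - 1)) (x₀ : E3) : ℝ) = 0 then
        Real.sign (inner ℝ (Q.nrm (k - 1)) (x : E3)) *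
          Real.sign (inner ℝ (Q.back k) (x₀ : E3)) else 0) =
      ∑ k, (if (inner ℝ (Q.nrm k) (x₀ : E3) : ℝ) = 0 then
        Real.sign (inner ℝ (Q.nrm k) (x : E3)) *
          Real.sign (inner ℝ (Q.back (k + 1)) (x₀ : E3)) else 0) := by
    refine Fintype.sum_equiv (Equiv.subRight 1) _ _ fun k => ?_
    simp
  rw [Finset.sum_add_distrib, ← Finset.mul_sum, Finset.sum_add_distrib, hshift,
    ← Finset.sum_add_distrib]
  -- The jumps of the two corner counts across the great circle of side k are exactly those of the
  -- indicators at x and −x, by `ind_side_sub`. Hence they cancel in the charge.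
  have hk : ∀ k, (if (inner ℝ (Q.nrm k) (x₀ : E3) : ℝ) = 0 then
      Real.sign (inner ℝ (Q.nrm k) (x : E3)) * Real.sign (inner ℝ (Q.dir k) (x₀ : E3)) else 0) +
      (if (inner ℝ (Q.nrm k) (x₀ : E3) : ℝ) = 0 then Real.sign (inner ℝ (Q.nrm k) (x : E3)) *
          Real.sign (inner ℝ (Q.back (k + 1)) (x₀ : E3)) else 0) =
      2 * (Real.sign (inner ℝ (Q.nrm k) (x : E3)) * (if x₀ ∈ Q.side k then 1 else 0) +
        -Real.sign (inner ℝ (Q.nrm k) (x : E3)) * (if -x₀ ∈ Q.side k then 1 else 0)) := by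
    intro k
    by_cases h : (inner ℝ (Q.nrm k) (x₀ : E3) : ℝ) = 0
    · have := Q.ind_side_sub h h1 h2
      rw [if_pos h, if_pos h]
      linear_combination (-2 * Real.sign (inner ℝ (Q.nrm k) (x : E3))) * this
    · rw [if_neg h, if_neg h, if_neg (fun hm => h (Q.inner_nrm_of_mem_side hm)),
        if_neg (fun hm => h (by simpa using Q.inner_nrm_of_mem_side hm))]
      simp
  rw [Finset.sum_congr rfl fun k _ => hk k, ← Finset.mul_sum, Finset.sum_add_distrib]
  ring

end QuadTile

/-- The points off a great circle are dense in the sphere. -/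
theorem dense_inner_ne_zero {n : E3} (hn : ‖n‖ = 1) :
    Dense {x : S2 | (inner ℝ n (x : E3) : ℝ) ≠ 0} := by
  intro x₀
  by_cases h : (inner ℝ n (x₀ : E3) : ℝ) = 0
  · obtain ⟨u, hu⟩ := exists_isFrame' (x₀ : E3) n (by simp) hn (by rw [real_inner_comm]; exact h)
    have hf := hu.swap
    have h1 := tendsto_stripPoint hf 0
    have e : geoPt x₀ u hf.isUnitTangent 0 = x₀ := Subtype.ext (geodesic_zero _ _)
    rw [e] at h1
    refine mem_closure_of_tendsto (b := 𝓝[>] (0 : ℝ)) (h1.mono_left nhdsWithin_le_nhds) ?_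
    have h2 : ∀ᶠ s in 𝓝[>] (0 : ℝ), s ∈ Ioo (0 : ℝ) 1 := Ioo_mem_nhdsGT one_pos
    filter_upwards [h2] with s hs
    rw [inner_stripPoint]
    exact (sin_pos_of_pos_of_le_one hs.1 hs.2.le).ne'
  · exact subset_closure h

theorem isOpen_inner_ne_zero (n : E3) : IsOpen {x : S2 | (inner ℝ n (x : E3) : ℝ) ≠ 0} :=
  isOpen_ne_fun (by fun_prop) continuous_const

theorem dense_forall_inner_ne_zero {ι : Type*} [Finite ι] (n : ι → E3) (hn : ∀ i, ‖n i‖ = 1) :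
    Dense {x : S2 | ∀ i, (inner ℝ (n i) (x : E3) : ℝ) ≠ 0} := by
  have := dense_iInter_of_isOpen (fun i => isOpen_inner_ne_zero (n i))
    (fun i => dense_inner_ne_zero (hn i))
  rwa [← ofPred_forall] at this

namespace QuadTile
variable (Q : QuadTile)

theorem dense_generic : Dense {x : S2 | Q.Generic x} :=
  dense_forall_inner_ne_zero Q.nrm fun k => (Q.frame k).norm_w

/-- Without the corners and their antipodes the sphere is connected, and near each of its points the
charge has one generic value. As generic points are dense, neighbouring values agree. -/
theorem charge_eq_charge {x y : S2} (hx : Q.Generic x) (hy : Q.Generic y) :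
    Q.charge x = Q.charge y := by
  let B : Set S2 := range Q.corner ∪ range (fun k => -Q.corner k)
  have hB : B.Finite := (finite_range _).union (finite_range _)
  have hconn := isPreconnected_compl_finite hB (v := Q.corner 0) (Or.inl ⟨0, rfl⟩)
  have hmem : ∀ z : S2, Q.Generic z → z ∈ Bᶜ := by
    rintro z hz (⟨k, rfl⟩ | ⟨k, rfl⟩)
    · exact hz k (Q.frame k).wp
    · apply hz k
      rw [coe_neg_sphere, inner_neg_right, (Q.frame k).wp, neg_zero]
  have hloc : ∀ z ∈ Bᶜ, ∃ c : ℝ, ∀ᶠ x : S2 in 𝓝 z, Q.Generic x → Q.charge x = c := by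
    intro z hz
    apply Q.eventually_charge_eq
    · rintro j rfl; exact hz (Or.inl ⟨j, rfl⟩)
    · rintro j rfl; exact hz (Or.inr ⟨j, rfl⟩)
  have huniq : ∀ z : S2, ∀ c c' : ℝ, (∀ᶠ x : S2 in 𝓝 z, Q.Generic x → Q.charge x = c) →
      (∀ᶠ x : S2 in 𝓝 z, Q.Generic x → Q.charge x = c') → c = c' := by
    intro z c c' h h'
    obtain ⟨w, hw, hw'⟩ := Q.dense_generic.inter_nhds_nonempty (h.and h')
    rw [← hw'.1 hw, ← hw'.2 hw]
  have key := hconn.induction₂ (fun z z' => ∃ c : ℝ,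
      (∀ᶠ x : S2 in 𝓝 z, Q.Generic x → Q.charge x = c) ∧
      (∀ᶠ x : S2 in 𝓝 z', Q.Generic x → Q.charge x = c)) ?_ ?_ ?_ (hmem x hx) (hmem y hy)
  · obtain ⟨c, h1, h2⟩ := key
    rw [h1.self_of_nhds hx, h2.self_of_nhds hy]
  · intro z hz
    obtain ⟨c, hc⟩ := hloc z hz
    filter_upwards [mem_nhdsWithin_of_mem_nhds hc.eventually_nhds] with z' hz'
    exact ⟨c, hc, hz'⟩
  · rintro z z' z'' - - - ⟨c, h1, h2⟩ ⟨c', h3, h4⟩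
    have := huniq z' c c' h2 h3
    subst this
    exact ⟨c, h1, h4⟩
  · rintro z z' - - ⟨c, h1, h2⟩
    exact ⟨c, h2, h1⟩

/-- Modulo 2 the count is 1, plus 1 if x lies on different sides of the two bounding great circles.
For a straight angle the two forms coincide, so no sign change occurs. -/
theorem cornerCount_parity (k : Fin 4) {x : E3} (hx : Q.Generic x) : ∃ m : ℤ,
    Q.cornerCount k x = 1 + (1 - Real.sign (inner ℝ (Q.nrm (k - 1)) x) *
      Real.sign (inner ℝ (Q.nrm k) x)) / 2 + 2 * m := by
  have h2 : ∀ y : ℝ, Real.sign y = 0 ∨ Real.sign y = 1 ∨ Real.sign y = -1 := by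
    intro y
    rcases lt_trichotomy y 0 with h | h | h
    · right; right; exact Real.sign_of_neg h
    · left; simp [h]
    · right; left; exact Real.sign_of_pos h
  have h0 := hx k
  have h1 := hx (k - 1)
  rw [Q.cornerCount_eq k hx]
  rw [inner_nrm_pred] at h1 ⊢
  have h3 : Real.sign (sin (Q.angle k)) = 0 →
      Real.sign (sin (Q.angle k) * inner ℝ (Q.dir k) x - cos (Q.angle k) * inner ℝ (Q.nrm k) x) =
        Real.sign (inner ℝ (Q.nrm k) x) := by
    intro hs
    rw [Real.sign_eq_zero_iff] at hs
    have hpi := pi_pos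
    have := (sin_eq_zero_iff_of_lt_of_lt (x := Q.angle k - π) (by linarith [Q.angle_pos k])
      (by linarith [Q.angle_lt k])).1 (by rw [sin_sub_pi, hs, neg_zero])
    have hpi' : Q.angle k = π := by linarith
    rw [hpi']; simp
  rcases sign_eq_or h0 with a | a <;> rcases sign_eq_or h1 with b | b <;>
    rcases h2 (sin (Q.angle k)) with c | c | c <;>
    first
    | (refine ⟨-1, ?_⟩; rw [a, b, c]; norm_num; done)
    | (refine ⟨0, ?_⟩; rw [a, b, c]; norm_num; done)
    | (have := h3 c; rw [a, b] at this; norm_num at this)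

/-- The charge is the same even integer at all generic points. -/
theorem exists_charge : ∃ m : ℤ, ∀ x : S2, Q.Generic x → Q.charge x = 2 * m := by
  have : Nonempty S2 := ⟨Q.corner 0⟩
  obtain ⟨y, hy⟩ := Q.dense_generic.nonempty
  choose m hm using fun k => Q.cornerCount_parity k hy
  have hind : ∀ z, ∃ i : ℤ, Q.ind z = i := by
    intro z; unfold ind; split_ifs
    · exact ⟨1, by simp⟩
    · exact ⟨0, by simp⟩
  obtain ⟨i, hi⟩ := hind y
  obtain ⟨j, hj⟩ := hind (-y)
  have key : ∃ n : ℤ, Q.charge y = 2 * n := by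
    rw [charge, hi, hj, Fin.sum_univ_four, hm, hm, hm, hm]
    rw [show (0 - 1 : Fin 4) = 3 from rfl, show (1 - 1 : Fin 4) = 0 from rfl,
      show (2 - 1 : Fin 4) = 1 from rfl, show (3 - 1 : Fin 4) = 2 from rfl]
    -- The number of sign changes around a cycle of four signs is even.
    have hs : ∃ q : ℤ, (4 : ℝ) - Real.sign (inner ℝ (Q.nrm 3) (y : E3)) * Real.sign (inner ℝ (Q.nrm 0) (y : E3))
      - Real.sign (inner ℝ (Q.nrm 0) (y : E3)) * Real.sign (inner ℝ (Q.nrm 1) (y : E3))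
      - Real.sign (inner ℝ (Q.nrm 1) (y : E3)) * Real.sign (inner ℝ (Q.nrm 2) (y : E3))
      - Real.sign (inner ℝ (Q.nrm 2) (y : E3)) * Real.sign (inner ℝ (Q.nrm 3) (y : E3)) = 4 * q := by
      rcases sign_eq_or (hy 0) with a | a <;> rcases sign_eq_or (hy 1) with b | b <;>
      rcases sign_eq_or (hy 2) with c | c <;> rcases sign_eq_or (hy 3) with d | d <;>
      rw [a, b, c, d] <;>
      first
      | (refine ⟨0, ?_⟩; norm_num; done)
      | (refine ⟨1, ?_⟩; norm_num; done)
      | (refine ⟨2, ?_⟩; norm_num)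
    obtain ⟨q, hq⟩ := hs
    refine ⟨2 + q + m 0 + m 1 + m 2 + m 3 - i - j, ?_⟩
    push_cast
    linear_combination hq / 2
  obtain ⟨n, hn⟩ := key
  exact ⟨n, fun x hx => by rw [Q.charge_eq_charge hx hy, hn]⟩

end QuadTile

/-! ### Moved tiles, shared sides and common corners -/

theorem coe_move (g : E3 ≃ₗᵢ[ℝ] E3) (x : S2) : (move g x : E3) = g x := rfl

/-- The action of an orthogonal transformation as a homeomorphism of the sphere. -/
noncomputable def moveHomeo (g : E3 ≃ₗᵢ[ℝ] E3) : S2 ≃ₜ S2 where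
  toFun := move g
  invFun := move g.symm
  left_inv x := Subtype.ext (by simp [coe_move])
  right_inv x := Subtype.ext (by simp [coe_move])
  continuous_toFun := by unfold move; fun_prop
  continuous_invFun := by unfold move; fun_prop

theorem move_injective (g : E3 ≃ₗᵢ[ℝ] E3) : Function.Injective (move g) := (moveHomeo g).injective

theorem mem_move_image {g : E3 ≃ₗᵢ[ℝ] E3} {R : Set S2} {x : S2} :
    x ∈ move g '' R ↔ move g.symm x ∈ R := by
  rw [show move g '' R = (moveHomeo g) '' R from rfl, Homeomorph.image_eq_preimage_symm]
  rfl

theorem interior_move_image (g : E3 ≃ₗᵢ[ℝ] E3) (R : Set S2) :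
    interior (move g '' R) = move g '' interior R := ((moveHomeo g).image_interior R).symm

theorem inner_map_left (g : E3 ≃ₗᵢ[ℝ] E3) (n x : E3) :
    (inner ℝ (g n) x : ℝ) = inner ℝ n (g.symm x) := by
  conv_lhs => rw [← g.apply_symm_apply x]
  exact g.inner_map_map _ _

theorem map_geodesic (g : E3 ≃ₗᵢ[ℝ] E3) (p u : E3) (t : ℝ) :
    g (geodesic p u t) = geodesic (g p) (g u) t := by simp [geodesic]

theorem map_geodesicVelocity (g : E3 ≃ₗᵢ[ℝ] E3) (p u : E3) (t : ℝ) :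
    g (geodesicVelocity p u t) = geodesicVelocity (g p) (g u) t := by simp [geodesicVelocity]

theorem move_image_geodesicArc (g : E3 ≃ₗᵢ[ℝ] E3) (p : S2) (u : E3) (l : ℝ) :
    move g '' geodesicArc p u l = geodesicArc (move g p) (g u) l := by
  ext x
  rw [mem_move_image]
  constructor
  · rintro ⟨t, ht, h⟩
    refine ⟨t, ht, ?_⟩
    rw [coe_move] at h
    rw [coe_move, ← map_geodesic, ← h, LinearIsometryEquiv.apply_symm_apply]
  · rintro ⟨t, ht, h⟩
    refine ⟨t, ht, ?_⟩
    rw [coe_move, h, coe_move, ← map_geodesic, LinearIsometryEquiv.symm_apply_apply]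

theorem IsUnitTangent.map {p : S2} {u : E3} (h : IsUnitTangent p u) (g : E3 ≃ₗᵢ[ℝ] E3) :
    IsUnitTangent (move g p) (g u) := by
  refine ⟨by simpa using h.1, ?_⟩
  rw [coe_move, g.inner_map_map]; exact h.2

section Tiling
variable (Q : QuadTile) {f : ℕ} (g : Fin f → E3 ≃ₗᵢ[ℝ] E3)

/-- The corner `k` of tile `i`. -/
noncomputable def vert (i : Fin f) (k : Fin 4) : S2 := move (g i) (Q.corner k)

/-- The side of a tile that leaves corner `c` in direction `dir c` (for `true`) or
`back c` (for `false`). -/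
def sideAt (c : Fin 4) (b : Bool) : Fin 4 := if b then c else c - 1

/-- The direction in which side `sideAt c b` of tile `i` leaves corner `c`. -/
noncomputable def ray (i : Fin f) (c : Fin 4) (b : Bool) : E3 :=
  g i (if b then Q.dir c else Q.back c)

/-- The tiles `i` and `j` share side `k` of `i`, which is side `l` of `j`. -/
def Adj (i : Fin f) (k : Fin 4) (j : Fin f) (l : Fin 4) : Prop :=
  i ≠ j ∧ move (g i) '' Q.side k = move (g j) '' Q.side l

/-- The point lies on no great circle of a side of a tile. -/
def GenericPoint (x : E3) : Prop := ∀ i k, (inner ℝ (g i (Q.nrm k)) x : ℝ) ≠ 0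

variable {Q g}

theorem vert_injective (i : Fin f) : Function.Injective (vert Q g i) :=
  (move_injective _).comp Q.corner_injective

theorem vert_frame (i : Fin f) (k : Fin 4) :
    IsFrame (vert Q g i k : E3) (g i (Q.dir k)) (g i (Q.nrm k)) := (Q.frame k).map (g i)

theorem dense_genericPoint : Dense {x : S2 | GenericPoint Q g x} := by
  have := dense_forall_inner_ne_zero (fun ik : Fin f × Fin 4 => g ik.1 (Q.nrm ik.2))
    (fun ik => by simpa using (Q.frame ik.2).norm_w)
  simp only [Prod.forall] at this
  exact this

theorem GenericPoint.generic {x : S2} (h : GenericPoint Q g x) (i : Fin f) :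
    Q.Generic (move (g i).symm x) := fun k => by
  have := h i k
  rwa [inner_map_left] at this

theorem GenericPoint.mem_interior {x : S2} (h : GenericPoint Q g x) {i : Fin f}
    (hx : x ∈ move (g i) '' Q.region) : x ∈ interior (move (g i) '' Q.region) := by
  rw [interior_move_image, mem_move_image]
  rw [mem_move_image] at hx
  exact Q.mem_interior_of_notMem_side hx fun k hk => h.generic i k (Q.inner_nrm_of_mem_side hk)

variable (hT : IsEdgeToEdgeTiling Q g)
include hT

/-- A generic point of a tile is an interior point of it, so disjointness of interiors turns
covering into unique covering. -/
theorem existsUnique_tile {x : S2} (h : GenericPoint Q g x) :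
    ∃! i, x ∈ move (g i) '' Q.region := by
  have hx : x ∈ ⋃ i, move (g i) '' Q.region := by rw [hT.covers]; trivial
  obtain ⟨i, hi⟩ := mem_iUnion.1 hx
  refine ⟨i, hi, fun j hj => ?_⟩
  by_contra hne
  exact disjoint_left.1 (hT.disjoint_interiors j i hne) (h.mem_interior hj) (h.mem_interior hi)

-- Equality of two sides as point sets becomes combinatorial data: equal lengths, and the same or
-- the reversed parametrization.
omit hT in
theorem side_image_eq {i j : Fin f} {k l : Fin 4}
    (h : move (g i) '' Q.side k = move (g j) '' Q.side l) :
    Q.len k = Q.len l ∧ ((vert Q g j l = vert Q g i k ∧ g j (Q.dir l) = g i (Q.dir k)) ∨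
      (vert Q g j l = vert Q g i (k + 1) ∧ g j (Q.dir l) = g i (Q.back (k + 1)))) := by
  unfold SimpleQuadrilateral.side at h
  rw [move_image_geodesicArc, move_image_geodesicArc] at h
  obtain ⟨h1, h2⟩ := geodesicArc_eq ((Q.isUnitTangent_dir k).map (g i))
    ((Q.isUnitTangent_dir l).map (g j)) (Q.len_pos k) (Q.len_lt k) (Q.len_pos l) (Q.len_lt l) h
  refine ⟨h1, h2.imp id ?_⟩
  rintro ⟨e1, e2⟩
  constructor
  · apply Subtype.ext
    change ((move (g j) (Q.corner l) : S2) : E3) = g i (Q.corner (k + 1))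
    rw [e1, coe_move, ← map_geodesic, Q.corner_succ]
  · rw [e2, Q.back_succ, map_neg, coe_move, map_geodesicVelocity]

omit hT in
/-- A shared side leaves a common corner in a common direction. -/
theorem Adj.exists_ray {i j : Fin f} {c l : Fin 4} {b : Bool} (h : Adj Q g i (sideAt c b) j l) :
    ∃ c' b', l = sideAt c' b' ∧ vert Q g j c' = vert Q g i c ∧ ray Q g j c' b' = ray Q g i c b := by
  obtain ⟨-, h⟩ := h
  cases b
  · obtain ⟨-, h1⟩ := side_image_eq h
    obtain ⟨-, h2⟩ := side_image_eq h.symm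
    simp only [sideAt, Bool.false_eq_true, if_false, sub_add_cancel] at h1 h2
    rcases h1 with ⟨h1, h1'⟩ | ⟨h1, h1'⟩
    · refine ⟨l + 1, false, by simp [sideAt], ?_, ?_⟩
      · have := side_image_eq h.symm
        apply Subtype.ext
        change g j (Q.corner (l + 1)) = g i (Q.corner c)
        have e : Q.corner c = Q.corner (c - 1 + 1) := by rw [sub_add_cancel]
        have h0 := congrArg Subtype.val h1
        change g j (Q.corner l) = g i (Q.corner (c - 1)) at h0
        rw [e, Q.corner_succ, Q.corner_succ, map_geodesic, map_geodesic, h1', h0, this.1]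
        rfl
      · have := side_image_eq h.symm
        have h0 := congrArg Subtype.val h1
        change g j (Q.corner l) = g i (Q.corner (c - 1)) at h0
        simp only [ray, Bool.false_eq_true, if_false]
        have e : Q.back c = Q.back (c - 1 + 1) := by rw [sub_add_cancel]
        rw [e, Q.back_succ, Q.back_succ, map_neg, map_neg, map_geodesicVelocity,
          map_geodesicVelocity, h1', h0, this.1]
        rfl
    · exact ⟨l, true, by simp [sideAt], h1, by simpa [ray] using h1'⟩
  · obtain ⟨-, h1⟩ := side_image_eq h
    obtain ⟨-, h2⟩ := side_image_eq h.symm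
    simp only [sideAt, if_true] at h1 h2
    rcases h2 with ⟨h2, h2'⟩ | ⟨h2, h2'⟩
    · exact ⟨l, true, by simp [sideAt], h2.symm, by simpa [ray] using h2'.symm⟩
    · exact ⟨l + 1, false, by simp [sideAt], h2.symm, by simpa [ray] using h2'.symm⟩

omit hT in
theorem Adj.symm {i j : Fin f} {k l : Fin 4} (h : Adj Q g i k j l) : Adj Q g j l i k :=
  ⟨h.1.symm, h.2.symm⟩

omit hT in
theorem Adj.len_eq {i j : Fin f} {k l : Fin 4} (h : Adj Q g i k j l) : Q.len k = Q.len l :=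
  (side_image_eq h.2).1

/-- The midpoint of the side is a limit of points outside the tile, hence lies in one of the
finitely many other closed tiles. As it is no corner, the edge-to-edge condition yields a shared
side. -/
theorem exists_adj (i : Fin f) (k : Fin 4) : ∃ j l, Adj Q g i k j l := by
  have hl := Q.len_pos k
  set x := move (g i) (Q.pt k (Q.len k / 2)) with hx
  have ht : Q.len k / 2 ∈ Ioo 0 (Q.len k) := ⟨by linarith, by linarith⟩
  have hside : Q.pt k (Q.len k / 2) ∈ Q.side k := Q.pt_mem_side (Ioo_subset_Icc_self ht)
  have hfr : Q.pt k (Q.len k / 2) ∈ frontier Q.region := by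
    rw [Q.frontier_region]; exact mem_iUnion.2 ⟨k, hside⟩
  have hcl : x ∈ closure (move (g i) '' Q.region)ᶜ := by
    have h1 : Q.pt k (Q.len k / 2) ∈ closure Q.regionᶜ := by
      rw [closure_compl]; exact hfr.2
    have h2 := image_closure_subset_closure_image (moveHomeo (g i)).continuous
      (mem_image_of_mem _ h1)
    have h3 : (moveHomeo (g i)) '' Q.regionᶜ = (move (g i) '' Q.region)ᶜ :=
      image_compl_eq (moveHomeo (g i)).bijective
    rw [h3] at h2
    exact h2
  have hclosed : IsClosed (⋃ j ∈ {j : Fin f | j ≠ i}, move (g j) '' Q.region) :=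
    (toFinite _).isClosed_biUnion fun j _ =>
      (moveHomeo (g j)).isClosedMap _ Q.isClosed_region
  have hsub : (move (g i) '' Q.region)ᶜ ⊆ ⋃ j ∈ {j : Fin f | j ≠ i}, move (g j) '' Q.region := by
    intro y hy
    have : y ∈ ⋃ j, move (g j) '' Q.region := by rw [hT.covers]; trivial
    obtain ⟨j, hj⟩ := mem_iUnion.1 this
    simp only [mem_iUnion]
    refine ⟨j, ?_, hj⟩
    rintro rfl
    exact hy hj
  have hmem := hclosed.closure_subset_iff.2 hsub hcl
  simp only [mem_iUnion] at hmem
  obtain ⟨j, hj, hxj⟩ := hmem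
  have hxi : x ∈ move (g i) '' Q.region := mem_image_of_mem _ (Q.side_subset_region k hside)
  rcases hT.edge_to_edge i j (Ne.symm hj) x ⟨hxi, hxj⟩ with ⟨k', -, h1, -⟩ | ⟨k', l, h1, h2⟩
  · have h3 := move_injective _ h1
    have h4 : k' = k := Q.side_unique ht (h3 ▸ Q.corner_mem_side k')
    have h5 : k' - 1 = k := by
      refine Q.side_unique ht ?_
      have := Q.corner_succ_mem_side (k' - 1)
      rw [sub_add_cancel] at this
      rw [h3]; exact this
    rw [h4] at h5
    exact absurd h5 (by simp)
  · have h3 : Q.pt k (Q.len k / 2) ∈ Q.side k' := by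
      obtain ⟨y, hy, hyx⟩ := h2
      rwa [← move_injective _ hyx]
    have h4 : k' = k := Q.side_unique ht h3
    subst h4
    exact ⟨j, l, Ne.symm hj, h1⟩

/-- A vertex on a tile is a corner of this tile. -/
theorem exists_vert_eq {i j : Fin f} {k : Fin 4} (h : vert Q g i k ∈ move (g j) '' Q.region) :
    ∃ l, vert Q g j l = vert Q g i k := by
  by_cases hij : i = j
  · subst hij; exact ⟨k, rfl⟩
  have hi : vert Q g i k ∈ move (g i) '' Q.region :=
    mem_image_of_mem _ (Q.side_subset_region k (Q.corner_mem_side k))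
  rcases hT.edge_to_edge i j hij _ ⟨hi, h⟩ with ⟨k', l, -, h2⟩ | ⟨k', l, h1, h2⟩
  · exact ⟨l, h2.symm⟩
  · have h3 : Q.corner k ∈ Q.side k' := by
      obtain ⟨y, hy, hyx⟩ := h2
      rwa [← move_injective _ hyx]
    rw [SimpleQuadrilateral.corner_mem_side_iff] at h3
    have hadj : Adj Q g i k' j l := ⟨hij, h1⟩
    have : ∃ b, k' = sideAt k b := by
      rcases h3 with rfl | rfl
      · exact ⟨true, by simp [sideAt]⟩
      · exact ⟨false, by simp [sideAt]⟩
    obtain ⟨b, rfl⟩ := this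
    obtain ⟨c', -, -, h5, -⟩ := hadj.exists_ray
    exact ⟨c', h5⟩

end Tiling

/-! ### Polar charts at a vertex and the cycle of its corners -/

section Tiling
variable {Q : QuadTile} {f : ℕ} {g : Fin f → E3 ≃ₗᵢ[ℝ] E3}

/-- The direction `d` at a vertex is not along a great circle of a side through the vertex. -/
def GenericDirection (Q : QuadTile) (g : Fin f → E3 ≃ₗᵢ[ℝ] E3) (v d : E3) : Prop :=
  ∀ i k, (inner ℝ (g i (Q.nrm k)) v : ℝ) = 0 → (inner ℝ (g i (Q.nrm k)) d : ℝ) ≠ 0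

/-- A direction at a vertex points into the sector of corner `k` of tile `i`. -/
def PointsInto (Q : QuadTile) (g : Fin f → E3 ≃ₗᵢ[ℝ] E3) (d : E3) (ik : Fin f × Fin 4) : Prop :=
  InSector (Q.angle ik.2) (inner ℝ (g ik.1 (Q.dir ik.2)) d) (inner ℝ (g ik.1 (Q.nrm ik.2)) d)

theorem tendsto_geoPt {v : S2} {d : E3} (hd : IsUnitTangent v d) :
    Tendsto (geoPt v d hd) (𝓝[>] 0) (𝓝 v) := by
  have hc : Continuous (geoPt v d hd) := by
    unfold geoPt geodesic
    apply Continuous.subtype_mk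
    fun_prop
  have h0 : geoPt v d hd 0 = v := Subtype.ext (geodesic_zero _ _)
  have := hc.tendsto 0
  rw [h0] at this
  exact this.mono_left nhdsWithin_le_nhds

/-- A generic direction at a vertex points into the sector of exactly one corner. -/
theorem existsUnique_pointsInto (hT : IsEdgeToEdgeTiling Q g) {i₀ : Fin f} {k₀ : Fin 4} {d : E3}
    (hd : IsUnitTangent (vert Q g i₀ k₀) d) (hgen : GenericDirection Q g (vert Q g i₀ k₀) d) :
    ∃! ik : Fin f × Fin 4, vert Q g ik.1 ik.2 = vert Q g i₀ k₀ ∧ PointsInto Q g d ik := by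
  set v := vert Q g i₀ k₀ with hv
  have hlim := tendsto_geoPt hd
  have hsmall : ∀ᶠ s in 𝓝[>] (0 : ℝ), s ∈ Ioo (0 : ℝ) 1 := Ioo_mem_nhdsGT one_pos
  obtain ⟨w, hw⟩ := hd.exists_frame
  have h1 : ∀ᶠ s in 𝓝[>] (0 : ℝ), GenericPoint Q g (geoPt v d hd s) := by
    refine eventually_all.2 fun i => eventually_all.2 fun k => ?_
    by_cases h : (inner ℝ (g i (Q.nrm k)) (v : E3) : ℝ) = 0
    · filter_upwards [hsmall] with s hs
      have : (inner ℝ (g i (Q.nrm k)) (geoPt v d hd s : E3) : ℝ) =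
          sin s * inner ℝ (g i (Q.nrm k)) d := by
        simp [geoPt, geodesic, inner_add_right, real_inner_smul_right, h]
      rw [this]
      exact mul_ne_zero (sin_pos_of_pos_of_le_one hs.1 hs.2.le).ne' (hgen i k h)
    · have hc : Continuous fun x : S2 => (inner ℝ (g i (Q.nrm k)) (x : E3) : ℝ) := by fun_prop
      exact ((hc.tendsto v).comp hlim).eventually_ne h
  have h2 : ∀ᶠ s in 𝓝[>] (0 : ℝ), ∀ i, v ∉ move (g i) '' Q.region →
      geoPt v d hd s ∉ move (g i) '' Q.region := by
    refine eventually_all.2 fun i => ?_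
    by_cases h : v ∈ move (g i) '' Q.region
    · exact Eventually.of_forall fun s h' => absurd h h'
    · have hcl : IsClosed (move (g i) '' Q.region) :=
        (moveHomeo (g i)).isClosedMap _ Q.isClosed_region
      filter_upwards [hlim.eventually (hcl.isOpen_compl.mem_nhds h)] with s hs _ using hs
  have h3 : ∀ᶠ s in 𝓝[>] (0 : ℝ), ∀ ik : Fin f × Fin 4, vert Q g ik.1 ik.2 = v →
      (geoPt v d hd s ∈ move (g ik.1) '' Q.region ↔ PointsInto Q g d ik) := by
    refine eventually_all.2 fun ik => ?_
    obtain ⟨i, k⟩ := ik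
    by_cases h : vert Q g i k = v
    swap
    · exact Eventually.of_forall fun s h' => absurd h' h
    obtain ⟨κ, hκ, hR⟩ := Q.mem_region_iff_inSector k
    have hf := vert_frame (Q := Q) (g := g) i k
    rw [h] at hf
    have hcos : ∀ᶠ s in 𝓝[>] (0 : ℝ), κ < cos s :=
      nhdsWithin_le_nhds (continuous_cos.continuousAt.tendsto.eventually_const_lt (by simpa using hκ))
    filter_upwards [hsmall, hcos] with s hs hs' _
    have hsin := sin_pos_of_pos_of_le_one hs.1 hs.2.le
    have hin : ∀ n : E3, (inner ℝ n ((move (g i).symm (geoPt v d hd s) : S2) : E3) : ℝ) =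
        cos s * inner ℝ (g i n) (v : E3) + sin s * inner ℝ (g i n) d := by
      intro n
      rw [coe_move, ← inner_map_left]
      simp [geoPt, geodesic, inner_add_right, real_inner_smul_right]
    have hcv : g i (Q.corner k) = (v : E3) := congrArg Subtype.val h
    have hcin : (inner ℝ (Q.corner k : E3) ((move (g i).symm (geoPt v d hd s) : S2) : E3) : ℝ) =
        cos s := by rw [hin, hcv, hd.2, hw.inner_self_p]; ring
    rw [mem_move_image, hR _ (by rw [hcin]; exact hs'), PointsInto, hin, hin, hf.up, hf.wp]
    · simp only [mul_zero, zero_add]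
      exact inSector_mul hsin
    · intro he
      rw [he, (Q.frame k).inner_self_p] at hcin
      nlinarith [cos_sq_add_sin_sq s]
  -- A point a short way along d is generic, avoids the tiles that miss v, and lies in a tile at v
  -- exactly when d points into the corner there. The unique tile containing it gives the unique
  -- corner.
  obtain ⟨s, a1, a2, a3⟩ := (h1.and (h2.and h3)).exists
  obtain ⟨i, hi, hu⟩ := existsUnique_tile hT a1
  have hvi : v ∈ move (g i) '' Q.region := by by_contra h; exact a2 i h hi
  obtain ⟨k, hk⟩ := exists_vert_eq hT hvi
  refine ⟨(i, k), ⟨hk, (a3 (i, k) hk).1 hi⟩, ?_⟩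
  rintro ⟨j, l⟩ ⟨hjl, hp⟩
  have hj := hu j ((a3 (j, l) hjl).2 hp)
  subst hj
  have hl : l = k := vert_injective j (hjl.trans hk.symm)
  rw [hl]

/-- The direction at polar angle `t` in the frame `e₁, e₂`. -/
noncomputable def dirAt (e₁ e₂ : E3) (t : ℝ) : E3 := cos t • e₁ + sin t • e₂

theorem IsFrame.frame_dirAt {p e₁ e₂ : E3} (h : IsFrame p e₁ e₂) (t : ℝ) :
    IsFrame p (dirAt e₁ e₂ t) (-sin t • e₁ + cos t • e₂) := h.rotate t

theorem inner_dirAt {p e₁ e₂ : E3} (h : IsFrame p e₁ e₂) (s t : ℝ) :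
    inner ℝ (dirAt e₁ e₂ s) (dirAt e₁ e₂ t) = cos (t - s) := by
  simp only [dirAt, inner_add_left, inner_add_right, real_inner_smul_left, real_inner_smul_right,
    h.uw, h.wu, h.inner_self_u, h.inner_self_w, cos_sub]
  ring

theorem IsFrame.exists_dirAt {p e₁ e₂ n : E3} (h : IsFrame p e₁ e₂) (hn : ‖n‖ = 1)
    (hp : inner ℝ p n = (0 : ℝ)) : ∃ t, n = dirAt e₁ e₂ t := by
  have h1 := h.sq_sum hn
  have h2 := h.expand n
  obtain ⟨ρ, hρ, φ, -, hA, hB⟩ := exists_polar (inner ℝ e₁ n) (inner ℝ e₂ n)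
  rw [hp, hA, hB] at h1 h2
  have hρ2 : ρ ^ 2 = 1 := by linear_combination h1 - ρ ^ 2 * cos_sq_add_sin_sq φ
  have hρ1 : ρ = 1 := by nlinarith
  refine ⟨φ, ?_⟩
  rw [h2, hρ1, dirAt]
  simp

theorem inSector_cos_sin {θ x : ℝ} :
    InSector θ (cos x) (sin x) ↔ ∃ m : ℤ, x - 2 * π * m ∈ Icc 0 θ := by
  constructor
  · rintro ⟨ρ, hρ, φ, hφ, h1, h2⟩
    have hρ2 : ρ ^ 2 = 1 := by
      have := cos_sq_add_sin_sq x
      rw [h1, h2] at this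
      linear_combination this - ρ ^ 2 * cos_sq_add_sin_sq φ
    have hρ1 : ρ = 1 := by nlinarith
    subst hρ1
    rw [one_mul] at h1 h2
    obtain ⟨m, hm⟩ := exists_eq_add_two_pi h1 h2
    exact ⟨m, by rw [hm, add_sub_cancel_right]; exact hφ⟩
  · rintro ⟨m, hm⟩
    refine ⟨1, one_pos, _, hm, ?_, ?_⟩
    · rw [one_mul, mul_comm (2 * π), cos_sub_int_mul_two_pi]
    · rw [one_mul, mul_comm (2 * π), sin_sub_int_mul_two_pi]

/-- A corner sector in polar coordinates around its vertex, with the angle at which it starts and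
which of the two sides is the start. -/
theorem exists_sector_interval {p e₁ e₂ u w : E3} (h : IsFrame p e₁ e₂) (hu : IsFrame p u w) (θ : ℝ) :
    ∃ a : ℝ, ((u = dirAt e₁ e₂ a ∧ cos θ • u + sin θ • w = dirAt e₁ e₂ (a + θ)) ∨
        (cos θ • u + sin θ • w = dirAt e₁ e₂ a ∧ u = dirAt e₁ e₂ (a + θ))) ∧
      ∀ ψ, InSector θ (inner ℝ u (dirAt e₁ e₂ ψ)) (inner ℝ w (dirAt e₁ e₂ ψ)) ↔
        ∃ m : ℤ, ψ - a - 2 * π * m ∈ Icc 0 θ := by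
  obtain ⟨b, hb⟩ := h.exists_dirAt hu.norm_u hu.pu
  have hr := h.frame_dirAt b
  rw [← hb] at hr
  have hsh : -sin b • e₁ + cos b • e₂ = dirAt e₁ e₂ (b + π / 2) := by
    simp [dirAt, cos_add_pi_div_two, sin_add_pi_div_two]
  rw [hsh] at hr
  have e1 : ∀ ψ, inner ℝ u (dirAt e₁ e₂ ψ) = cos (ψ - b) := by
    intro ψ; rw [hb, inner_dirAt h]
  have e2 : ∀ ψ, inner ℝ (dirAt e₁ e₂ (b + π / 2)) (dirAt e₁ e₂ ψ) = sin (ψ - b) := by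
    intro ψ; rw [inner_dirAt h, ← sub_sub, cos_sub_pi_div_two]
  rcases hr.eq_or_eq_neg hu.norm_w hu.pw hu.uw with hw | hw
  · refine ⟨b, Or.inl ⟨hb, ?_⟩, fun ψ => ?_⟩
    · rw [hw, hb]
      simp only [dirAt, cos_add, sin_add, cos_pi_div_two, sin_pi_div_two]
      module
    · rw [hw, e1, e2, inSector_cos_sin]
  · refine ⟨b - θ, Or.inr ⟨?_, by rw [sub_add_cancel]; exact hb⟩, fun ψ => ?_⟩
    · rw [hw, hb]
      simp only [dirAt, cos_add, sin_add, cos_pi_div_two, sin_pi_div_two, cos_sub, sin_sub]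
      module
    · rw [hw, inner_neg_left, e1, e2, ← cos_neg, ← sin_neg, inSector_cos_sin]
      constructor
      · rintro ⟨m, hm⟩
        refine ⟨-m, ?_, ?_⟩ <;> push_cast <;> linarith [hm.1, hm.2]
      · rintro ⟨m, hm⟩
        refine ⟨-m, ?_, ?_⟩ <;> push_cast <;> linarith [hm.1, hm.2]

open Classical in
/-- The indicator function of the angles in a sector. -/
noncomputable def sectorInd (a θ : ℝ) (ψ : ℝ) : ℝ :=
  if ∃ m : ℤ, ψ - a - 2 * π * m ∈ Icc 0 θ then 1 else 0

theorem sectorInd_periodic (a θ : ℝ) : Function.Periodic (sectorInd a θ) (2 * π) := by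
  intro ψ
  unfold sectorInd
  congr 1
  rw [eq_iff_iff]
  constructor
  · rintro ⟨m, hm⟩
    exact ⟨m - 1, by push_cast; convert hm using 1; ring⟩
  · rintro ⟨m, hm⟩
    exact ⟨m + 1, by push_cast; convert hm using 1; ring⟩

/-- On the period starting at a the indicator is 1 on (a, a + θ) and 0 on the rest. Periodicity
moves the integral to [0, 2π]. -/
theorem integral_sectorInd {a θ : ℝ} (h0 : 0 < θ) (hθ : θ < 2 * π) :
    IntervalIntegrable (sectorInd a θ) MeasureTheory.volume 0 (2 * π) ∧
      ∫ ψ in (0 : ℝ)..2 * π, sectorInd a θ ψ = θ := by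
  have hpi := pi_pos
  have e1 : EqOn (fun _ => (1 : ℝ)) (sectorInd a θ) (Ioo a (a + θ)) := by
    intro ψ hψ
    simp only [sectorInd]
    rw [if_pos ⟨0, by constructor <;> push_cast <;> linarith [hψ.1, hψ.2]⟩]
  have e2 : EqOn (fun _ => (0 : ℝ)) (sectorInd a θ) (Ioo (a + θ) (a + 2 * π)) := by
    intro ψ hψ
    simp only [sectorInd]
    rw [if_neg]
    rintro ⟨m, hm⟩
    have h1 : (m : ℝ) < 1 := by
      by_contra hh; push Not at hh
      nlinarith [hm.1, hψ.2]
    have h2 : (0 : ℝ) < m := by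
      by_contra hh; push Not at hh
      nlinarith [hm.2, hψ.1]
    have h1' : m < 1 := by exact_mod_cast h1
    have h2' : 0 < m := by exact_mod_cast h2
    omega
  have i1 : IntervalIntegrable (sectorInd a θ) MeasureTheory.volume a (a + θ) :=
    (intervalIntegrable_const (c := (1 : ℝ))).congr_uIoo (by rwa [uIoo_of_le (by linarith)])
  have i2 : IntervalIntegrable (sectorInd a θ) MeasureTheory.volume (a + θ) (a + 2 * π) :=
    (intervalIntegrable_const (c := (0 : ℝ))).congr_uIoo (by rwa [uIoo_of_le (by linarith)])
  have hp := sectorInd_periodic a θ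
  constructor
  · exact hp.intervalIntegrable two_pi_pos.ne' (t := a) (i1.trans i2) _ _
  · have := hp.intervalIntegral_add_eq 0 a
    rw [zero_add] at this
    have j1 := intervalIntegral.integral_congr_Ioo_of_le (μ := MeasureTheory.volume) (by linarith) e1
    have j2 := intervalIntegral.integral_congr_Ioo_of_le (μ := MeasureTheory.volume) (by linarith) e2
    rw [this, ← intervalIntegral.integral_add_adjacent_intervals i1 i2, ← j1, ← j2]
    simp

end Tiling

theorem dirAt_eq_iff {p e₁ e₂ : E3} (h : IsFrame p e₁ e₂) {s t : ℝ} :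
    dirAt e₁ e₂ s = dirAt e₁ e₂ t ↔ (s : Real.Angle) = t := by
  constructor
  · intro he
    apply Real.Angle.cos_sin_inj
    · have := congrArg (fun x => (inner ℝ e₁ x : ℝ)) he
      simpa only [dirAt, inner_add_right, real_inner_smul_right, h.uw, h.inner_self_u, mul_zero,
        add_zero, mul_one] using this
    · have := congrArg (fun x => (inner ℝ e₂ x : ℝ)) he
      simpa only [dirAt, inner_add_right, real_inner_smul_right, h.wu, h.inner_self_w, mul_zero,
        zero_add, mul_one] using this
  · intro he
    have hc : cos s = cos t := by
      have := congrArg Real.Angle.cos he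
      simpa using this
    have hs : sin s = sin t := by
      have := congrArg Real.Angle.sin he
      simpa using this
    rw [dirAt, dirAt, hc, hs]

section Tiling
variable {Q : QuadTile} {f : ℕ} {g : Fin f → E3 ≃ₗᵢ[ℝ] E3}

/-- Each of the finitely many great circles through the vertex excludes only the zeros of a shifted
cosine. -/
theorem countable_not_genericDirection {v e₁ e₂ : E3} (h : IsFrame v e₁ e₂) :
    {ψ : ℝ | ¬GenericDirection Q g v (dirAt e₁ e₂ ψ)}.Countable := by
  have hcos : {x : ℝ | cos x = 0}.Countable := by
    refine (countable_range fun n : ℤ => (2 * (n : ℝ) + 1) * π / 2).mono ?_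
    intro x hx
    obtain ⟨n, hn⟩ := cos_eq_zero_iff.1 hx
    exact ⟨n, hn.symm⟩
  have hsub : {ψ : ℝ | ¬GenericDirection Q g v (dirAt e₁ e₂ ψ)} ⊆ ⋃ ik : Fin f × Fin 4,
      {ψ : ℝ | (inner ℝ (g ik.1 (Q.nrm ik.2)) v : ℝ) = 0 ∧
        (inner ℝ (g ik.1 (Q.nrm ik.2)) (dirAt e₁ e₂ ψ) : ℝ) = 0} := by
    intro ψ hψ
    simp only [GenericDirection, mem_ofPred_eq, not_forall, ne_eq, not_not] at hψ
    obtain ⟨i, k, h1, h2⟩ := hψ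
    exact mem_iUnion.2 ⟨(i, k), h1, h2⟩
  refine (countable_iUnion fun ik => ?_).mono hsub
  by_cases h0 : (inner ℝ (g ik.1 (Q.nrm ik.2)) v : ℝ) = 0
  · obtain ⟨t, ht⟩ := h.exists_dirAt (n := g ik.1 (Q.nrm ik.2))
      (by simpa using (Q.frame ik.2).norm_w) (by rw [real_inner_comm]; exact h0)
    refine (hcos.preimage (f := fun ψ => ψ - t) (fun a b hab => by simpa using hab)).mono ?_
    rintro ψ ⟨-, h2⟩
    rw [ht, inner_dirAt h] at h2
    exact h2
  · convert countable_empty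
    ext ψ
    simp [h0]

open Classical in
/-- The corners at a point. -/
noncomputable def cornersAt (Q : QuadTile) (g : Fin f → E3 ≃ₗᵢ[ℝ] E3) (v : S2) :
    Finset (Fin f × Fin 4) := Finset.univ.filter fun ik => vert Q g ik.1 ik.2 = v

theorem mem_cornersAt {v : S2} {ik : Fin f × Fin 4} :
    ik ∈ cornersAt Q g v ↔ vert Q g ik.1 ik.2 = v := by simp [cornersAt]

/-- Polar coordinates around a vertex: every corner is an interval of angles, which starts at
`a` with the side marked by `st`. -/
structure IsVertexChart (Q : QuadTile) (g : Fin f → E3 ≃ₗᵢ[ℝ] E3) (v : S2) (e₁ e₂ : E3)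
    (a : Fin f × Fin 4 → ℝ) (st : Fin f × Fin 4 → Bool) : Prop where
  frame : IsFrame (v : E3) e₁ e₂
  start : ∀ ik ∈ cornersAt Q g v, ray Q g ik.1 ik.2 (st ik) = dirAt e₁ e₂ (a ik)
  final : ∀ ik ∈ cornersAt Q g v,
    ray Q g ik.1 ik.2 (!(st ik)) = dirAt e₁ e₂ (a ik + Q.angle ik.2)
  pointsInto : ∀ ik ∈ cornersAt Q g v, ∀ ψ, PointsInto Q g (dirAt e₁ e₂ ψ) ik ↔
    ∃ m : ℤ, ψ - a ik - 2 * π * m ∈ Icc 0 (Q.angle ik.2)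

theorem exists_isVertexChart (v : S2) : ∃ e₁ e₂ a st, IsVertexChart Q g v e₁ e₂ a st := by
  obtain ⟨e₁, e₂, h⟩ := exists_isFrame (v : E3) (by simp)
  have key : ∀ ik : Fin f × Fin 4, ∃ (a : ℝ) (st : Bool), ik ∈ cornersAt Q g v →
      ray Q g ik.1 ik.2 st = dirAt e₁ e₂ a ∧
      ray Q g ik.1 ik.2 (!st) = dirAt e₁ e₂ (a + Q.angle ik.2) ∧
      ∀ ψ, PointsInto Q g (dirAt e₁ e₂ ψ) ik ↔
        ∃ m : ℤ, ψ - a - 2 * π * m ∈ Icc 0 (Q.angle ik.2) := by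
    intro ik
    by_cases hik : ik ∈ cornersAt Q g v
    · have hf := vert_frame (Q := Q) (g := g) ik.1 ik.2
      rw [mem_cornersAt.1 hik] at hf
      have hb : g ik.1 (Q.back ik.2) = cos (Q.angle ik.2) • g ik.1 (Q.dir ik.2) +
          sin (Q.angle ik.2) • g ik.1 (Q.nrm ik.2) := by simp [QuadTile.back]
      obtain ⟨a, hab, hψ⟩ := exists_sector_interval h hf (Q.angle ik.2)
      rw [← hb] at hab
      rcases hab with ⟨h1, h2⟩ | ⟨h1, h2⟩
      · exact ⟨a, true, fun _ => ⟨by simpa [ray] using h1, by simpa [ray] using h2, hψ⟩⟩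
      · exact ⟨a, false, fun _ => ⟨by simpa [ray] using h1, by simpa [ray] using h2, hψ⟩⟩
    · exact ⟨0, true, fun h => absurd h hik⟩
  choose a st hst using key
  exact ⟨e₁, e₂, a, st, h, fun ik hik => (hst ik hik).1, fun ik hik => (hst ik hik).2.1,
    fun ik hik => (hst ik hik).2.2⟩

namespace IsVertexChart
variable {e₁ e₂ : E3} {a : Fin f × Fin 4 → ℝ} {st : Fin f × Fin 4 → Bool} {i₀ : Fin f} {k₀ : Fin 4}

theorem existsUnique (hT : IsEdgeToEdgeTiling Q g)
    (h : IsVertexChart Q g (vert Q g i₀ k₀) e₁ e₂ a st) {ψ : ℝ}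
    (hψ : GenericDirection Q g (vert Q g i₀ k₀) (dirAt e₁ e₂ ψ)) :
    ∃! ik, ik ∈ cornersAt Q g (vert Q g i₀ k₀) ∧
      ∃ m : ℤ, ψ - a ik - 2 * π * m ∈ Icc 0 (Q.angle ik.2) := by
  obtain ⟨ik, ⟨h1, h2⟩, h3⟩ := existsUnique_pointsInto hT (h.frame.frame_dirAt ψ).isUnitTangent hψ
  refine ⟨ik, ⟨mem_cornersAt.2 h1, (h.pointsInto ik (mem_cornersAt.2 h1) ψ).1 h2⟩, ?_⟩
  rintro jl ⟨h4, h5⟩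
  exact h3 jl ⟨mem_cornersAt.1 h4, (h.pointsInto jl h4 ψ).2 h5⟩

/-- The indicators of the corner sectors add up to 1 at all but countably many angles. Integration
over a full turn gives the angle sum. -/
theorem sum_angle (hT : IsEdgeToEdgeTiling Q g)
    (h : IsVertexChart Q g (vert Q g i₀ k₀) e₁ e₂ a st) :
    ∑ ik ∈ cornersAt Q g (vert Q g i₀ k₀), Q.angle ik.2 = 2 * π := by
  have hI := fun ik : Fin f × Fin 4 =>
    integral_sectorInd (a := a ik) (Q.angle_pos ik.2) (Q.angle_lt ik.2)
  have e1 : ∑ ik ∈ cornersAt Q g (vert Q g i₀ k₀), Q.angle ik.2 =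
      ∫ ψ in (0 : ℝ)..2 * π, ∑ ik ∈ cornersAt Q g (vert Q g i₀ k₀),
        sectorInd (a ik) (Q.angle ik.2) ψ := by
    rw [intervalIntegral.integral_finsetSum fun ik _ => (hI ik).1]
    exact Finset.sum_congr rfl fun ik _ => (hI ik).2.symm
  have e2 : ∫ ψ in (0 : ℝ)..2 * π, ∑ ik ∈ cornersAt Q g (vert Q g i₀ k₀),
        sectorInd (a ik) (Q.angle ik.2) ψ = ∫ ψ in (0 : ℝ)..2 * π, (1 : ℝ) := by
    apply intervalIntegral.integral_congr_ae
    have hae := (countable_not_genericDirection (Q := Q) (g := g) h.frame).ae_notMem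
      MeasureTheory.volume
    filter_upwards [hae] with ψ hψ _
    obtain ⟨ik, ⟨h1, h2⟩, h3⟩ := h.existsUnique hT (not_not.1 hψ)
    rw [Finset.sum_eq_single_of_mem ik h1, sectorInd, if_pos h2]
    intro jl hjl hne
    rw [sectorInd, if_neg]
    exact fun hm => hne (h3 jl ⟨hjl, hm⟩)
  rw [e1, e2]
  simp

theorem exists_generic_between (h : IsVertexChart Q g (vert Q g i₀ k₀) e₁ e₂ a st) {s t : ℝ}
    (hst : s < t) :
    ∃ ψ ∈ Ioo s t, GenericDirection Q g (vert Q g i₀ k₀) (dirAt e₁ e₂ ψ) := by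
  have hd := (countable_not_genericDirection (Q := Q) (g := g) h.frame).dense_compl ℝ
  obtain ⟨ψ, h1, h2⟩ := hd.inter_open_nonempty _ isOpen_Ioo (nonempty_Ioo.2 hst)
  exact ⟨ψ, h1, not_not.1 h2⟩

/-- Two sectors with a common start overlap in an interval, which contains a generic direction, and
such a direction lies in one sector only. -/
theorem start_inj (hT : IsEdgeToEdgeTiling Q g)
    (h : IsVertexChart Q g (vert Q g i₀ k₀) e₁ e₂ a st) {ik jl : Fin f × Fin 4}
    (hik : ik ∈ cornersAt Q g (vert Q g i₀ k₀)) (hjl : jl ∈ cornersAt Q g (vert Q g i₀ k₀))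
    (he : (a ik : Real.Angle) = a jl) : ik = jl := by
  rw [Real.Angle.angle_eq_iff_two_pi_dvd_sub] at he
  obtain ⟨m, hm⟩ := he
  obtain ⟨ψ, hψ, hgen⟩ := h.exists_generic_between (s := a ik)
    (t := a ik + min (Q.angle ik.2) (Q.angle jl.2))
    (by linarith [lt_min (Q.angle_pos ik.2) (Q.angle_pos jl.2)])
  have h1 := min_le_left (Q.angle ik.2) (Q.angle jl.2)
  have h2 := min_le_right (Q.angle ik.2) (Q.angle jl.2)
  refine (h.existsUnique hT hgen).unique ⟨hik, 0, ?_⟩ ⟨hjl, m, ?_⟩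
  · constructor <;> push_cast <;> linarith [hψ.1, hψ.2]
  · constructor <;> linarith [hψ.1, hψ.2]

theorem final_inj (hT : IsEdgeToEdgeTiling Q g)
    (h : IsVertexChart Q g (vert Q g i₀ k₀) e₁ e₂ a st) {ik jl : Fin f × Fin 4}
    (hik : ik ∈ cornersAt Q g (vert Q g i₀ k₀)) (hjl : jl ∈ cornersAt Q g (vert Q g i₀ k₀))
    (he : ((a ik + Q.angle ik.2 : ℝ) : Real.Angle) = (a jl + Q.angle jl.2 : ℝ)) : ik = jl := by
  rw [Real.Angle.angle_eq_iff_two_pi_dvd_sub] at he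
  obtain ⟨m, hm⟩ := he
  obtain ⟨ψ, hψ, hgen⟩ := h.exists_generic_between
    (s := a ik + Q.angle ik.2 - min (Q.angle ik.2) (Q.angle jl.2)) (t := a ik + Q.angle ik.2)
    (by linarith [lt_min (Q.angle_pos ik.2) (Q.angle_pos jl.2)])
  have h1 := min_le_left (Q.angle ik.2) (Q.angle jl.2)
  have h2 := min_le_right (Q.angle ik.2) (Q.angle jl.2)
  refine (h.existsUnique hT hgen).unique ⟨hik, 0, ?_⟩ ⟨hjl, m, ?_⟩
  · constructor <;> push_cast <;> linarith [hψ.1, hψ.2]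
  · constructor <;> linarith [hψ.1, hψ.2]

theorem start_ne_final (h : IsVertexChart Q g (vert Q g i₀ k₀) e₁ e₂ a st) (ik : Fin f × Fin 4) :
    dirAt e₁ e₂ (a ik) ≠ dirAt e₁ e₂ (a ik + Q.angle ik.2) := by
  intro he
  rw [dirAt_eq_iff h.frame, Real.Angle.angle_eq_iff_two_pi_dvd_sub] at he
  obtain ⟨m, hm⟩ := he
  have := int_bound_zero (n := m) (a := a ik) (b := a ik + Q.angle ik.2) (by linarith)
    (by linarith [Q.angle_lt ik.2]) (by linarith [Q.angle_pos ik.2, two_pi_pos])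
  subst this
  push_cast at hm
  linarith [Q.angle_pos ik.2]

/-- Among the corners at a vertex, a given side direction starts at most one and stops at most
one. -/
theorem ray_cases (h : IsVertexChart Q g (vert Q g i₀ k₀) e₁ e₂ a st) {ik : Fin f × Fin 4}
    (hik : ik ∈ cornersAt Q g (vert Q g i₀ k₀)) (b : Bool) :
    (b = st ik ∧ ray Q g ik.1 ik.2 b = dirAt e₁ e₂ (a ik)) ∨
      (b = !(st ik) ∧ ray Q g ik.1 ik.2 b = dirAt e₁ e₂ (a ik + Q.angle ik.2)) := by
  have h1 := h.start ik hik
  have h2 := h.final ik hik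
  by_cases hb : b = st ik
  · left; exact ⟨hb, hb ▸ h1⟩
  · right
    have : b = !(st ik) := by revert hb; cases b <;> cases st ik <;> simp
    exact ⟨this, this ▸ h2⟩

end IsVertexChart

theorem sum_angle_cornersAt (hT : IsEdgeToEdgeTiling Q g) (i : Fin f) (k : Fin 4) :
    ∑ jl ∈ cornersAt Q g (vert Q g i k), Q.angle jl.2 = 2 * π := by
  obtain ⟨e₁, e₂, a, st, h⟩ := exists_isVertexChart (Q := Q) (g := g) (vert Q g i k)
  exact h.sum_angle hT

/-- At most two tiles share a side direction at a vertex. -/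
theorem eq_of_ray_eq (hT : IsEdgeToEdgeTiling Q g) {i j j' : Fin f} {c c' c'' : Fin 4}
    {b b' b'' : Bool} (hv : vert Q g j c' = vert Q g i c) (hv' : vert Q g j' c'' = vert Q g i c)
    (hr : ray Q g j c' b' = ray Q g i c b) (hr' : ray Q g j' c'' b'' = ray Q g i c b)
    (hij : i ≠ j) (hij' : i ≠ j') : j = j' ∧ c' = c'' ∧ b' = b'' := by
  obtain ⟨e₁, e₂, a, st, h⟩ := exists_isVertexChart (Q := Q) (g := g) (vert Q g i c)
  have m1 : (i, c) ∈ cornersAt Q g (vert Q g i c) := mem_cornersAt.2 rfl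
  have m2 : (j, c') ∈ cornersAt Q g (vert Q g i c) := mem_cornersAt.2 hv
  have m3 : (j', c'') ∈ cornersAt Q g (vert Q g i c) := mem_cornersAt.2 hv'
  have hS : ∀ x y : Fin f × Fin 4, x ∈ cornersAt Q g (vert Q g i c) →
      y ∈ cornersAt Q g (vert Q g i c) → dirAt e₁ e₂ (a x) = dirAt e₁ e₂ (a y) → x = y :=
    fun x y hx hy he => h.start_inj hT hx hy ((dirAt_eq_iff h.frame).1 he)
  have hE : ∀ x y : Fin f × Fin 4, x ∈ cornersAt Q g (vert Q g i c) →
      y ∈ cornersAt Q g (vert Q g i c) →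
      dirAt e₁ e₂ (a x + Q.angle x.2) = dirAt e₁ e₂ (a y + Q.angle y.2) → x = y :=
    fun x y hx hy he => h.final_inj hT hx hy ((dirAt_eq_iff h.frame).1 he)
  have key : ((j, c') : Fin f × Fin 4) = (j', c'') := by
    rcases h.ray_cases m1 b with ⟨-, r1⟩ | ⟨-, r1⟩ <;>
    rcases h.ray_cases m2 b' with ⟨-, r2⟩ | ⟨-, r2⟩ <;>
    rcases h.ray_cases m3 b'' with ⟨-, r3⟩ | ⟨-, r3⟩
    · exact hS _ _ m2 m3 (by rw [← r2, ← r3, hr, hr'])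
    · exact absurd (congrArg Prod.fst (hS _ _ m1 m2 (by rw [← r1, ← r2, hr]))) hij
    · exact absurd (congrArg Prod.fst (hS _ _ m1 m3 (by rw [← r1, ← r3, hr']))) hij'
    · exact hE _ _ m2 m3 (by rw [← r2, ← r3, hr, hr'])
    · exact hS _ _ m2 m3 (by rw [← r2, ← r3, hr, hr'])
    · exact absurd (congrArg Prod.fst (hE _ _ m1 m3 (by rw [← r1, ← r3, hr']))) hij'
    · exact absurd (congrArg Prod.fst (hE _ _ m1 m2 (by rw [← r1, ← r2, hr]))) hij
    · exact hE _ _ m2 m3 (by rw [← r2, ← r3, hr, hr'])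
  obtain ⟨rfl, rfl⟩ := Prod.mk.inj key
  refine ⟨rfl, rfl, ?_⟩
  have hne := h.start_ne_final (j, c')
  rcases h.ray_cases m2 b' with ⟨r2, s2⟩ | ⟨r2, s2⟩ <;>
    rcases h.ray_cases m2 b'' with ⟨r3, s3⟩ | ⟨r3, s3⟩
  · rw [r2, r3]
  · exact absurd (by rw [← s2, ← s3, hr, hr']) hne
  · exact absurd (by rw [← s2, ← s3, hr, hr']) hne.symm
  · rw [r2, r3]

theorem Adj.unique (hT : IsEdgeToEdgeTiling Q g) {i j j' : Fin f} {k l l' : Fin 4}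
    (h : Adj Q g i k j l) (h' : Adj Q g i k j' l') : j = j' ∧ l = l' := by
  have e : k = sideAt k true := by simp [sideAt]
  rw [e] at h h'
  obtain ⟨c', b', rfl, h1, h2⟩ := h.exists_ray
  obtain ⟨c'', b'', rfl, h3, h4⟩ := h'.exists_ray
  obtain ⟨rfl, rfl, rfl⟩ := eq_of_ray_eq hT h1 h3 h2 h4 h.1 h'.1
  exact ⟨rfl, rfl⟩

/-- The tiles at a vertex form a single cycle: a nonempty set of corners at a vertex that is closed
under adjacency contains all corners at this vertex. -/
theorem cornersAt_subset_of_closed (hT : IsEdgeToEdgeTiling Q g) {v : S2} (S : Finset (Fin f × Fin 4))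
    (hS : S ⊆ cornersAt Q g v) (hne : S.Nonempty)
    (hcl : ∀ ik ∈ S, ∀ b, ∃ jl ∈ S, ∃ b', Adj Q g ik.1 (sideAt ik.2 b) jl.1 (sideAt jl.2 b') ∧
      ray Q g jl.1 jl.2 b' = ray Q g ik.1 ik.2 b) :
    cornersAt Q g v ⊆ S := by
  obtain ⟨⟨i₀, k₀⟩, h₀⟩ := hne
  have hv := mem_cornersAt.1 (hS h₀)
  simp only at hv
  subst hv
  obtain ⟨e₁, e₂, a, st, h⟩ := exists_isVertexChart (Q := Q) (g := g) (vert Q g i₀ k₀)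
  -- The neighbour across the final ray must start there. If it stopped there too, `final_inj` would
  -- make it the same corner.
  have h1 : ∀ ik ∈ S, ∃ jl ∈ S, ((a jl : ℝ) : Real.Angle) = (a ik + Q.angle ik.2 : ℝ) := by
    intro ik hik
    obtain ⟨jl, hjl, b', hadj, hr⟩ := hcl ik hik (!(st ik))
    refine ⟨jl, hjl, ?_⟩
    rw [h.final ik (hS hik)] at hr
    rcases h.ray_cases (hS hjl) b' with ⟨-, s⟩ | ⟨-, s⟩
    · rw [s] at hr; exact (dirAt_eq_iff h.frame).1 hr
    · rw [s] at hr
      have := h.final_inj hT (hS hjl) (hS hik) ((dirAt_eq_iff h.frame).1 hr)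
      rw [this] at hadj
      exact absurd rfl hadj.1
  classical
  have hsub : S.image (fun ik => ((a ik + Q.angle ik.2 : ℝ) : Real.Angle)) ⊆
      S.image (fun ik => ((a ik : ℝ) : Real.Angle)) := by
    intro x hx
    obtain ⟨ik, hik, rfl⟩ := Finset.mem_image.1 hx
    obtain ⟨jl, hjl, he⟩ := h1 ik hik
    exact Finset.mem_image.2 ⟨jl, hjl, he⟩
  have inj1 : InjOn (fun ik => ((a ik : ℝ) : Real.Angle)) S := fun x hx y hy he =>
    h.start_inj hT (hS hx) (hS hy) he
  have inj2 : InjOn (fun ik => ((a ik + Q.angle ik.2 : ℝ) : Real.Angle)) S := fun x hx y hy he =>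
    h.final_inj hT (hS hx) (hS hy) he
  have heq := Finset.eq_of_subset_of_card_le hsub (by
    rw [Finset.card_image_of_injOn inj1, Finset.card_image_of_injOn inj2])
  -- Starting and final angles of S form the same set modulo 2π. Subtracting their sums leaves the
  -- sum of the angles, which is therefore a positive multiple of the full turn.
  have hsum : ((∑ ik ∈ S, Q.angle ik.2 : ℝ) : Real.Angle) = 0 := by
    have e1 := Finset.sum_image (f := fun x : Real.Angle => x) inj1
    have e2 := Finset.sum_image (f := fun x : Real.Angle => x) inj2
    rw [heq, e1] at e2
    simp only [Real.Angle.coe_add, Finset.sum_add_distrib] at e2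
    have e3 : ((∑ ik ∈ S, Q.angle ik.2 : ℝ) : Real.Angle) =
        ∑ ik ∈ S, ((Q.angle ik.2 : ℝ) : Real.Angle) := map_sum Real.Angle.coeHom _ _
    rw [e3]
    exact (left_eq_add.1 e2)
  rw [Real.Angle.coe_eq_zero_iff] at hsum
  obtain ⟨m, hm⟩ := hsum
  rw [zsmul_eq_mul] at hm
  have hpos : 0 < ∑ ik ∈ S, Q.angle ik.2 :=
    Finset.sum_pos (fun ik _ => Q.angle_pos ik.2) ⟨_, h₀⟩
  have hpi := two_pi_pos
  have hm1 : 1 ≤ m := by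
    have : (0 : ℝ) < m := by
      by_contra hh; push Not at hh
      nlinarith
    have : 0 < m := by exact_mod_cast this
    omega
  have hm2 : (1 : ℝ) ≤ m := by exact_mod_cast hm1
  have htot := h.sum_angle hT
  intro jl hjl
  by_contra hnot
  have : ∑ ik ∈ S, Q.angle ik.2 < ∑ ik ∈ cornersAt Q g (vert Q g i₀ k₀), Q.angle ik.2 :=
    Finset.sum_lt_sum_of_subset hS hjl hnot (Q.angle_pos _) fun x _ _ => (Q.angle_pos _).le
  nlinarith

end Tiling

/-! ### Counting over all vertices: Euler's formula and the angle sum of the tile -/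

section Tiling
variable {Q : QuadTile} {f : ℕ} {g : Fin f → E3 ≃ₗᵢ[ℝ] E3}

open Classical in
/-- The vertices of the tiling. -/
noncomputable def verts (Q : QuadTile) (g : Fin f → E3 ≃ₗᵢ[ℝ] E3) : Finset S2 :=
  Finset.univ.image fun ik : Fin f × Fin 4 => vert Q g ik.1 ik.2

theorem mem_verts {v : S2} : v ∈ verts Q g ↔ ∃ i k, vert Q g i k = v := by
  simp [verts]

theorem sum_verts {M : Type*} [AddCommMonoid M] (F : Fin f × Fin 4 → M) :
    ∑ v ∈ verts Q g, ∑ ik ∈ cornersAt Q g v, F ik = ∑ i, ∑ k, F (i, k) := by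
  classical
  rw [← Fintype.sum_prod_type' (f := fun i k => F (i, k))]
  unfold verts
  have := Finset.sum_fiberwise_of_maps_to (s := Finset.univ) (t := verts Q g)
    (g := fun ik : Fin f × Fin 4 => vert Q g ik.1 ik.2) (fun ik _ => by
      rw [mem_verts]; exact ⟨_, _, rfl⟩) F
  rw [← this]
  refine Finset.sum_congr rfl fun v _ => Finset.sum_congr ?_ fun _ _ => rfl
  ext ik; simp [cornersAt]

theorem vertexType_eq (v : S2) (k : Fin 4) :
    vertexType Q g v k = ((cornersAt Q g v).filter fun ik => ik.2 = k).card := by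
  classical
  rw [vertexType, ← Set.ncard_coe_finset]
  have : (((cornersAt Q g v).filter fun ik => ik.2 = k : Finset (Fin f × Fin 4)) : Set _) =
      (fun i => (i, k)) '' {i : Fin f | move (g i) (Q.corner k) = v} := by
    ext ⟨i, l⟩
    simp only [Finset.coe_filter, mem_cornersAt, mem_ofPred_eq, mem_image, Prod.mk.injEq, vert]
    constructor
    · rintro ⟨h, rfl⟩; exact ⟨i, h, rfl, rfl⟩
    · rintro ⟨_, h, rfl, rfl⟩; exact ⟨h, rfl⟩
  rw [this, Set.ncard_image_of_injective _ fun i j h => (Prod.mk.inj h).1]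

theorem sum_cornersAt (v : S2) (F : Fin 4 → ℝ) :
    ∑ ik ∈ cornersAt Q g v, F ik.2 = ∑ k, (vertexType Q g v k : ℝ) * F k := by
  classical
  rw [← Finset.sum_fiberwise (cornersAt Q g v) (fun ik => ik.2)]
  refine Finset.sum_congr rfl fun k _ => ?_
  rw [Finset.sum_congr rfl (g := fun _ => F k) fun ik hik => by rw [(Finset.mem_filter.1 hik).2],
    Finset.sum_const, vertexType_eq, nsmul_eq_mul]

/-- The angles at a vertex add up to a full turn. -/
theorem sum_vertexType_mul_angle (hT : IsEdgeToEdgeTiling Q g) {v : S2} (hv : v ∈ verts Q g) :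
    ∑ k, (vertexType Q g v k : ℝ) * Q.angle k = 2 * π := by
  obtain ⟨i, k, rfl⟩ := mem_verts.1 hv
  rw [← sum_cornersAt]
  exact sum_angle_cornersAt hT i k

/-- Every angle of the tile occurs `f` times in the tiling. -/
theorem sum_verts_vertexType (F : Fin 4 → ℝ) :
    ∑ v ∈ verts Q g, ∑ k, (vertexType Q g v k : ℝ) * F k = f * ∑ k, F k := by
  simp_rw [← sum_cornersAt]
  rw [sum_verts (fun ik => F ik.2)]
  simp

/-- Vectors tangent at the vertex see x only through its direction d from there, up to a positive
factor. Each of d and −d points into exactly one corner. -/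
theorem sum_cornerCount (hT : IsEdgeToEdgeTiling Q g) {x v : S2} (hx : GenericPoint Q g x)
    (hv : v ∈ verts Q g) :
    ∑ ik ∈ cornersAt Q g v, Q.cornerCount ik.2 (move (g ik.1).symm x) = 2 := by
  obtain ⟨i, k, rfl⟩ := mem_verts.1 hv
  have hf := vert_frame (Q := Q) (g := g) i k
  obtain ⟨e₁, e₂, h⟩ := exists_isFrame (vert Q g i k : E3) (by simp)
  have hne := h.coord_ne_zero (x := (x : E3)) (by simp)
    (fun he => hx i k (by rw [he]; exact hf.wp))
    (fun he => hx i k (by rw [he, inner_neg_right, hf.wp, neg_zero]))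
  obtain ⟨ρ, hρ, φ, -, hA, hB⟩ := exists_polar_pos hne
  have hd := (h.frame_dirAt φ).isUnitTangent
  have hx' : (x : E3) = (inner ℝ (vert Q g i k : E3) (x : E3) : ℝ) • (vert Q g i k : E3) +
      ρ • dirAt e₁ e₂ φ := by
    conv_lhs => rw [h.expand x, hA, hB]
    rw [dirAt]; module
  set d := dirAt e₁ e₂ φ
  have hin : ∀ n : E3, (inner ℝ n (vert Q g i k : E3) : ℝ) = 0 →
      (inner ℝ n (x : E3) : ℝ) = ρ * inner ℝ n d := by
    intro n hn
    conv_lhs => rw [hx']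
    rw [inner_add_right, real_inner_smul_right, real_inner_smul_right, hn]; ring
  have hg : GenericDirection Q g (vert Q g i k) d := by
    intro j l h0 h1
    apply hx j l
    rw [hin _ h0, h1, mul_zero]
  have hg' : GenericDirection Q g (vert Q g i k) (-d) := by
    intro j l h0
    rw [inner_neg_right, neg_ne_zero]
    exact hg j l h0
  have hd' : IsUnitTangent (vert Q g i k) (-d) :=
    ⟨by rw [norm_neg]; exact hd.1, by rw [inner_neg_right, hd.2, neg_zero]⟩
  classical
  have key : ∀ d' : E3, (∃! ik : Fin f × Fin 4, vert Q g ik.1 ik.2 = vert Q g i k ∧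
      PointsInto Q g d' ik) →
      ∑ ik ∈ cornersAt Q g (vert Q g i k), (if PointsInto Q g d' ik then (1 : ℝ) else 0) = 1 := by
    rintro d' ⟨ik, ⟨h1, h2⟩, h3⟩
    rw [Finset.sum_eq_single_of_mem ik (mem_cornersAt.2 h1), if_pos h2]
    intro jl hjl hne
    rw [if_neg]
    exact fun hm => hne (h3 jl ⟨mem_cornersAt.1 hjl, hm⟩)
  have e : ∀ ik ∈ cornersAt Q g (vert Q g i k), Q.cornerCount ik.2 (move (g ik.1).symm x) =
      (if PointsInto Q g d ik then (1 : ℝ) else 0) +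
        (if PointsInto Q g (-d) ik then (1 : ℝ) else 0) := by
    rintro ⟨j, l⟩ hjl
    have hjf := vert_frame (Q := Q) (g := g) j l
    rw [mem_cornersAt.1 hjl] at hjf
    simp only [QuadTile.cornerCount, coe_move, ← inner_map_left, sectorCount]
    rw [hin _ hjf.up, hin _ hjf.wp, ← mul_neg, ← mul_neg]
    simp only [inSector_mul hρ, PointsInto, inner_neg_right]
    congr!
  rw [Finset.sum_congr rfl e, Finset.sum_add_distrib, key d (existsUnique_pointsInto hT hd hg),
    key (-d) (existsUnique_pointsInto hT hd' hg')]
  norm_num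

theorem sum_ind (hT : IsEdgeToEdgeTiling Q g) {x : S2} (hx : GenericPoint Q g x) :
    ∑ i, Q.ind (move (g i).symm x) = 1 := by
  obtain ⟨i, hi, hu⟩ := existsUnique_tile hT hx
  rw [Finset.sum_eq_single i]
  · rw [QuadTile.ind, if_pos (mem_move_image.1 hi)]
  · intro j _ hj
    rw [QuadTile.ind, if_neg]
    exact fun h => hj (hu j (mem_move_image.2 h))
  · simp

theorem degree_eq_card (v : S2) : degree (vertexType Q g v) = (cornersAt Q g v).card := by
  have h := sum_cornersAt (Q := Q) (g := g) v (fun _ => 1)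
  simp only [Finset.sum_const, nsmul_eq_mul, mul_one, Fin.sum_univ_four] at h
  rw [degree]
  exact_mod_cast h.symm

/-- Euler's formula for the tiling. -/
theorem card_verts (hT : IsEdgeToEdgeTiling Q g) (hf : 0 < f) : (verts Q g).card = f + 2 := by
  obtain ⟨m, hm⟩ := Q.exists_charge
  have hne : Nonempty S2 := ⟨Q.corner 0⟩
  obtain ⟨x, hx⟩ := (dense_genericPoint (Q := Q) (g := g)).nonempty
  change GenericPoint Q g x at hx
  have hx' : GenericPoint Q g (-x : S2) := by
    intro i k; rw [coe_neg_sphere, inner_neg_right, neg_ne_zero]; exact hx i k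
  have h1 : ∑ i, Q.charge (move (g i).symm x) = 2 * (verts Q g).card - 4 := by
    have e : ∀ i, Q.charge (move (g i).symm x) = ∑ k, Q.cornerCount k (move (g i).symm x) -
        2 * Q.ind (move (g i).symm x) - 2 * Q.ind (move (g i).symm (-x)) := by
      intro i
      rw [QuadTile.charge]
      congr 3
      apply Subtype.ext
      simp [coe_move, coe_neg_sphere]
    simp_rw [e]
    rw [Finset.sum_sub_distrib, Finset.sum_sub_distrib, ← Finset.mul_sum, ← Finset.mul_sum,
      sum_ind hT hx, sum_ind hT hx',
      ← sum_verts (Q := Q) (g := g) (fun ik => Q.cornerCount ik.2 (move (g ik.1).symm x)),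
      Finset.sum_congr rfl fun v hv => sum_cornerCount hT hx hv]
    simp only [Finset.sum_const, nsmul_eq_mul]
    ring
  rw [Finset.sum_congr rfl fun i _ => hm _ (hx.generic i)] at h1
  simp only [Finset.sum_const, Finset.card_univ, Fintype.card_fin, nsmul_eq_mul] at h1
  -- The common charge 2m, counted over all tiles, equals 2V − 4.
  have h2 : (f : ℤ) * m = (verts Q g).card - 2 := by
    have : (f : ℝ) * m = (verts Q g).card - 2 := by linarith
    exact_mod_cast this
  have h3 : 4 ≤ (verts Q g).card := by
    have : Finset.univ.image (vert Q g ⟨0, hf⟩) ⊆ verts Q g := by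
      intro v hv
      obtain ⟨k, -, rfl⟩ := Finset.mem_image.1 hv
      exact mem_verts.2 ⟨_, _, rfl⟩
    have := Finset.card_le_card this
    rwa [Finset.card_image_of_injective _ (vert_injective _)] at this
  have h4 : 3 * (verts Q g).card ≤ 4 * f := by
    have e := sum_verts (Q := Q) (g := g) (fun _ => 1)
    simp only [Finset.sum_const, Finset.card_univ, Fintype.card_fin, smul_eq_mul, mul_one] at e
    have : ∑ v ∈ verts Q g, 3 ≤ ∑ v ∈ verts Q g, (cornersAt Q g v).card := by
      refine Finset.sum_le_sum fun v hv => ?_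
      obtain ⟨i, k, rfl⟩ := mem_verts.1 hv
      rw [← degree_eq_card]
      exact hT.three_le_degree i k
    rw [e] at this
    simp only [Finset.sum_const, smul_eq_mul] at this
    linarith
  have hf' : (0 : ℤ) < f := by exact_mod_cast hf
  have h3' : (4 : ℤ) ≤ (verts Q g).card := by exact_mod_cast h3
  have h4' : (3 : ℤ) * (verts Q g).card ≤ 4 * f := by exact_mod_cast h4
  -- V ≥ 4 makes fm positive, and 3V ≤ 4f makes it smaller than 2f.
  have hm1 : m = 1 := by
    have : 0 < m := by
      by_contra hh; push Not at hh
      nlinarith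
    have : m < 2 := by
      by_contra hh; push Not at hh
      nlinarith
    omega
  subst hm1
  have : ((verts Q g).card : ℤ) = f + 2 := by linarith
  exact_mod_cast this

/-- The angle sum of the tile. -/
theorem sum_angle (hT : IsEdgeToEdgeTiling Q g) (hf : 0 < f) :
    Q.angle 0 + Q.angle 1 + Q.angle 2 + Q.angle 3 = 2 * π + 4 * π / f := by
  have h1 := sum_verts_vertexType (Q := Q) (g := g) Q.angle
  rw [Finset.sum_congr rfl fun v hv => sum_vertexType_mul_angle hT hv, Fin.sum_univ_four,
    Finset.sum_const, card_verts hT hf, nsmul_eq_mul] at h1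
  have : (0 : ℝ) < f := by exact_mod_cast hf
  push_cast at h1
  field_simp
  linarith

end Tiling

/-! ### Neighbours across the a-, b- and c-sides -/

section Tiling
variable {Q : QuadTile} {f : ℕ} {g : Fin f → E3 ≃ₗᵢ[ℝ] E3}

/-- The other end of side `sideAt c b`. -/
def far (c : Fin 4) (b : Bool) : Fin 4 := if b then c + 1 else c - 1

theorem sideAt_far (c : Fin 4) (b : Bool) : sideAt (far c b) (!b) = sideAt c b := by
  revert c b; decide

theorem eq_or_eq_far {c c' : Fin 4} {b b' : Bool} (h : sideAt c b = sideAt c' b') :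
    (c = c' ∧ b = b') ∨ (c = far c' b' ∧ b = !b') := by
  revert c b c' b'; decide

theorem ne_far (c : Fin 4) (b : Bool) : c ≠ far c b := by
  revert c b; decide

theorem far_far (c : Fin 4) (b : Bool) : far (far c b) (!b) = c := by
  revert c b; decide

/-- The tile on the other side of a side, with its corners at the two ends. -/
theorem Adj.exists_dart {i j : Fin f} {c l : Fin 4} {b : Bool} (h : Adj Q g i (sideAt c b) j l) :
    ∃ c' b', l = sideAt c' b' ∧ vert Q g j c' = vert Q g i c ∧
      vert Q g j (far c' b') = vert Q g i (far c b) ∧ ray Q g j c' b' = ray Q g i c b := by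
  obtain ⟨c', b', rfl, h1, h1'⟩ := h.exists_ray
  have h2 := h
  rw [← sideAt_far c b] at h2
  obtain ⟨c₂, b₂, h3, h4, -⟩ := h2.exists_ray
  refine ⟨c', b', rfl, h1, ?_, h1'⟩
  rcases eq_or_eq_far h3 with ⟨h5, -⟩ | ⟨h5, h6⟩
  · rw [← h5, h1] at h4
    exact absurd (vert_injective i h4) (ne_far c b)
  · rw [h5, h6, far_far, h4]

/-- Two sides of the tile have equal length only if they are the two `a`-sides. -/
theorem QuadTile.IsA2BC.side_cases (hQ : Q.IsA2BC) {k l : Fin 4} (h : Q.len k = Q.len l) :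
    k = l ∨ (k = 0 ∧ l = 3) ∨ (k = 3 ∧ l = 0) := by
  obtain ⟨h1, h2, h3, h4⟩ := hQ
  fin_cases k <;> fin_cases l <;> simp_all

variable (hQ : Q.IsA2BC) (hT : IsEdgeToEdgeTiling Q g)
include hQ hT

theorem exists_nbr (i : Fin f) (c : Fin 4) (b : Bool) : ∃ j c' b', i ≠ j ∧
    Adj Q g i (sideAt c b) j (sideAt c' b') ∧ vert Q g j c' = vert Q g i c ∧
    vert Q g j (far c' b') = vert Q g i (far c b) ∧
    (sideAt c b = sideAt c' b' ∨ (sideAt c b = 0 ∧ sideAt c' b' = 3) ∨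
      (sideAt c b = 3 ∧ sideAt c' b' = 0)) := by
  obtain ⟨j, l, h⟩ := exists_adj hT i (sideAt c b)
  obtain ⟨c', b', rfl, h1, h2, -⟩ := h.exists_dart
  exact ⟨j, c', b', h.1, h, h1, h2, hQ.side_cases h.len_eq⟩

/-- The neighbour across an `a`-side, seen from a corner. -/
theorem exists_nbr_a (i : Fin f) {c : Fin 4} {b : Bool} (hcb : sideAt c b = 0 ∨ sideAt c b = 3) :
    ∃ j, i ≠ j ∧
      ((Adj Q g i (sideAt c b) j 0 ∧ vert Q g j 0 = vert Q g i c ∧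
          vert Q g j 1 = vert Q g i (far c b)) ∨
        (Adj Q g i (sideAt c b) j 3 ∧ vert Q g j 0 = vert Q g i c ∧
          vert Q g j 3 = vert Q g i (far c b)) ∨
        (Adj Q g i (sideAt c b) j 0 ∧ vert Q g j 1 = vert Q g i c ∧
          vert Q g j 0 = vert Q g i (far c b)) ∨
        (Adj Q g i (sideAt c b) j 3 ∧ vert Q g j 3 = vert Q g i c ∧
          vert Q g j 0 = vert Q g i (far c b))) := by
  obtain ⟨j, c', b', hne, h1, h2, h3, h4⟩ := exists_nbr hQ hT i c b
  refine ⟨j, hne, ?_⟩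
  have hd : ∀ (c' : Fin 4) (b' : Bool), (sideAt c' b' = 0 ∨ sideAt c' b' = 3) →
      (c' = 0 ∧ b' = true) ∨ (c' = 0 ∧ b' = false) ∨ (c' = 1 ∧ b' = false) ∨
        (c' = 3 ∧ b' = true) := by decide
  have h5 : sideAt c' b' = 0 ∨ sideAt c' b' = 3 := by
    rcases h4 with h4 | ⟨-, h4⟩ | ⟨-, h4⟩
    · rwa [h4] at hcb
    · exact Or.inr h4
    · exact Or.inl h4
  rcases hd c' b' h5 with ⟨rfl, rfl⟩ | ⟨rfl, rfl⟩ | ⟨rfl, rfl⟩ | ⟨rfl, rfl⟩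
  · exact Or.inl ⟨h1, h2, h3⟩
  · exact Or.inr (Or.inl ⟨h1, h2, h3⟩)
  · exact Or.inr (Or.inr (Or.inl ⟨h1, h2, h3⟩))
  · exact Or.inr (Or.inr (Or.inr ⟨h1, h2, h3⟩))

/-- The neighbour across side `k`, for the `b`-side (`k = 1`) and the `c`-side (`k = 2`). -/
theorem exists_nbr_bc (i : Fin f) {k : Fin 4} (hk : k = 1 ∨ k = 2) :
    ∃ j, i ≠ j ∧ Adj Q g i k j k ∧
      ((vert Q g j k = vert Q g i k ∧ vert Q g j (k + 1) = vert Q g i (k + 1)) ∨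
        (vert Q g j k = vert Q g i (k + 1) ∧ vert Q g j (k + 1) = vert Q g i k)) := by
  have e : sideAt k true = k := rfl
  obtain ⟨j, c', b', hne, h1, h2, h3, h4⟩ := exists_nbr hQ hT i k true
  have h5 : sideAt c' b' = k := by
    rw [e] at h4
    rcases h4 with h4 | ⟨h4, -⟩ | ⟨h4, -⟩
    · exact h4.symm
    · exfalso; rcases hk with rfl | rfl <;> revert h4 <;> decide
    · exfalso; rcases hk with rfl | rfl <;> revert h4 <;> decide
  rw [e, h5] at h1
  refine ⟨j, hne, h1, ?_⟩
  rcases eq_or_eq_far (h5.trans e.symm) with ⟨rfl, rfl⟩ | ⟨rfl, rfl⟩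
  · left; exact ⟨h2, h3⟩
  · right
    refine ⟨?_, h2⟩
    rw [far_far] at h3
    exact h3

omit hQ in
/-- A set of tiles at a vertex that is closed under adjacency across the sides at the vertex
contains all tiles at the vertex. -/
theorem mem_of_closed {v : S2} {S : Set (Fin f)} (hne : ∃ i ∈ S, ∃ c, vert Q g i c = v)
    (hcl : ∀ i ∈ S, ∀ c, vert Q g i c = v → ∀ b, ∃ j ∈ S, ∃ l, Adj Q g i (sideAt c b) j l)
    {j : Fin f} {c : Fin 4} (hj : vert Q g j c = v) : j ∈ S := by
  classical
  have key := cornersAt_subset_of_closed hT (v := v) ((cornersAt Q g v).filter fun ik => ik.1 ∈ S)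
    (Finset.filter_subset _ _) (by
      obtain ⟨i, hi, c, hc⟩ := hne
      exact ⟨(i, c), Finset.mem_filter.2 ⟨mem_cornersAt.2 hc, hi⟩⟩) (by
      rintro ⟨i, c⟩ hic b
      obtain ⟨h1, h2⟩ := Finset.mem_filter.1 hic
      obtain ⟨j, hj, l, hadj⟩ := hcl i h2 c (mem_cornersAt.1 h1) b
      obtain ⟨c', b', rfl, h3, -, h4⟩ := hadj.exists_dart
      exact ⟨(j, c'), Finset.mem_filter.2
        ⟨mem_cornersAt.2 (h3.trans (mem_cornersAt.1 h1)), hj⟩, b', hadj, h4⟩)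
  exact (Finset.mem_filter.1 (key (mem_cornersAt.2 hj : ((j, c) : Fin f × Fin 4) ∈ _))).2

omit hQ hT in
open Classical in
theorem vertexType_eq_card (v : S2) (k : Fin 4) :
    vertexType Q g v k = (Finset.univ.filter fun i : Fin f => vert Q g i k = v).card := by
  rw [vertexType, ← Set.ncard_coe_finset]
  congr 1
  ext i
  rw [Finset.coe_filter]
  exact (and_iff_right (Finset.mem_univ i)).symm

omit hQ hT in
theorem vertexType_pos {v : S2} {k : Fin 4} {i : Fin f} (h : vert Q g i k = v) :
    0 < vertexType Q g v k := by
  classical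
  rw [vertexType_eq_card]
  exact Finset.card_pos.2 ⟨i, by simpa using h⟩

omit hQ hT in
theorem exists_vert_of_pos {v : S2} {k : Fin 4} (h : 0 < vertexType Q g v k) :
    ∃ i, vert Q g i k = v := by
  classical
  rw [vertexType_eq_card] at h
  obtain ⟨i, hi⟩ := Finset.card_pos.1 h
  exact ⟨i, by simpa using hi⟩

omit hQ hT in
theorem vertexType_ge_two {v : S2} {k : Fin 4} {i j : Fin f} (hi : vert Q g i k = v)
    (hj : vert Q g j k = v) (hne : i ≠ j) : 2 ≤ vertexType Q g v k := by
  classical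
  rw [vertexType_eq_card, ← Finset.card_pair hne]
  apply Finset.card_le_card
  intro x hx
  simp only [Finset.mem_insert, Finset.mem_singleton] at hx
  rcases hx with rfl | rfl <;> simpa

omit hQ hT in
theorem vertexType_ge_three {v : S2} {k : Fin 4} {i j x : Fin f} (hi : vert Q g i k = v)
    (hj : vert Q g j k = v) (hx : vert Q g x k = v) (hij : i ≠ j) (hix : i ≠ x) (hjx : j ≠ x) :
    3 ≤ vertexType Q g v k := by
  classical
  have h : ({i, j, x} : Finset (Fin f)).card = 3 :=
    Finset.card_eq_three.2 ⟨i, j, x, hij, hix, hjx, rfl⟩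
  rw [vertexType_eq_card]
  refine h.symm.le.trans (Finset.card_le_card ?_)
  intro y hy
  simp only [Finset.mem_insert, Finset.mem_singleton] at hy
  rcases hy with rfl | rfl | rfl <;> simpa

omit hQ hT in
/-- A fixed-point free symmetric pairing on a finite set makes its cardinality even. -/
theorem even_card_of_pairing {ι : Type*} {s : Finset ι} (R : ι → ι → Prop)
    (hex : ∀ i ∈ s, ∃ j ∈ s, R i j) (hu : ∀ i ∈ s, ∀ j ∈ s, ∀ j' ∈ s, R i j → R i j' → j = j')
    (hs : ∀ i j, R i j → R j i) (hi : ∀ i, ¬R i i) : Even s.card := by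
  choose! F hF hR using hex
  have h := Finset.prod_involution (s := s) (f := fun _ => (-1 : ℤ)) (fun i _ => F i)
    (by simp) (by
      intro i hi' _ he
      exact hi i (by conv_rhs => rw [← he]
                     exact hR i hi')) (fun i hi' => hF i hi') (by
      intro i hi'
      exact hu (F i) (hF i hi') _ (hF _ (hF i hi')) i hi' (hR _ (hF i hi')) (hs _ _ (hR i hi')))
  rw [Finset.prod_const] at h
  exact (neg_one_pow_eq_one_iff_even (by norm_num)).1 h

/-- A tile with β or γ at v has exactly one b-side there, which it shares with exactly one other
such tile (for k = 1). The c-sides do the same for γ and δ (for k = 2). -/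
theorem even_add (v : S2) {k : Fin 4} (hk : k = 1 ∨ k = 2) :
    Even (vertexType Q g v k + vertexType Q g v (k + 1)) := by
  classical
  have hkk : k ≠ k + 1 := by revert k; decide
  rw [vertexType_eq_card, vertexType_eq_card, ← Finset.card_union_of_disjoint]
  · refine even_card_of_pairing (fun i j => Adj Q g i k j k) ?_ ?_ ?_ ?_
    · intro i hi
      obtain ⟨j, -, h1, h2⟩ := exists_nbr_bc hQ hT i hk
      refine ⟨j, ?_, h1⟩
      simp only [Finset.mem_union, Finset.mem_filter, Finset.mem_univ, true_and] at hi ⊢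
      rcases h2 with ⟨h2, h3⟩ | ⟨h2, h3⟩ <;> rw [h2, h3]
      · exact hi
      · exact hi.symm
    · intro i _ j _ j' _ h h'
      exact (h.unique hT h').1
    · exact fun i j h => h.symm
    · exact fun i h => h.1 rfl
  · rw [Finset.disjoint_filter]
    intro i _ h1 h2
    exact hkk (vert_injective i (h1.trans h2.symm))

end Tiling

/-! ### Parity, angle inequalities and the first list of vertices -/

/-- The tilings under consideration: `αβ²` is the only vertex of degree three and `γ²δ²` is not
a vertex. -/
structure IsAB2Tiling (Q : QuadTile) {f : ℕ} (g : Fin f → E3 ≃ₗᵢ[ℝ] E3) : Prop where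
  isA2BC : Q.IsA2BC
  tiling : IsEdgeToEdgeTiling Q g
  degree_three : {t ∈ avc Q g | degree t = 3} = {vtx 1 2 0 0}
  not_mem : vtx 0 0 2 2 ∉ avc Q g

/-- The arithmetic core of `classify_zero`. Hypotheses b₁ to b₅ name angle combinations that exceed
2π. b₆ rules out degree three, and b₇ is the assumption on γ²δ². -/
theorem arith_classify_zero {l m n : ℕ} (e₁ : Even (l + m)) (e₂ : Even (m + n))
    (b₀ : 3 ≤ 0 + l + m + n) (b₁ : ¬(3 ≤ l ∧ 1 ≤ m ∧ 1 ≤ n)) (b₂ : ¬(1 ≤ l ∧ 3 ≤ m ∧ 1 ≤ n))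
    (b₃ : ¬4 ≤ l) (b₄ : ¬(2 ≤ l ∧ 2 ≤ m)) (b₅ : ¬(4 ≤ m ∧ 2 ≤ n)) (b₆ : l + m + n ≠ 3)
    (b₇ : ¬(l = 0 ∧ m = 2 ∧ n = 2)) :
    (l = 1 ∧ m = 1 ∧ Odd n ∧ 3 ≤ n) ∨ (l = 2 ∧ m = 0 ∧ Even n ∧ 2 ≤ n) ∨
      (l = 0 ∧ m = 2 ∧ Even n ∧ 4 ≤ n) ∨ (l = 0 ∧ n = 0 ∧ Even m ∧ 4 ≤ m) ∨
      (l = 0 ∧ m = 0 ∧ Even n ∧ 4 ≤ n) := by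
  rw [Nat.even_iff] at e₁ e₂
  obtain rfl | rfl | rfl | rfl : l = 0 ∨ l = 1 ∨ l = 2 ∨ l = 3 := by
    clear b₁ b₂ b₄ b₅ b₆ b₇; omega
  · clear b₁ b₂ b₃ b₄
    rcases (by omega : m = 0 ∨ m = 2 ∨ 4 ≤ m) with rfl | rfl | hm
    · exact .inr (.inr (.inr (.inr ⟨rfl, rfl, Nat.even_iff.2 (by omega), by omega⟩)))
    · exact .inr (.inr (.inl ⟨rfl, rfl, Nat.even_iff.2 (by omega), by omega⟩))
    · exact .inr (.inr (.inr (.inl ⟨rfl, by omega, Nat.even_iff.2 (by omega), hm⟩)))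
  · clear b₁ b₃ b₄ b₅ b₇
    obtain rfl : m = 1 := by omega
    exact .inl ⟨rfl, rfl, Nat.odd_iff.2 (by omega), by omega⟩
  · clear b₁ b₂ b₃ b₅ b₆ b₇
    obtain rfl : m = 0 := by omega
    exact .inr (.inl ⟨rfl, rfl, Nat.even_iff.2 (by omega), by omega⟩)
  · clear b₂ b₃ b₅ b₆ b₇
    omega

section Tiling
variable {Q : QuadTile} {f : ℕ} {g : Fin f → E3 ≃ₗᵢ[ℝ] E3}

theorem vtx_inj {k l m n k' l' m' n' : ℕ} :
    vtx k l m n = vtx k' l' m' n' ↔ k = k' ∧ l = l' ∧ m = m' ∧ n = n' := by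
  constructor
  · intro h
    exact ⟨congrFun h 0, congrFun h 1, congrFun h 2, congrFun h 3⟩
  · rintro ⟨rfl, rfl, rfl, rfl⟩; rfl

theorem eq_vtx (t : Fin 4 → ℕ) : t = vtx (t 0) (t 1) (t 2) (t 3) := by
  ext k; fin_cases k <;> rfl

theorem vtx_vert_mem (i : Fin f) (c : Fin 4) :
    vtx (vertexType Q g (vert Q g i c) 0) (vertexType Q g (vert Q g i c) 1)
      (vertexType Q g (vert Q g i c) 2) (vertexType Q g (vert Q g i c) 3) ∈ avc Q g :=
  ⟨i, c, (eq_vtx _).symm⟩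

theorem exists_of_mem_avc {t : Fin 4 → ℕ} (h : t ∈ avc Q g) :
    ∃ v ∈ verts Q g, vertexType Q g v = t := by
  obtain ⟨i, k, rfl⟩ := h
  exact ⟨_, mem_verts.2 ⟨i, k, rfl⟩, rfl⟩

theorem mem_avc_of_verts {v : S2} (h : v ∈ verts Q g) :
    vtx (vertexType Q g v 0) (vertexType Q g v 1) (vertexType Q g v 2) (vertexType Q g v 3) ∈
      avc Q g := by
  obtain ⟨i, k, rfl⟩ := mem_verts.1 h
  exact vtx_vert_mem i k

theorem angle_sum_of_mem (hT : IsEdgeToEdgeTiling Q g) {k l m n : ℕ}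
    (h : vtx k l m n ∈ avc Q g) :
    k * Q.angle 0 + l * Q.angle 1 + m * Q.angle 2 + n * Q.angle 3 = 2 * π := by
  obtain ⟨v, hv, h1⟩ := exists_of_mem_avc h
  have h2 := sum_vertexType_mul_angle hT hv
  rw [h1, Fin.sum_univ_four] at h2
  exact h2

/-- A combination of at most the angles at a vertex has sum at most `2π`. -/
theorem angle_sum_le_of_mem (hT : IsEdgeToEdgeTiling Q g) {k l m n : ℕ}
    (h : vtx k l m n ∈ avc Q g) (a b c d : ℕ) (ha : a ≤ k) (hb : b ≤ l) (hc : c ≤ m)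
    (hd : d ≤ n) :
    a * Q.angle 0 + b * Q.angle 1 + c * Q.angle 2 + d * Q.angle 3 ≤ 2 * π := by
  rw [← angle_sum_of_mem hT h]
  have h0 := Q.angle_pos 0
  have h1 := Q.angle_pos 1
  have h2 := Q.angle_pos 2
  have h3 := Q.angle_pos 3
  gcongr

theorem three_le_of_mem (hT : IsEdgeToEdgeTiling Q g) {k l m n : ℕ}
    (h : vtx k l m n ∈ avc Q g) : 3 ≤ k + l + m + n := by
  obtain ⟨i, c, h⟩ := h
  have := hT.three_le_degree i c
  rw [← h] at this
  exact this

theorem balance (a b c d : ℤ) : ∑ v ∈ verts Q g, ((vertexType Q g v 0 : ℤ) * a +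
    vertexType Q g v 1 * b + vertexType Q g v 2 * c + vertexType Q g v 3 * d) =
      f * (a + b + c + d) := by
  have h := sum_verts_vertexType (Q := Q) (g := g) (fun k => ((![a, b, c, d] k : ℤ) : ℝ))
  simp only [Fin.sum_univ_four] at h
  exact_mod_cast h

/-- Every angle occurs f times, so weights with sum zero have total zero over all vertices. One
negative vertex forces a positive one. -/
theorem exists_pos_of_balance {a b c d : ℤ} (h : a + b + c + d = 0) {k l m n : ℕ}
    (hm : vtx k l m n ∈ avc Q g) (hn : k * a + l * b + m * c + n * d < 0) :
    ∃ k l m n : ℕ, vtx k l m n ∈ avc Q g ∧ 0 < k * a + l * b + m * c + n * d := by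
  have hb := balance (Q := Q) (g := g) a b c d
  rw [h, mul_zero] at hb
  obtain ⟨v, hv, h1⟩ := exists_of_mem_avc hm
  obtain ⟨w, hw, h2⟩ := Finset.exists_pos_of_sum_zero_of_exists_nonzero _ hb ⟨v, hv, by
    rw [h1]; exact hn.ne⟩
  exact ⟨_, _, _, _, mem_avc_of_verts hw, h2⟩

theorem exists_neg_of_balance (hf : 0 < f) {a b c d : ℤ} (h : a + b + c + d < 0) :
    ∃ k l m n : ℕ, vtx k l m n ∈ avc Q g ∧ k * a + l * b + m * c + n * d < 0 := by
  have hb := balance (Q := Q) (g := g) a b c d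
  by_contra! hc
  have : (0 : ℤ) ≤ f * (a + b + c + d) := by
    rw [← hb]
    exact Finset.sum_nonneg fun v hv => hc _ _ _ _ (mem_avc_of_verts hv)
  have h1 : (0 : ℤ) < f := by exact_mod_cast hf
  nlinarith

theorem exists_three_of_le {v : S2} {k : Fin 4} (h : 3 ≤ vertexType Q g v k) :
    ∃ x y z, vert Q g x k = v ∧ vert Q g y k = v ∧ vert Q g z k = v ∧ x ≠ y ∧ x ≠ z ∧ y ≠ z := by
  classical
  rw [vertexType_eq_card] at h
  obtain ⟨x, hx, y, hy, z, hz, h1, h2, h3⟩ := Finset.two_lt_card.1 h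
  exact ⟨x, y, z, by simpa using hx, by simpa using hy, by simpa using hz, h1, h2, h3⟩

theorem eq_of_vertexType_eq_one {v : S2} {k : Fin 4} (h : vertexType Q g v k ≤ 1) {i j : Fin f}
    (hi : vert Q g i k = v) (hj : vert Q g j k = v) : i = j := by
  by_contra hne
  have := vertexType_ge_two hi hj hne
  omega

section Neighbours
variable (hQ : Q.IsA2BC) (hT : IsEdgeToEdgeTiling Q g)
include hQ hT

/-- The neighbour across side `AB`. -/
theorem exists_nbr_zero (i : Fin f) : ∃ j, i ≠ j ∧
    ((Adj Q g i 0 j 0 ∧ vert Q g j 0 = vert Q g i 0 ∧ vert Q g j 1 = vert Q g i 1) ∨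
      (Adj Q g i 0 j 3 ∧ vert Q g j 0 = vert Q g i 0 ∧ vert Q g j 3 = vert Q g i 1) ∨
      (Adj Q g i 0 j 0 ∧ vert Q g j 1 = vert Q g i 0 ∧ vert Q g j 0 = vert Q g i 1) ∨
      (Adj Q g i 0 j 3 ∧ vert Q g j 3 = vert Q g i 0 ∧ vert Q g j 0 = vert Q g i 1)) :=
  exists_nbr_a hQ hT i (c := 0) (b := true) (Or.inl rfl)

/-- The neighbour across side `DA`. -/
theorem exists_nbr_three (i : Fin f) : ∃ j, i ≠ j ∧
    ((Adj Q g i 3 j 0 ∧ vert Q g j 0 = vert Q g i 0 ∧ vert Q g j 1 = vert Q g i 3) ∨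
      (Adj Q g i 3 j 3 ∧ vert Q g j 0 = vert Q g i 0 ∧ vert Q g j 3 = vert Q g i 3) ∨
      (Adj Q g i 3 j 0 ∧ vert Q g j 1 = vert Q g i 0 ∧ vert Q g j 0 = vert Q g i 3) ∨
      (Adj Q g i 3 j 3 ∧ vert Q g j 3 = vert Q g i 0 ∧ vert Q g j 0 = vert Q g i 3)) :=
  exists_nbr_a hQ hT i (c := 0) (b := false) (Or.inr rfl)

/-- A vertex with an angle `α` and an angle `γ` has an angle `β` or `δ`. -/
theorem vertexType_beta_add_delta_pos {v : S2} (h0 : 0 < vertexType Q g v 0)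
    (h2 : 0 < vertexType Q g v 2) : 0 < vertexType Q g v 1 + vertexType Q g v 3 := by
  by_contra h
  have hb : ∀ i, vert Q g i 1 ≠ v := fun i hi => by have := vertexType_pos hi; omega
  have hd : ∀ i, vert Q g i 3 ≠ v := fun i hi => by have := vertexType_pos hi; omega
  obtain ⟨x, hx⟩ := exists_vert_of_pos h0
  obtain ⟨y, hy⟩ := exists_vert_of_pos h2
  -- Without β and δ, the only angle that can follow α across an a-side is α. The α-tiles then
  -- already close up the vertex and leave no room for γ.
  have := mem_of_closed hT (v := v) (S := {i | vert Q g i 0 = v}) ⟨x, hx, 0, hx⟩ (by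
    intro i hi c hc b
    change vert Q g i 0 = v at hi
    obtain rfl : c = 0 := vert_injective i (hc.trans hi.symm)
    cases b
    · obtain ⟨j, -, h | h | h | h⟩ := exists_nbr_three hQ hT i
      · exact ⟨j, h.2.1.trans hi, _, h.1⟩
      · exact ⟨j, h.2.1.trans hi, _, h.1⟩
      · exact absurd (h.2.1.trans hi) (hb j)
      · exact absurd (h.2.1.trans hi) (hd j)
    · obtain ⟨j, -, h | h | h | h⟩ := exists_nbr_zero hQ hT i
      · exact ⟨j, h.2.1.trans hi, _, h.1⟩
      · exact ⟨j, h.2.1.trans hi, _, h.1⟩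
      · exact absurd (h.2.1.trans hi) (hb j)
      · exact absurd (h.2.1.trans hi) (hd j)) hy
  exact absurd (vert_injective y (hy.trans (Eq.symm this))) (by decide)

end Neighbours

namespace IsAB2Tiling
variable (h : IsAB2Tiling Q g)
include h

theorem mem_avc : vtx 1 2 0 0 ∈ avc Q g := by
  have : vtx 1 2 0 0 ∈ {t ∈ avc Q g | degree t = 3} := by rw [h.degree_three]; rfl
  exact this.1

theorem eq_of_degree {k l m n : ℕ} (hm : vtx k l m n ∈ avc Q g) (hd : k + l + m + n = 3) :
    k = 1 ∧ l = 2 ∧ m = 0 ∧ n = 0 := by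
  have : vtx k l m n ∈ {t ∈ avc Q g | degree t = 3} := ⟨hm, hd⟩
  rw [h.degree_three] at this
  exact vtx_inj.1 this

theorem pos : 0 < f := by
  obtain ⟨i, -⟩ := h.mem_avc
  exact i.pos

theorem even_beta_gamma {k l m n : ℕ} (hm : vtx k l m n ∈ avc Q g) : Even (l + m) := by
  obtain ⟨v, -, h1⟩ := exists_of_mem_avc hm
  have := even_add h.isA2BC h.tiling v (k := 1) (Or.inl rfl)
  rw [h1] at this
  exact this

theorem even_gamma_delta {k l m n : ℕ} (hm : vtx k l m n ∈ avc Q g) : Even (m + n) := by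
  obtain ⟨v, -, h1⟩ := exists_of_mem_avc hm
  have := even_add h.isA2BC h.tiling v (k := 2) (Or.inr rfl)
  rw [h1] at this
  exact this

theorem four_pi_div_pos : 0 < 4 * π / f := by
  have : (0 : ℝ) < f := by exact_mod_cast h.pos
  positivity

theorem alpha_beta : Q.angle 0 + 2 * Q.angle 1 = 2 * π := by
  have := angle_sum_of_mem h.tiling h.mem_avc
  push_cast at this
  linarith

theorem gamma_delta : Q.angle 2 + Q.angle 3 = Q.angle 1 + 4 * π / f := by
  have := sum_angle h.tiling h.pos
  linarith [h.alpha_beta]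

/-- The vertices with an angle `α`. -/
theorem classify_alpha {k l m n : ℕ} (hm : vtx k l m n ∈ avc Q g) (hk : 1 ≤ k) :
    (k = 1 ∧ l = 2 ∧ m = 0 ∧ n = 0) ∨ (l = 0 ∧ m = 0 ∧ Even n ∧ 4 ≤ k + n) := by
  have e := h.four_pi_div_pos
  have h1 := h.alpha_beta
  have h2 := h.gamma_delta
  have p0 := Q.angle_pos 0
  have p1 := Q.angle_pos 1
  have p2 := Q.angle_pos 2
  have p3 := Q.angle_pos 3
  obtain ⟨x, hx⟩ := h.even_beta_gamma hm
  obtain ⟨y, hy⟩ := h.even_gamma_delta hm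
  have le := angle_sum_le_of_mem h.tiling hm
  have h3 := three_le_of_mem h.tiling hm
  by_cases hl : 2 ≤ l
  · left
    have k1 : k = 1 := by
      by_contra hc
      have := le 2 2 0 0 (by omega) hl (by omega) (by omega)
      push_cast at this; linarith
    have l2 : l = 2 := by
      by_contra hc
      have := le 1 3 0 0 (by omega) (by omega) (by omega) (by omega)
      push_cast at this; linarith
    have m0 : m = 0 := by
      by_contra hc
      have := le 1 2 1 0 (by omega) (by omega) (by omega) (by omega)
      push_cast at this; linarith
    have n0 : n = 0 := by
      by_contra hc
      have := le 1 2 0 1 (by omega) (by omega) (by omega) (by omega)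
      push_cast at this; linarith
    exact ⟨k1, l2, m0, n0⟩
  · right
    -- A single β forces, by parity, a γ and a δ, but α + β + γ + δ exceeds 2π.
    have l0 : l = 0 := by
      by_contra hc
      have := le 1 1 1 1 (by omega) (by omega) (by omega) (by omega)
      push_cast at this; linarith
    have m0 : m = 0 := by
      by_contra hc
      by_cases hn : n = 0
      · obtain ⟨v, -, h4⟩ := exists_of_mem_avc hm
        have := vertexType_beta_add_delta_pos h.isA2BC h.tiling (v := v)
          (by rw [h4]; exact hk) (by rw [h4]; exact Nat.pos_of_ne_zero hc)
        rw [h4] at this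
        change 0 < l + n at this
        omega
      · have := le 1 0 2 2 (by omega) (by omega) (by omega) (by omega)
        push_cast at this; linarith
    refine ⟨l0, m0, ⟨y, by omega⟩, ?_⟩
    by_contra hc
    have := h.eq_of_degree hm (by omega)
    omega

/-- The neighbours across the `a`-sides of the angle `α` at a vertex `αβ²`. -/
theorem nbr_of_alpha_beta_sq {i : Fin f} (hi : vertexType Q g (vert Q g i 0) = vtx 1 2 0 0) :
    (∃ y, Adj Q g i 0 y 0 ∧ vert Q g y 1 = vert Q g i 0 ∧ vert Q g y 0 = vert Q g i 1) ∧
      ∃ z, Adj Q g i 3 z 0 ∧ vert Q g z 1 = vert Q g i 0 ∧ vert Q g z 0 = vert Q g i 3 := by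
  have ha : ∀ j, i ≠ j → vert Q g j 0 ≠ vert Q g i 0 := fun j hj hc =>
    hj (eq_of_vertexType_eq_one (by rw [hi]; rfl) rfl hc)
  have hd : ∀ j, vert Q g j 3 ≠ vert Q g i 0 := fun j hc => by
    have := vertexType_pos hc
    rw [hi] at this
    exact absurd this (by decide)
  constructor
  · obtain ⟨j, hj, h1 | h1 | h1 | h1⟩ := exists_nbr_zero h.isA2BC h.tiling i
    · exact absurd h1.2.1 (ha j hj)
    · exact absurd h1.2.1 (ha j hj)
    · exact ⟨j, h1⟩
    · exact absurd h1.2.1 (hd j)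
  · obtain ⟨j, hj, h1 | h1 | h1 | h1⟩ := exists_nbr_three h.isA2BC h.tiling i
    · exact absurd h1.2.1 (ha j hj)
    · exact absurd h1.2.1 (ha j hj)
    · exact ⟨j, h1⟩
    · exact absurd h1.2.1 (hd j)

/-- The tile across side DA of the α at αβ² has its β at that vertex, hence its α at the other end,
where the first tile has its δ. -/
theorem exists_alpha_delta : ∃ k n, vtx k 0 0 n ∈ avc Q g ∧ 1 ≤ k ∧ 2 ≤ n ∧ Even n := by
  obtain ⟨v, -, h1⟩ := exists_of_mem_avc h.mem_avc
  obtain ⟨i, rfl⟩ := exists_vert_of_pos (Q := Q) (g := g) (v := v) (k := 0)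
    (by rw [h1]; decide)
  obtain ⟨-, z, -, -, hz⟩ := h.nbr_of_alpha_beta_sq h1
  have hm := vtx_vert_mem (Q := Q) (g := g) i 3
  have h2 := vertexType_pos hz
  have h3 := vertexType_pos (rfl : vert Q g i 3 = _)
  rcases h.classify_alpha hm h2 with h4 | ⟨h4, h5, h6, h7⟩
  · omega
  · rw [h4, h5] at hm
    obtain ⟨x, hx⟩ := h6
    exact ⟨_, _, hm, h2, by omega, ⟨x, hx⟩⟩

/-- This is immediate from a vertex α^k δ^n with k, n ≥ 2. The work is to handle a vertex αδ^n, by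
finding another vertex with two α. -/
theorem alpha_add_delta_le : Q.angle 0 + Q.angle 3 ≤ π := by
  obtain ⟨k, n, hm, hk, hn, hn'⟩ := h.exists_alpha_delta
  have p0 := Q.angle_pos 0
  have p3 := Q.angle_pos 3
  have le := angle_sum_le_of_mem h.tiling hm
  by_cases hk2 : 2 ≤ k
  · have := le 2 0 0 2 hk2 le_rfl le_rfl hn
    push_cast at this; linarith
  obtain rfl : k = 1 := by omega
  have hn4 : 4 ≤ n := by
    rcases h.classify_alpha hm le_rfl with h1 | ⟨-, -, -, h1⟩
    · omega
    · obtain ⟨x, hx⟩ := hn'; omega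
  obtain ⟨v, -, hv⟩ := exists_of_mem_avc hm
  have hv0 : vertexType Q g v 0 = 1 := by rw [hv]; rfl
  have hb : ∀ j, vert Q g j 1 ≠ v := fun j hc => by
    have := vertexType_pos hc
    rw [hv] at this
    exact absurd this (by change ¬(0 < 0); omega)
  obtain ⟨x, hx⟩ := exists_vert_of_pos (Q := Q) (g := g) (v := v) (k := 0) (by omega)
  -- If no two α met, each δ of αδ^n would be glued along DA to the single α-tile there. That tile
  -- has only two a-sides, but n ≥ 4.
  have key : ∃ i j, i ≠ j ∧ vert Q g j 0 = vert Q g i 0 := by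
    by_contra! hc
    have hnbr : ∀ i, vert Q g i 3 = v → Adj Q g x 0 i 3 ∨ Adj Q g x 3 i 3 := by
      intro i hi
      obtain ⟨j, hj, h1 | h1 | h1 | h1⟩ := exists_nbr_three h.isA2BC h.tiling i
      · exact absurd h1.2.1 (hc i j hj)
      · exact absurd h1.2.1 (hc i j hj)
      · obtain rfl := eq_of_vertexType_eq_one hv0.le hx (h1.2.2.trans hi)
        exact Or.inl h1.1.symm
      · obtain rfl := eq_of_vertexType_eq_one hv0.le hx (h1.2.2.trans hi)
        exact Or.inr h1.1.symm
    obtain ⟨a, b, c, ha, hb, hc, h1, h2, h3⟩ := exists_three_of_le (Q := Q) (g := g) (v := v)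
      (k := 3) (by rw [hv]; change 3 ≤ n; omega)
    rcases hnbr a ha with u | u <;> rcases hnbr b hb with u' | u' <;>
      rcases hnbr c hc with u'' | u'' <;>
      first
      | exact h1 (u.unique h.tiling u').1
      | exact h2 (u.unique h.tiling u'').1
      | exact h3 (u'.unique h.tiling u'').1
  obtain ⟨i, j, hij, hj⟩ := key
  have h2 := vertexType_ge_two (Q := Q) (g := g) (k := 0) rfl hj hij
  have hm' := vtx_vert_mem (Q := Q) (g := g) i 0
  have le' := angle_sum_le_of_mem h.tiling hm'
  rcases h.classify_alpha hm' (by omega) with h4 | ⟨h4, h5, ⟨y, h6⟩, h7⟩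
  · omega
  -- For a pure power of α the bound follows from 4α ≤ 2π together with α + 4δ ≤ 2π.
  · by_cases hy : y = 0
    · have a1 := le' 4 0 0 0 (by omega) (by omega) (by omega) (by omega)
      have a2 := le 1 0 0 4 (by omega) (by omega) (by omega) (by omega)
      push_cast at a1 a2
      linarith [pi_pos]
    · have a1 := le' 2 0 0 2 (by omega) (by omega) (by omega) (by omega)
      push_cast at a1
      linarith

theorem beta_add_gamma_ge : π + 4 * π / f ≤ Q.angle 1 + Q.angle 2 := by
  linarith [h.alpha_add_delta_le, h.gamma_delta, h.alpha_beta]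

/-- The vertex with α and δ has more δ than γ, so some vertex has more γ than δ. Parity and β + γ >
π, in the forms 2β + 2γ, β + 3γ + δ and 4γ + 2δ > 2π, leave only powers of γ. -/
theorem exists_gamma_pow : ∃ m, vtx 0 0 m 0 ∈ avc Q g ∧ Even m ∧ 4 ≤ m := by
  obtain ⟨k₀, n₀, hm₀, hk₀, hn₀, -⟩ := h.exists_alpha_delta
  obtain ⟨k, l, m, n, hm, hp⟩ := exists_pos_of_balance (a := 0) (b := 0) (c := 1) (d := -1)
    (by norm_num) hm₀ (by push_cast; omega)
  have e := h.four_pi_div_pos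
  have h1 := h.alpha_beta
  have h2 := h.gamma_delta
  have h3 := h.beta_add_gamma_ge
  have p2 := Q.angle_pos 2
  have p3 := Q.angle_pos 3
  obtain ⟨x, hx⟩ := h.even_beta_gamma hm
  obtain ⟨y, hy⟩ := h.even_gamma_delta hm
  have le := angle_sum_le_of_mem h.tiling hm
  have h4 := three_le_of_mem h.tiling hm
  obtain rfl : k = 0 := by
    by_contra hc
    rcases h.classify_alpha hm (by omega) with h4 | ⟨h4, h5, -⟩ <;> omega
  obtain rfl : l = 0 := by
    by_contra hc
    by_cases hl : l = 1
    · have := le 0 1 3 1 (by omega) (by omega) (by omega) (by omega)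
      push_cast at this; linarith
    · have := le 0 2 2 0 (by omega) (by omega) (by omega) (by omega)
      push_cast at this; linarith
  obtain rfl : n = 0 := by
    by_contra hc
    have := le 0 0 4 2 (by omega) (by omega) (by omega) (by omega)
    push_cast at this; linarith
  exact ⟨m, hm, ⟨x, by omega⟩, by omega⟩

theorem gamma_le : Q.angle 2 ≤ π / 2 := by
  obtain ⟨m, hm, -, h4⟩ := h.exists_gamma_pow
  have := angle_sum_le_of_mem h.tiling hm 0 0 4 0 le_rfl le_rfl h4 le_rfl
  push_cast at this; linarith

/-- The vertices without angle `α`. -/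
theorem classify_zero {l m n : ℕ} (hm : vtx 0 l m n ∈ avc Q g) :
    (l = 1 ∧ m = 1 ∧ Odd n ∧ 3 ≤ n) ∨ (l = 2 ∧ m = 0 ∧ Even n ∧ 2 ≤ n) ∨
      (l = 0 ∧ m = 2 ∧ Even n ∧ 4 ≤ n) ∨ (l = 0 ∧ n = 0 ∧ Even m ∧ 4 ≤ m) ∨
      (l = 0 ∧ m = 0 ∧ Even n ∧ 4 ≤ n) := by
  have e := h.four_pi_div_pos
  have h2 := h.gamma_delta
  have h3 := h.beta_add_gamma_ge
  have h5 := h.gamma_le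
  have p2 := Q.angle_pos 2
  have p3 := Q.angle_pos 3
  obtain ⟨x, hx⟩ := h.even_beta_gamma hm
  obtain ⟨y, hy⟩ := h.even_gamma_delta hm
  have le := angle_sum_le_of_mem h.tiling hm
  have h4 := three_le_of_mem h.tiling hm
  have b1 : ¬(3 ≤ l ∧ 1 ≤ m ∧ 1 ≤ n) := fun hc => by
    have := le 0 3 1 1 (by omega) (by omega) (by omega) (by omega)
    push_cast at this; linarith
  have b2 : ¬(1 ≤ l ∧ 3 ≤ m ∧ 1 ≤ n) := fun hc => by
    have := le 0 1 3 1 (by omega) (by omega) (by omega) (by omega)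
    push_cast at this; linarith
  have b3 : ¬(4 ≤ l) := fun hc => by
    have := le 0 4 0 0 (by omega) (by omega) (by omega) (by omega)
    push_cast at this; linarith
  have b4 : ¬(2 ≤ l ∧ 2 ≤ m) := fun hc => by
    have := le 0 2 2 0 (by omega) (by omega) (by omega) (by omega)
    push_cast at this; linarith
  have b5 : ¬(4 ≤ m ∧ 2 ≤ n) := fun hc => by
    have := le 0 0 4 2 (by omega) (by omega) (by omega) (by omega)
    push_cast at this; linarith
  have b6 : l + m + n ≠ 3 := fun hc => by
    have := h.eq_of_degree hm (by omega)
    omega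
  refine arith_classify_zero ⟨x, hx⟩ ⟨y, hy⟩ h4 b1 b2 b3 b4 b5 b6 ?_
  rintro ⟨rfl, rfl, rfl⟩
  exact h.not_mem hm

end IsAB2Tiling
end Tiling

/-! ### Excluding γ^m with m ≥ 6 -/

section Tiling
variable {Q : QuadTile} {f : ℕ} {g : Fin f → E3 ≃ₗᵢ[ℝ] E3}

namespace IsAB2Tiling
variable (h : IsAB2Tiling Q g)
include h

/-- If there is a vertex `γ^m` with `m ≥ 6`, then `m = 6` and only five vertices are possible. -/
theorem vertices_of_six_le {m : ℕ} (hm : vtx 0 0 m 0 ∈ avc Q g) (h6 : 6 ≤ m) :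
    vtx 0 0 6 0 ∈ avc Q g ∧ ∀ k l m n, vtx k l m n ∈ avc Q g →
      (k = 1 ∧ l = 2 ∧ m = 0 ∧ n = 0) ∨ (k = 2 ∧ l = 0 ∧ m = 0 ∧ n = 2) ∨
      (k = 4 ∧ l = 0 ∧ m = 0 ∧ n = 0) ∨ (k = 0 ∧ l = 0 ∧ m = 6 ∧ n = 0) ∨
      (k = 0 ∧ l = 0 ∧ m = 0 ∧ n = 4) := by
  have e := h.four_pi_div_pos
  set ε := 4 * π / f with hε
  have h1 := h.alpha_beta
  have h2 := h.gamma_delta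
  have h3 := h.beta_add_gamma_ge
  rw [← hε] at h2 h3
  have p0 := Q.angle_pos 0
  have p2 := Q.angle_pos 2
  have p3 := Q.angle_pos 3
  have hγ : 6 * Q.angle 2 ≤ 2 * π := by
    have := angle_sum_le_of_mem h.tiling hm 0 0 6 0 le_rfl le_rfl h6 le_rfl
    push_cast at this; linarith
  -- γ ≤ π/3 makes β and δ large. Already α + 4δ exceeds 2π.
  have hlt : ∀ k n : ℕ, vtx k 0 0 n ∈ avc Q g → 1 ≤ k → n < 2 * k := by
    intro k n hv hk
    by_contra! hc
    have le := angle_sum_le_of_mem h.tiling hv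
    rcases h.classify_alpha hv hk with h4 | ⟨-, -, ⟨x, hx⟩, h4⟩
    · omega
    · by_cases hk2 : 2 ≤ k
      · have := le 2 0 0 4 hk2 le_rfl le_rfl (by omega)
        push_cast at this; linarith
      · have := le 1 0 0 4 hk le_rfl le_rfl (by omega)
        push_cast at this; linarith
  have hzero : ∀ l m n : ℕ, vtx 0 l m n ∈ avc Q g →
      (l = 0 ∧ n = 0) ∨ (l = 0 ∧ m = 0 ∧ Even n ∧ 4 ≤ n) := by
    intro l m n hv
    have le := angle_sum_le_of_mem h.tiling hv
    rcases h.classify_zero hv with ⟨rfl, rfl, -, hn⟩ | ⟨rfl, rfl, -, hn⟩ | ⟨rfl, rfl, -, hn⟩ | hc | hc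
    · have := le 0 1 1 3 le_rfl le_rfl le_rfl hn
      push_cast at this; linarith
    · have := le 0 2 0 2 le_rfl le_rfl le_rfl hn
      push_cast at this; linarith
    · have := le 0 0 2 4 le_rfl le_rfl le_rfl hn
      push_cast at this; linarith
    · exact Or.inl ⟨hc.1, hc.2.1⟩
    · exact Or.inr hc
  obtain ⟨k₀, n₀, hw, hk₀, hn₀, -⟩ := h.exists_alpha_delta
  have hlt₀ := hlt _ _ hw hk₀
  -- The weights vanish on αβ² and γ^m and are negative on every α^k δ^n by `hlt`. The vertex with
  -- positive weight is therefore δ^n, and 6δ > 2π leaves n = 4.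
  have hδ : 4 * Q.angle 3 = 2 * π := by
    obtain ⟨k, l, m', n, hv, hp⟩ := exists_pos_of_balance (a := -2) (b := 1) (c := 0) (d := 1)
      (by norm_num) hw (by push_cast; omega)
    obtain rfl : k = 0 := by
      by_contra hc
      rcases h.classify_alpha hv (by omega) with h4 | ⟨rfl, rfl, -⟩
      · omega
      · have := hlt _ _ hv (by omega)
        omega
    rcases hzero _ _ _ hv with ⟨rfl, rfl⟩ | ⟨rfl, rfl, ⟨x, hx⟩, hn⟩
    · exact absurd hp (by simp)
    · obtain rfl : n = 4 := by
        by_contra hc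
        have := angle_sum_le_of_mem h.tiling hv 0 0 0 6 le_rfl le_rfl le_rfl (by omega)
        push_cast at this; linarith
      have := angle_sum_of_mem h.tiling hv
      push_cast at this; linarith
  -- Eight angles γ would give γ ≤ π/4 and then δ > π/2.
  have hγ' : 6 * Q.angle 2 = 2 * π ∧ vtx 0 0 6 0 ∈ avc Q g := by
    obtain ⟨x, hx⟩ := h.even_gamma_delta hm
    obtain rfl : m = 6 := by
      by_contra hc
      have := angle_sum_le_of_mem h.tiling hm 0 0 8 0 le_rfl le_rfl (by omega) le_rfl
      push_cast at this; linarith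
    have := angle_sum_of_mem h.tiling hm
    push_cast at this
    exact ⟨by linarith, hm⟩
  -- The known vertex with α and δ has n₀ = 2, as α + 4δ > 2π. Then k₀ ≥ 2 by `hlt`, and 3α + 2δ >
  -- 2π gives k₀ = 2.
  have hα : 4 * Q.angle 0 = 2 * π := by
    obtain rfl : n₀ = 2 := by
      rcases h.classify_alpha hw hk₀ with h4 | ⟨-, -, ⟨x, hx⟩, h4⟩
      · omega
      · by_contra hc
        have := angle_sum_le_of_mem h.tiling hw 1 0 0 4 hk₀ le_rfl le_rfl (by omega)
        push_cast at this; linarith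
    obtain rfl : k₀ = 2 := by
      by_contra hc
      have := angle_sum_le_of_mem h.tiling hw 3 0 0 2 (by omega) le_rfl le_rfl le_rfl
      push_cast at this; linarith
    have := angle_sum_of_mem h.tiling hw
    push_cast at this; linarith
  refine ⟨hγ'.2, fun k l m n hv => ?_⟩
  have hs := angle_sum_of_mem h.tiling hv
  have a0 : Q.angle 0 = π / 2 := by linarith
  have a2 : Q.angle 2 = π / 3 := by linarith
  have a3 : Q.angle 3 = π / 2 := by linarith
  by_cases hk : k = 0
  · subst hk
    rcases hzero _ _ _ hv with ⟨rfl, rfl⟩ | ⟨rfl, rfl, -, -⟩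
    · have : (m : ℝ) = 6 := by
        rw [a2] at hs; push_cast at hs
        have : ((m : ℝ) - 6) * π = 0 := by linarith
        rcases mul_eq_zero.1 this with h5 | h5
        · linarith
        · exact absurd h5 pi_ne_zero
      have : m = 6 := by exact_mod_cast this
      omega
    · have : (n : ℝ) = 4 := by
        rw [a3] at hs; push_cast at hs
        have : ((n : ℝ) - 4) * π = 0 := by linarith
        rcases mul_eq_zero.1 this with h5 | h5
        · linarith
        · exact absurd h5 pi_ne_zero
      have : n = 4 := by exact_mod_cast this
      omega
  · rcases h.classify_alpha hv (by omega) with h4 | ⟨rfl, rfl, ⟨x, hx⟩, h4⟩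
    · exact Or.inl h4
    · have := hlt _ _ hv (by omega)
      have : (k : ℝ) + n = 4 := by
        rw [a0, a3] at hs; push_cast at hs
        have : ((k : ℝ) + n - 4) * π = 0 := by linarith
        rcases mul_eq_zero.1 this with h5 | h5
        · linarith
        · exact absurd h5 pi_ne_zero
      have : k + n = 4 := by exact_mod_cast this
      omega

end IsAB2Tiling

/-- The only vertices are `αβ²`, `α²δ²`, `α⁴`, `γ⁶`, `δ⁴`. -/
def HasHexVertices (Q : QuadTile) (g : Fin f → E3 ≃ₗᵢ[ℝ] E3) : Prop :=
  ∀ k l m n, vtx k l m n ∈ avc Q g →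
      (k = 1 ∧ l = 2 ∧ m = 0 ∧ n = 0) ∨ (k = 2 ∧ l = 0 ∧ m = 0 ∧ n = 2) ∨
      (k = 4 ∧ l = 0 ∧ m = 0 ∧ n = 0) ∨ (k = 0 ∧ l = 0 ∧ m = 6 ∧ n = 0) ∨
      (k = 0 ∧ l = 0 ∧ m = 0 ∧ n = 4)

namespace HasHexVertices

theorem of_beta (hH : HasHexVertices Q g) {v : S2} {i : Fin f} (hi : vert Q g i 1 = v) :
    vertexType Q g v = vtx 1 2 0 0 := by
  have h1 := vertexType_pos hi
  subst hi
  rw [eq_vtx (vertexType Q g _), vtx_inj]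
  have := hH _ _ _ _ (vtx_vert_mem i 1)
  omega

theorem of_alpha_delta (hH : HasHexVertices Q g) {v : S2} {i j : Fin f}
    (hi : vert Q g i 0 = v) (hj : vert Q g j 3 = v) : vertexType Q g v = vtx 2 0 0 2 := by
  have h1 := vertexType_pos hi
  have h2 := vertexType_pos hj
  subst hi
  rw [eq_vtx (vertexType Q g _), vtx_inj]
  have := hH _ _ _ _ (vtx_vert_mem i 0)
  omega

/-- Of two tiles that share their `b`-edge, exactly one has its angle `α` at a vertex `αβ²`. -/
theorem b_neighbours (hH : HasHexVertices Q g) (h : IsAB2Tiling Q g) {i j : Fin f} (hij : i ≠ j)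
    (hv : vert Q g j 1 = vert Q g i 1) :
    vertexType Q g (vert Q g i 0) = vtx 1 2 0 0 ↔ ¬vertexType Q g (vert Q g j 0) = vtx 1 2 0 0 := by
  have hw := hH.of_beta (rfl : vert Q g i 1 = _)
  obtain ⟨x, hx⟩ := exists_vert_of_pos (Q := Q) (g := g) (v := vert Q g i 1) (k := 0)
    (by rw [hw]; decide)
  -- The two β-tiles y and z lie across AB and DA of the α-tile x. The α of y meets the β of x, and
  -- the α of z meets the δ of x, so only the former is at a vertex αβ².
  obtain ⟨⟨y, -, hy, hy'⟩, z, -, hz, hz'⟩ := h.nbr_of_alpha_beta_sq (i := x) (by rw [hx, hw])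
  have Iy : vertexType Q g (vert Q g y 0) = vtx 1 2 0 0 := by
    rw [hy']; exact hH.of_beta rfl
  have Iz : ¬vertexType Q g (vert Q g z 0) = vtx 1 2 0 0 := by
    intro hc
    have := vertexType_pos (rfl : vert Q g x 3 = _)
    rw [← hz', hc] at this
    exact absurd this (by decide)
  have hyz : y ≠ z := by rintro rfl; exact Iz Iy
  have key : ∀ t, vert Q g t 1 = vert Q g i 1 → t = i ∨ t = j := by
    intro t ht
    by_contra! hc
    have := vertexType_ge_three (Q := Q) (g := g) (k := 1) rfl hv ht hij hc.1.symm hc.2.symm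
    rw [hw] at this
    exact absurd this (by decide)
  rcases key y (hy.trans hx) with rfl | rfl <;> rcases key z (hz.trans hx) with rfl | rfl
  · exact absurd rfl hyz
  · exact iff_of_true Iy Iz
  · exact iff_of_false Iz (not_not.2 Iy)
  · exact absurd rfl hyz

/-- Of two tiles that share their `c`-edge, both or none have their angle `α` at a vertex
`αβ²`. -/
theorem c_neighbours (hH : HasHexVertices Q g) (h : IsAB2Tiling Q g) {i j : Fin f}
    (hij : Adj Q g i 2 j 2) (hv : vert Q g j 3 = vert Q g i 3)
    (hi : vertexType Q g (vert Q g i 0) = vtx 1 2 0 0) :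
    vertexType Q g (vert Q g j 0) = vtx 1 2 0 0 := by
  have hT := h.tiling
  obtain ⟨-, z, hz1, hz2, hz3⟩ := h.nbr_of_alpha_beta_sq hi
  have hd := hH.of_alpha_delta hz3 rfl
  have hnb : ∀ t, vert Q g t 1 ≠ vert Q g i 3 := by
    intro t ht
    have := vertexType_pos ht
    rw [hd] at this
    exact absurd this (by decide)
  have hδ : ∀ t, vert Q g t 3 = vert Q g i 3 → t = i ∨ t = j := by
    intro t ht
    by_contra! hc
    have := vertexType_ge_three (Q := Q) (g := g) (k := 3) rfl hv ht hij.1 hc.1.symm hc.2.symm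
    rw [hd] at this
    exact absurd this (by decide)
  -- Here D is a vertex α²δ² whose two δ belong to i and j. In the tile y across DA of j, a β at D
  -- is impossible, and a δ at D would make y = i, whose side DA is already glued to an AB. The
  -- third alternative is the claim.
  obtain ⟨y, hjy, ⟨hy1, hy2, hy3⟩ | ⟨hy1, hy2, hy3⟩ | ⟨hy1, hy2, hy3⟩ | ⟨hy1, hy2, hy3⟩⟩ :=
    exists_nbr_three h.isA2BC hT j
  · exact absurd (hy3.trans hv) (hnb y)
  · rcases hδ y (hy3.trans hv) with rfl | rfl
    · exact absurd (hz1.unique hT hy1.symm).2 (by decide)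
    · exact absurd rfl hjy
  · exact hH.of_beta hy2
  · exfalso
    rw [hv] at hy3
    by_cases hyz : y = z
    -- The tiles i, j and y alone would close up the vertex, which then has a single α.
    · subst hyz
      have hcl : ∀ t c, vert Q g t c = vert Q g i 3 → t ∈ ({i, j, y} : Set (Fin f)) := by
        intro t c ht
        refine mem_of_closed hT ⟨i, by simp, 3, rfl⟩ ?_ ht
        rintro t (rfl | rfl | rfl) c hc b
        · obtain rfl := vert_injective _ hc
          cases b
          · exact ⟨j, by simp, 2, hij⟩
          · exact ⟨y, by simp, 0, hz1⟩
        · obtain rfl := vert_injective _ (hc.trans hv.symm)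
          cases b
          · exact ⟨i, by simp, 2, hij.symm⟩
          · exact ⟨_, by simp, 3, hy1⟩
        · obtain rfl := vert_injective _ (hc.trans hy3.symm)
          cases b
          · exact ⟨j, by simp, 3, hy1.symm⟩
          · exact ⟨i, by simp, 3, hz1.symm⟩
      have h2 : vertexType Q g (vert Q g i 3) 0 ≤ 1 := by
        rw [vertexType_eq_card, Finset.card_le_one]
        have : ∀ t, vert Q g t 0 = vert Q g i 3 → t = y := by
          intro t ht
          rcases hcl t 0 ht with rfl | rfl | rfl
          · exact absurd (vert_injective _ ht) (by decide)
          · exact absurd (vert_injective _ (ht.trans hv.symm)) (by decide)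
          · rfl
        intro s hs t ht
        rw [this s (by simpa using hs), this t (by simpa using ht)]
      rw [hd] at h2
      exact absurd h2 (by decide)
    · have hα : ∀ t, vert Q g t 0 = vert Q g i 3 → t = y ∨ t = z := by
        intro t ht
        by_contra! hc
        have := vertexType_ge_three (Q := Q) (g := g) (k := 0) hy3 hz3 ht hyz hc.1.symm hc.2.symm
        rw [hd] at this
        exact absurd this (by decide)
      -- Now y and z hold the two α. Any tile x across DA of z puts a β next to an α or δ where none
      -- can be, or glues some side to two different sides.
      obtain ⟨x, hzx, ⟨h1, h2, h3⟩ | ⟨h1, h2, h3⟩ | ⟨h1, h2, h3⟩ | ⟨h1, h2, h3⟩⟩ :=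
        exists_nbr_three h.isA2BC hT z
      · have h4 := hH.of_beta h3
        have := vertexType_pos (rfl : vert Q g z 3 = _)
        rw [h4] at this
        exact absurd this (by decide)
      · rcases hα x (h2.trans hz3) with rfl | rfl
        · obtain ⟨rfl, -⟩ := h1.symm.unique hT hy1.symm
          exact absurd (vert_injective _ (hv.trans hz3.symm)) (by decide)
        · exact hzx rfl
      · exact hnb x (h2.trans hz3)
      · rcases hδ x (h2.trans hz3) with rfl | rfl
        · exact absurd (hz1.unique hT h1.symm).2 (by decide)
        · exact hyz (hy1.unique hT h1.symm).1

/-- Colour the six tiles at γ⁶ by whether their own α sits at a vertex αβ². Pairing across b-sides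
gives three of each colour, pairing across c-sides gives an even number of each. -/
theorem not_mem (hH : HasHexVertices Q g) (h : IsAB2Tiling Q g) : vtx 0 0 6 0 ∉ avc Q g := by
  classical
  intro hm
  obtain ⟨v, -, hv⟩ := exists_of_mem_avc hm
  have hT := h.tiling
  have hcard : (Finset.univ.filter fun i : Fin f => vert Q g i 2 = v).card = 6 := by
    rw [← vertexType_eq_card, hv]; rfl
  set S := Finset.univ.filter fun i : Fin f => vert Q g i 2 = v with hS
  have hmem : ∀ i, i ∈ S ↔ vert Q g i 2 = v := fun i => by simp [hS]
  let I : Fin f → Prop := fun i => vertexType Q g (vert Q g i 0) = vtx 1 2 0 0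
  have hb : ∀ i ∈ S, ∃ j ∈ S, Adj Q g i 1 j 1 ∧ (I i ↔ ¬I j) := by
    intro i hi
    rw [hmem] at hi
    obtain ⟨j, hj, h1, ⟨h2, h3⟩ | ⟨h2, h3⟩⟩ := exists_nbr_bc h.isA2BC hT i (k := 1) (Or.inl rfl)
    · exact ⟨j, (hmem j).2 (h3.trans hi), h1, hH.b_neighbours h hj h2⟩
    · have := hH.of_beta (h2.trans hi)
      rw [hv] at this
      exact absurd (congrFun this 0) (by decide)
  have hc : ∀ i ∈ S, ∃ j ∈ S, Adj Q g i 2 j 2 ∧ (I i → I j) := by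
    intro i hi
    rw [hmem] at hi
    obtain ⟨j, hj, h1, ⟨h2, h3⟩ | ⟨h2, h3⟩⟩ := exists_nbr_bc h.isA2BC hT i (k := 2) (Or.inr rfl)
    · exact ⟨j, (hmem j).2 (h2.trans hi), h1, hH.c_neighbours h h1 h3⟩
    · have := vertexType_pos (h3.trans hi)
      rw [hv] at this
      exact absurd this (by decide)
  have heven : Even (S.filter I).card := by
    refine even_card_of_pairing (fun i j => Adj Q g i 2 j 2) ?_ ?_ (fun i j h => h.symm)
      (fun i h => h.1 rfl)
    · intro i hi
      obtain ⟨h1, h2⟩ := Finset.mem_filter.1 hi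
      obtain ⟨j, hj, h3, h4⟩ := hc i h1
      exact ⟨j, Finset.mem_filter.2 ⟨hj, h4 h2⟩, h3⟩
    · exact fun i _ j _ j' _ h h' => (h.unique hT h').1
  have hsub : ∀ (T : Finset (Fin f)) (j : Fin f),
      ({i ∈ (T : Set (Fin f)) | Adj Q g i 1 j 1}).Subsingleton :=
    fun T j i hi i' hi' => (hi.2.symm.unique hT hi'.2.symm).1
  have h1 : (S.filter I).card ≤ (S.filter fun i => ¬I i).card := by
    refine Finset.card_le_card_of_forall_subsingleton (fun i j => Adj Q g i 1 j 1) ?_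
      fun j _ => hsub _ j
    intro i hi
    obtain ⟨h1, h2⟩ := Finset.mem_filter.1 hi
    obtain ⟨j, hj, h3, h4⟩ := hb i h1
    exact ⟨j, Finset.mem_filter.2 ⟨hj, h4.1 h2⟩, h3⟩
  have h2 : (S.filter fun i => ¬I i).card ≤ (S.filter I).card := by
    refine Finset.card_le_card_of_forall_subsingleton (fun i j => Adj Q g i 1 j 1) ?_
      fun j _ => hsub _ j
    intro i hi
    obtain ⟨h1, h2⟩ := Finset.mem_filter.1 hi
    obtain ⟨j, hj, h3, h4⟩ := hb i h1
    exact ⟨j, Finset.mem_filter.2 ⟨hj, not_not.1 fun hc => h2 (h4.2 hc)⟩, h3⟩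
  have h3 := Finset.card_filter_add_card_filter_not (s := S) I
  obtain ⟨r, hr⟩ := heven
  omega

end HasHexVertices

namespace IsAB2Tiling

theorem gamma_pow_four (h : IsAB2Tiling Q g) : vtx 0 0 4 0 ∈ avc Q g := by
  obtain ⟨m, hm, ⟨x, hx⟩, h4⟩ := h.exists_gamma_pow
  by_cases h6 : 6 ≤ m
  · obtain ⟨h1, h2⟩ := h.vertices_of_six_le hm h6
    exact absurd h1 (HasHexVertices.not_mem h2 h)
  · obtain rfl : m = 4 := by omega
    exact hm

theorem gamma_eq (h : IsAB2Tiling Q g) : Q.angle 2 = π / 2 := by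
  have := angle_sum_of_mem h.tiling h.gamma_pow_four
  push_cast at this
  linarith

end IsAB2Tiling
end Tiling

/-! ### The four angles and the final list of vertices -/

section Tiling
variable {Q : QuadTile} {f : ℕ} {g : Fin f → E3 ≃ₗᵢ[ℝ] E3}

namespace IsAB2Tiling
variable (h : IsAB2Tiling Q g)
include h

theorem delta_eq : Q.angle 3 = π / 2 - Q.angle 0 / 2 + 4 * π / f := by
  linarith [h.alpha_beta, h.gamma_delta, h.gamma_eq]

/-- If two angles `α` at a vertex share an `a`-edge from that vertex, then `α > π / 2`. -/
theorem alpha_ge_of_adj {x y : Fin f} {l : Fin 4} (hxy : Adj Q g x 0 y l)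
    (h0 : vert Q g y 0 = vert Q g x 0)
    (h1 : l = 0 ∧ vert Q g y 1 = vert Q g x 1 ∨ vert Q g y 3 = vert Q g x 1) :
    π / 2 + 4 * π / f ≤ Q.angle 0 := by
  have e := h.four_pi_div_pos
  have hα := h.alpha_beta
  have hγ := h.gamma_eq
  have hδ := h.delta_eq
  have hm := vtx_vert_mem (Q := Q) (g := g) x 1
  have hβ := vertexType_pos (rfl : vert Q g x 1 = _)
  -- An α at this end would make the vertex αβ². It has no δ, and one of its β-tiles has its side AB
  -- glued to the α-tile, whereas here the two β-tiles are glued along AB to each other.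
  have hk : vertexType Q g (vert Q g x 1) 0 = 0 := by
    by_contra hc
    rcases h.classify_alpha hm (by omega) with h2 | ⟨h2, -⟩
    · have ht : vertexType Q g (vert Q g x 1) = vtx 1 2 0 0 := by
        rw [eq_vtx (vertexType Q g _), vtx_inj]; exact h2
      rcases h1 with ⟨rfl, h1⟩ | h1
      · obtain ⟨z, hz⟩ := exists_vert_of_pos (Q := Q) (g := g) (k := 0) (Nat.pos_of_ne_zero hc)
        obtain ⟨⟨w, hw, hw', -⟩, -⟩ := h.nbr_of_alpha_beta_sq (i := z) (by rw [hz, ht])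
        rw [hz] at hw'
        by_cases hwx : w = x
        · subst hwx
          obtain ⟨rfl, -⟩ := hw.symm.unique h.tiling hxy
          exact absurd (vert_injective _ (hz.trans h1.symm)) (by decide)
        · by_cases hwy : w = y
          · subst hwy
            obtain ⟨rfl, -⟩ := hw.symm.unique h.tiling hxy.symm
            exact absurd (vert_injective _ hz) (by decide)
          · have := vertexType_ge_three (Q := Q) (g := g) rfl h1 hw' hxy.1 (Ne.symm hwx)
              (Ne.symm hwy)
            omega
      · have := vertexType_pos h1
        omega
    · omega
  rw [hk] at hm
  have le := angle_sum_le_of_mem h.tiling hm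
  -- Either β + γ + 3δ ≤ 2π or 2β + 2δ ≤ 2π, and with γ = π/2 each bounds α from below.
  rcases h.classify_zero hm with ⟨-, h2, -, hn⟩ | ⟨h2, -, -, hn⟩ | hc | hc | hc
  · have := le 0 1 1 3 le_rfl hβ h2.ge hn
    push_cast at this; linarith
  · have := le 0 2 0 2 le_rfl h2.ge (by omega) hn
    push_cast at this; linarith
  · omega
  · omega
  · omega

/-- Three α leave room for at most two δ. Then not every α can have its own δ across AB, so two α
are adjacent and `alpha_ge_of_adj` makes α too large. -/
theorem alpha_count_le {k n : ℕ} (hm : vtx k 0 0 n ∈ avc Q g) : k ≤ 2 := by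
  by_contra! hk
  have e := h.four_pi_div_pos
  have hδ := h.delta_eq
  have le := angle_sum_le_of_mem h.tiling hm
  have hn : n ≤ 2 := by
    by_contra hc
    rcases h.classify_alpha hm (by omega) with h4 | ⟨-, -, ⟨x, hx⟩, -⟩
    · omega
    · have := le 3 0 0 4 hk le_rfl le_rfl (by omega)
      push_cast at this
      linarith [Q.angle_pos 0]
  obtain ⟨v, -, hv⟩ := exists_of_mem_avc hm
  have hα : π / 2 + 4 * π / f ≤ Q.angle 0 := by
    by_contra hα
    have hnbr : ∀ x, vert Q g x 0 = v → ∃ j, Adj Q g x 0 j 3 ∧ vert Q g j 3 = v := by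
      intro x hx
      obtain ⟨j, hj, ⟨h1, h2, h3⟩ | ⟨h1, h2, h3⟩ | ⟨h1, h2, h3⟩ | ⟨h1, h2, h3⟩⟩ :=
        exists_nbr_zero h.isA2BC h.tiling x
      · exact absurd (h.alpha_ge_of_adj h1 h2 (Or.inl ⟨rfl, h3⟩)) hα
      · exact absurd (h.alpha_ge_of_adj h1 h2 (Or.inr h3)) hα
      · have := vertexType_pos (h2.trans hx)
        rw [hv] at this
        exact absurd this (lt_irrefl 0)
      · exact ⟨j, h1, h2.trans hx⟩
    obtain ⟨a, b, c, ha, hb, hc, hab, hac, hbc⟩ := exists_three_of_le (Q := Q) (g := g) (v := v)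
      (k := 0) (by rw [hv]; exact hk)
    obtain ⟨a', ha', ha⟩ := hnbr a ha
    obtain ⟨b', hb', hb⟩ := hnbr b hb
    obtain ⟨c', hc', hc⟩ := hnbr c hc
    have := vertexType_ge_three ha hb hc
      (by rintro rfl; exact hab (ha'.symm.unique h.tiling hb'.symm).1)
      (by rintro rfl; exact hac (ha'.symm.unique h.tiling hc'.symm).1)
      (by rintro rfl; exact hbc (hb'.symm.unique h.tiling hc'.symm).1)
    rw [hv] at this
    change 3 ≤ n at this
    omega
  by_cases hk4 : 4 ≤ k
  · have := le 4 0 0 0 hk4 le_rfl le_rfl (by omega)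
    push_cast at this; linarith
  · rcases h.classify_alpha hm (by omega) with h4 | ⟨-, -, ⟨x, hx⟩, h4⟩
    · omega
    · have := le 3 0 0 2 (by omega) le_rfl le_rfl (by omega)
      push_cast at this; linarith

/-- The weights have negative sum, so some vertex is negative. They vanish on αβ² and are
nonnegative on αδ^n, where n ≥ 4. This leaves α²δ^n, and 2α + 4δ > 2π gives n = 2. -/
theorem alpha_sq_delta_sq : vtx 2 0 0 2 ∈ avc Q g := by
  obtain ⟨k, l, m, n, hm, hn⟩ := exists_neg_of_balance (Q := Q) (g := g) h.pos (a := -4) (b := 2)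
    (c := 0) (d := 1) (by norm_num)
  have hk : k ≠ 0 := by rintro rfl; push_cast at hn; omega
  rcases h.classify_alpha hm (by omega) with h4 | ⟨rfl, rfl, ⟨x, hx⟩, h4⟩
  · omega
  · have hk2 := h.alpha_count_le hm
    obtain rfl : k = 2 := by omega
    obtain rfl : n = 2 := by
      by_contra hc
      have := angle_sum_le_of_mem h.tiling hm 2 0 0 4 le_rfl le_rfl le_rfl (by omega)
      push_cast at this
      linarith [h.delta_eq, h.four_pi_div_pos]
    exact hm

theorem alpha_eq : Q.angle 0 = π - 8 * π / f := by
  have := angle_sum_of_mem h.tiling h.alpha_sq_delta_sq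
  push_cast at this
  have e : 8 * π / f = 2 * (4 * π / f) := by ring
  rw [e]
  linarith [h.delta_eq]

theorem beta_eq : Q.angle 1 = π / 2 + 4 * π / f := by
  have e : 8 * π / f = 2 * (4 * π / f) := by ring
  linarith [h.alpha_eq, h.alpha_beta]

theorem delta_eq' : Q.angle 3 = 8 * π / f := by
  have e : 8 * π / f = 2 * (4 * π / f) := by ring
  linarith [h.alpha_eq, h.delta_eq]

theorem alpha_eq_zero_of_gamma {i : Fin f} {v : S2} (hi : vert Q g i 2 = v) :
    vertexType Q g v 0 = 0 := by
  have h1 := vertexType_pos hi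
  subst hi
  by_contra hc
  have := h.classify_alpha (vtx_vert_mem (Q := Q) (g := g) i 2) (by omega)
  omega

/-- A tile has an angle `α` of some tile at its corner `B` or at its corner `D`. -/
theorem alpha_pos_or (i : Fin f) : 0 < vertexType Q g (vert Q g i 1) 0 ∨
    0 < vertexType Q g (vert Q g i 3) 0 := by
  by_contra! hc
  have h1 : ∀ j, vert Q g j 0 ≠ vert Q g i 1 := fun j hj => by
    have := vertexType_pos hj; omega
  have h3 : ∀ j, vert Q g j 0 ≠ vert Q g i 3 := fun j hj => by
    have := vertexType_pos hj; omega
  have hT := h.tiling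
  obtain ⟨j, hj, l, hjl, hl, hj0⟩ : ∃ j, i ≠ j ∧ ∃ l : Fin 4, Adj Q g i 0 j l ∧ (l = 0 ∨ l = 3) ∧
      vert Q g j 0 = vert Q g i 0 := by
    obtain ⟨j, hj, ⟨h4, h5, h6⟩ | ⟨h4, h5, h6⟩ | ⟨h4, h5, h6⟩ | ⟨h4, h5, h6⟩⟩ :=
      exists_nbr_zero h.isA2BC hT i
    · exact ⟨j, hj, 0, h4, Or.inl rfl, h5⟩
    · exact ⟨j, hj, 3, h4, Or.inr rfl, h5⟩
    · exact absurd h6 (h1 j)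
    · exact absurd h6 (h1 j)
  obtain ⟨j', hj', l', hjl', hl', hj0'⟩ : ∃ j, i ≠ j ∧ ∃ l : Fin 4, Adj Q g i 3 j l ∧
      (l = 0 ∨ l = 3) ∧ vert Q g j 0 = vert Q g i 0 := by
    obtain ⟨j, hj, ⟨h4, h5, h6⟩ | ⟨h4, h5, h6⟩ | ⟨h4, h5, h6⟩ | ⟨h4, h5, h6⟩⟩ :=
      exists_nbr_three h.isA2BC hT i
    · exact ⟨j, hj, 0, h4, Or.inl rfl, h5⟩
    · exact ⟨j, hj, 3, h4, Or.inr rfl, h5⟩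
    · exact absurd h6 (h3 j)
    · exact absurd h6 (h3 j)
  have hm := vtx_vert_mem (Q := Q) (g := g) i 0
  have hpos := vertexType_pos (rfl : vert Q g i 0 = _)
  -- The tiles across both a-sides have their α at the corner A of i. If they coincide, that vertex
  -- has degree two. If not, it has three α.
  by_cases hjj : j = j'
  · subst hjj
    have hll : l ≠ l' := by
      rintro rfl
      exact absurd (hjl.symm.unique hT hjl'.symm).2 (by decide)
    have hcl : ∀ t c, vert Q g t c = vert Q g i 0 → t ∈ ({i, j} : Set (Fin f)) := by
      intro t c ht
      refine mem_of_closed hT ⟨i, by simp, 0, rfl⟩ ?_ ht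
      rintro t (rfl | rfl) c hc b
      · obtain rfl := vert_injective _ hc
        cases b
        · exact ⟨j, by simp, l', hjl'⟩
        · exact ⟨j, by simp, l, hjl⟩
      · obtain rfl := vert_injective _ (hc.trans hj0.symm)
        refine ⟨i, by simp, ?_⟩
        have hs : sideAt 0 b = l ∨ sideAt 0 b = l' := by
          clear hc hjl hjl'
          revert hl hl' hll
          revert b l l'
          decide
        rcases hs with hs | hs <;> rw [hs]
        · exact ⟨0, hjl.symm⟩
        · exact ⟨3, hjl'.symm⟩
    have hc0 : ∀ t c, vert Q g t c = vert Q g i 0 → c = 0 := by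
      intro t c ht
      rcases hcl t c ht with rfl | rfl
      · exact vert_injective _ ht
      · exact vert_injective _ (ht.trans hj0.symm)
    have hz : ∀ c, c ≠ 0 → vertexType Q g (vert Q g i 0) c = 0 := by
      intro c hc
      by_contra hcc
      obtain ⟨t, ht⟩ := exists_vert_of_pos (Nat.pos_of_ne_zero hcc)
      exact hc (hc0 t c ht)
    have h2 : vertexType Q g (vert Q g i 0) 0 ≤ 2 := by
      rw [vertexType_eq_card]
      refine (Finset.card_le_card (t := {i, j}) ?_).trans Finset.card_le_two
      intro t ht
      have := hcl t 0 (by simpa using ht)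
      simpa using this
    have := three_le_of_mem hT hm
    rw [hz 1 (by decide), hz 2 (by decide), hz 3 (by decide)] at this
    omega
  · have := vertexType_ge_three (Q := Q) (g := g) rfl hj0 hj0' hj hj' hjj
    rcases h.classify_alpha hm hpos with h4 | ⟨h4, h5, -⟩
    · omega
    · rw [h4, h5] at hm
      have := h.alpha_count_le hm
      omega

/-- The tile with the only γ must be glued with its b- and c-sides reversed, which puts a γ at its
corners B and D. Vertices with γ have no α, against `alpha_pos_or`. -/
theorem beta_gamma_not_mem {n : ℕ} : vtx 0 1 1 n ∉ avc Q g := by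
  intro hm
  obtain ⟨v, -, hv⟩ := exists_of_mem_avc hm
  have hT := h.tiling
  obtain ⟨i, rfl⟩ := exists_vert_of_pos (Q := Q) (g := g) (v := v) (k := 2)
    (by rw [hv]; exact Nat.one_pos)
  have hu : ∀ j, i ≠ j → vert Q g j 2 ≠ vert Q g i 2 := fun j hj hc =>
    hj (eq_of_vertexType_eq_one (by rw [hv]; rfl) rfl hc)
  have hb : vertexType Q g (vert Q g i 1) 0 = 0 := by
    obtain ⟨j, hj, -, ⟨h2, h3⟩ | ⟨h2, h3⟩⟩ := exists_nbr_bc h.isA2BC hT i (k := 1) (Or.inl rfl)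
    · exact absurd h3 (hu j hj)
    · exact h.alpha_eq_zero_of_gamma h3
  have hd : vertexType Q g (vert Q g i 3) 0 = 0 := by
    obtain ⟨j, hj, -, ⟨h2, h3⟩ | ⟨h2, h3⟩⟩ := exists_nbr_bc h.isA2BC hT i (k := 2) (Or.inr rfl)
    · exact absurd h2 (hu j hj)
    · exact h.alpha_eq_zero_of_gamma h2
  have := h.alpha_pos_or i
  omega

/-- Without β, the two γ are mirrored across their b-side. Hence their c-sides are reversed, D
carries a γ and no α, and B must be αβ². One of the two tiles then has no possible neighbour across
DA. -/
theorem gamma_sq_not_mem {n : ℕ} (hn : 0 < n) : vtx 0 0 2 n ∉ avc Q g := by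
  intro hm
  obtain ⟨v, -, hv⟩ := exists_of_mem_avc hm
  have hT := h.tiling
  have hbn : ∀ i, vert Q g i 2 = v → ∃ j, Adj Q g i 1 j 1 ∧ vert Q g j 1 = vert Q g i 1 ∧
      vert Q g j 2 = v := by
    intro i hi
    obtain ⟨j, -, h1, ⟨h2, h3⟩ | ⟨h2, h3⟩⟩ := exists_nbr_bc h.isA2BC hT i (k := 1) (Or.inl rfl)
    · exact ⟨j, h1, h2, h3.trans hi⟩
    · have := vertexType_pos (h2.trans hi)
      rw [hv] at this
      exact absurd this (lt_irrefl 0)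
  have hd : ∀ i, vert Q g i 2 = v → vertexType Q g (vert Q g i 3) 0 = 0 := by
    intro i hi
    obtain ⟨j, hj, h1, ⟨h2, h3⟩ | ⟨h2, h3⟩⟩ := exists_nbr_bc h.isA2BC hT i (k := 2) (Or.inr rfl)
    -- A second mirrored gluing, along the c-side, would close up the vertex with the two γ alone,
    -- leaving no place for δ.
    · exfalso
      obtain ⟨j', h4, -, h5⟩ := hbn i hi
      have hjj : j = j' := by
        by_contra hc
        have := vertexType_ge_three hi (h2.trans hi) h5 hj h4.1 hc
        rw [hv] at this
        exact absurd this (by change ¬3 ≤ 2; omega)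
      subst hjj
      obtain ⟨s, hs⟩ := exists_vert_of_pos (Q := Q) (g := g) (v := v) (k := 3)
        (by rw [hv]; exact hn)
      have := mem_of_closed hT (v := v) (S := {i, j}) ⟨i, by simp, 2, hi⟩ (by
        rintro t (rfl | rfl) c hc b
        · obtain rfl := vert_injective _ (hc.trans hi.symm)
          cases b
          · exact ⟨j, by simp, 1, h4⟩
          · exact ⟨j, by simp, 2, h1⟩
        · obtain rfl := vert_injective _ (hc.trans h5.symm)
          cases b
          · exact ⟨i, by simp, 1, h4.symm⟩
          · exact ⟨i, by simp, 2, h1.symm⟩) hs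
      rcases this with rfl | rfl
      · exact absurd (vert_injective _ (hs.trans hi.symm)) (by decide)
      · exact absurd (vert_injective _ (hs.trans h5.symm)) (by decide)
    · exact h.alpha_eq_zero_of_gamma h2
  obtain ⟨i, hi⟩ := exists_vert_of_pos (Q := Q) (g := g) (v := v) (k := 2)
    (by rw [hv]; change 0 < 2; omega)
  obtain ⟨j, hij, hj1, hj2⟩ := hbn i hi
  have h0 : 0 < vertexType Q g (vert Q g i 1) 0 := by
    have := h.alpha_pos_or i
    rw [hd i hi] at this
    omega
  have hβ := vertexType_pos (rfl : vert Q g i 1 = _)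
  have hw := h.classify_alpha (vtx_vert_mem (Q := Q) (g := g) i 1) h0
  have ht : vertexType Q g (vert Q g i 1) = vtx 1 2 0 0 := by
    rw [eq_vtx (vertexType Q g _), vtx_inj]; omega
  obtain ⟨x, hx⟩ := exists_vert_of_pos h0
  obtain ⟨⟨y, -, hy1, hy0⟩, -⟩ := h.nbr_of_alpha_beta_sq (i := x) (by rw [hx, ht])
  rw [hx] at hy1
  have hy : vert Q g y 2 = v := by
    by_cases h1 : y = i
    · rw [h1, hi]
    · by_cases h2 : y = j
      · rw [h2, hj2]
      · have := vertexType_ge_three (Q := Q) (g := g) rfl hj1 hy1 hij.1 (Ne.symm h1) (Ne.symm h2)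
        rw [ht] at this
        exact absurd this (by decide)
  have hone : vertexType Q g (vert Q g y 0) 0 ≤ 1 := by
    have h1 := vertexType_pos (rfl : vert Q g y 0 = _)
    have h2 := vertexType_pos hy0.symm
    have := h.classify_alpha (vtx_vert_mem (Q := Q) (g := g) y 0) h1
    omega
  have hy3 : ∀ t, vert Q g t 0 ≠ vert Q g y 3 := fun t ht => by
    have := vertexType_pos ht
    rw [hd y hy] at this
    exact absurd this (lt_irrefl 0)
  -- The α of the tile across DA of y would lie at A, where the vertex αβ² has no second α, or at D,
  -- where there is no α.
  obtain ⟨t, hyt, ⟨-, h2, -⟩ | ⟨-, h2, -⟩ | ⟨-, -, h3⟩ | ⟨-, -, h3⟩⟩ :=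
    exists_nbr_three h.isA2BC hT y
  · exact hyt (eq_of_vertexType_eq_one hone rfl h2)
  · exact hyt (eq_of_vertexType_eq_one hone rfl h2)
  · exact hy3 t h3
  · exact hy3 t h3

theorem classify {k l m n : ℕ} (hm : vtx k l m n ∈ avc Q g) :
    (k = 1 ∧ l = 2 ∧ m = 0 ∧ n = 0) ∨ (k = 2 ∧ l = 0 ∧ m = 0 ∧ n = 2) ∨
      (k = 0 ∧ l = 0 ∧ m = 4 ∧ n = 0) ∨
      (k = 1 ∧ l = 0 ∧ m = 0 ∧ Even n ∧ 8 * n = f + 8) ∨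
      (k = 0 ∧ l = 2 ∧ m = 0 ∧ Even n ∧ 8 * n + 8 = f) ∨
      (k = 0 ∧ l = 0 ∧ m = 0 ∧ Even n ∧ 4 * n = f) := by
  have hs := angle_sum_of_mem h.tiling hm
  have hf : (f : ℝ) ≠ 0 := by exact_mod_cast h.pos.ne'
  have hπ := pi_ne_zero
  by_cases hk : k = 0
  · subst hk
    rcases h.classify_zero hm with ⟨rfl, rfl, -⟩ | ⟨rfl, rfl, hn, -⟩ | ⟨rfl, rfl, -, hn⟩ |
      ⟨rfl, rfl, -⟩ | ⟨rfl, rfl, hn, -⟩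
    · exact absurd hm h.beta_gamma_not_mem
    · have : (8 * n + 8 : ℝ) = f := by
        rw [h.beta_eq, h.delta_eq'] at hs
        push_cast at hs
        field_simp at hs
        exact mul_left_cancel₀ hπ (by linarith)
      have : 8 * n + 8 = f := by exact_mod_cast this
      simp [hn, this]
    · exact absurd hm (h.gamma_sq_not_mem (by omega))
    · have : (m : ℝ) = 4 := by
        rw [h.gamma_eq] at hs
        push_cast at hs
        field_simp at hs
        exact mul_left_cancel₀ hπ (by linarith)
      have : m = 4 := by exact_mod_cast this
      simp [this]
    · have : (4 * n : ℝ) = f := by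
        rw [h.delta_eq'] at hs
        push_cast at hs
        field_simp at hs
        exact mul_left_cancel₀ hπ (by linarith)
      have : 4 * n = f := by exact_mod_cast this
      simp [hn, this]
  · rcases h.classify_alpha hm (by omega) with h4 | ⟨rfl, rfl, hn, h4⟩
    · exact Or.inl h4
    · have hk2 := h.alpha_count_le hm
      obtain rfl | rfl : k = 1 ∨ k = 2 := by omega
      · have : (8 * n : ℝ) = f + 8 := by
          rw [h.alpha_eq, h.delta_eq'] at hs
          push_cast at hs
          field_simp at hs
          exact mul_left_cancel₀ hπ (by linarith)
        have : 8 * n = f + 8 := by exact_mod_cast this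
        simp [hn, this]
      · have : (n : ℝ) = 2 := by
          have h5 := angle_sum_of_mem h.tiling h.alpha_sq_delta_sq
          have p := Q.angle_pos 3
          push_cast at hs h5
          have : ((n : ℝ) - 2) * Q.angle 3 = 0 := by linarith
          rcases mul_eq_zero.1 this with h6 | h6
          · linarith
          · exact absurd h6 p.ne'
        have : n = 2 := by exact_mod_cast this
        simp [this]

end IsAB2Tiling
end Tiling

theorem mainTheorem3 (f : ℕ) (Q : QuadTile) (g : Fin f → E3 ≃ₗᵢ[ℝ] E3)
    (hQ : Q.IsA2BC) (hT : IsEdgeToEdgeTiling Q g)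
    (h3 : {t ∈ avc Q g | degree t = 3} = {vtx 1 2 0 0})
    (h4 : vtx 0 0 2 2 ∉ avc Q g) :
    ((f = 16 ∧ avc Q g = {vtx 1 2 0 0, vtx 2 0 0 2, vtx 0 0 4 0, vtx 0 0 0 4}) ∨
      (16 < f ∧ 8 ∣ f ∧
        {vtx 1 2 0 0, vtx 2 0 0 2, vtx 0 0 4 0} ⊆ avc Q g ∧
        avc Q g ⊆ {vtx 1 2 0 0, vtx 2 0 0 2, vtx 0 0 4 0,
          vtx 1 0 0 ((f + 8) / 8), vtx 0 2 0 ((f - 8) / 8), vtx 0 0 0 (f / 4)})) ∧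
    Q.angle 0 = π - 8 * π / f ∧
    Q.angle 1 = π / 2 + 4 * π / f ∧
    Q.angle 2 = π / 2 ∧
    Q.angle 3 = 8 * π / f := by
  have h : IsAB2Tiling Q g := ⟨hQ, hT, h3, h4⟩
  refine ⟨?_, h.alpha_eq, h.beta_eq, h.gamma_eq, h.delta_eq'⟩
  have hf8 : 8 < f := by
    have h1 := Q.angle_pos 0
    rw [h.alpha_eq] at h1
    have hf : (0 : ℝ) < f := by exact_mod_cast h.pos
    have h2 : 8 * π / f < π := by linarith
    rw [div_lt_iff₀ hf] at h2
    have : (8 : ℝ) < f := by nlinarith [pi_pos]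
    exact_mod_cast this
  -- αβ² has more α than δ, so some vertex has more δ than α. It belongs to one of the three δ-rich
  -- families.
  obtain ⟨k, l, m, n, hm, hp⟩ := exists_pos_of_balance (a := -1) (b := 0) (c := 0) (d := 1)
    (by norm_num) h.mem_avc (by norm_num)
  -- In each family the equation for n, with n even in the case δ^n, gives 8 ∣ f. For f = 16 it
  -- would give αδ³ or β²δ, which have odd n, or δ⁴.
  have hex : 8 ∣ f ∧ (f = 16 → k = 0 ∧ l = 0 ∧ m = 0 ∧ n = 4) := by
    rcases h.classify hm with h1 | h1 | h1 | ⟨h1, h2, h3, ⟨x, hx⟩, h5⟩ |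
      ⟨h1, h2, h3, ⟨x, hx⟩, h5⟩ | ⟨h1, h2, h3, ⟨x, hx⟩, h5⟩ <;> omega
  obtain ⟨⟨q, hq⟩, hδ⟩ := hex
  have hincl : {vtx 1 2 0 0, vtx 2 0 0 2, vtx 0 0 4 0} ⊆ avc Q g := by
    rintro t (rfl | rfl | rfl)
    · exact h.mem_avc
    · exact h.alpha_sq_delta_sq
    · exact h.gamma_pow_four
  by_cases hf : f = 16
  · refine Or.inl ⟨hf, Subset.antisymm ?_ ?_⟩
    · intro t ht
      rw [eq_vtx t] at ht ⊢
      simp only [mem_insert_iff, mem_singleton_iff, vtx_inj]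
      rcases h.classify ht with h1 | h1 | h1 | ⟨h1, h2, h3, ⟨x, hx⟩, h5⟩ |
        ⟨h1, h2, h3, ⟨x, hx⟩, h5⟩ | ⟨h1, h2, h3, ⟨x, hx⟩, h5⟩ <;> omega
    · obtain ⟨rfl, rfl, rfl, rfl⟩ := hδ hf
      rintro t (rfl | rfl | rfl | rfl)
      · exact h.mem_avc
      · exact h.alpha_sq_delta_sq
      · exact h.gamma_pow_four
      · exact hm
  · refine Or.inr ⟨by omega, ⟨q, hq⟩, hincl, ?_⟩
    intro t ht
    rw [eq_vtx t] at ht ⊢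
    simp only [mem_insert_iff, mem_singleton_iff, vtx_inj]
    rcases h.classify ht with h1 | h1 | h1 | ⟨h1, h2, h3, -, h5⟩ |
      ⟨h1, h2, h3, -, h5⟩ | ⟨h1, h2, h3, -, h5⟩ <;> omega
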